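/- Let $P=\{x\in\mathbb R^2:\ \ell_j(x)=\langle x,\nu_j\rangle+\lambda_j\ge 0,\ j=1,\dots,d\}$ be a strictly unbounded moment polygon: a convex polygonal region with edges $E_1,\dots,E_d$ and primitive interior normals $\nu_j=(\alpha_j,\beta_j)\in\mathbb Z^2$, such that the normals of any two intersecting edges form a $\mathbb Z$-basis of $\mathbb Z^2$, the unbounded edges are exactly $E_1$ and $E_d$ and they are not parallel, and consecutive edges meet with $\det(\nu_{j-1},\nu_j)=-1$. Let $\mathring P$ be the interior of $P$. Let $\nu=(\alpha,\beta)\in\mathbb R^2$ satisfy $\det(\nu,\nu_1)\ge 0$ and $\det(\nu,\nu_d)\ge 0$. On the half-plane $\mathbb H=\{(H,r):r>0\}$ put $$\xi=(\xi_1,\xi_2)=\nu_1\log r+\tfrac12\sum_{i=1}^{d-1}(\nu_{i+1}-\nu_i)\log\Big(H+a_i+\sqrt{(H+a_i)^2+r^2}\Big)+\nu H ,$$ and let $x=(x_1,x_2)$ be given by the primitives, with additive constants $c=(c_1,c_2)$, $$x_1=\beta_1H+\tfrac12\sum_{i=1}^{d-1}(\beta_{i+1}-\beta_i)\Big(H+a_i-\sqrt{(H+a_i)^2+r^2}\Big)-\tfrac12\beta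 r^2+c_1,$$ $$x_2=-\alpha_1H-\tfrac12\sum_{i=1}^{d-1}(\alpha_{i+1}-\alpha_i)\Big(H+a_i-\sqrt{(H+a_i)^2+r^2}\Big)+\tfrac12\alpha r^2+c_2$$ of $\epsilon_1=r(\partial_r\xi_2\,dH-\partial_H\xi_2\,dr)$ and $\epsilon_2=-r(\partial_r\xi_1\,dH-\partial_H\xi_1\,dr)$. Here the real numbers $a_1<\dots<a_{d-1}$ and the constants $c$ are determined by $P$ (up to a translation of the variable $H$) through $$\langle c,\nu_j\rangle+\lambda_j=\sum_{i=1}^{j-1}a_i\det(\nu_{i+1}-\nu_i,\nu_j),\qquad j=1,\dots,d,$$ which says that $H\mapsto x(H,0)$ parametrizes $\partial P$. Let ${\bf u}\in C^\infty(\mathring P)$ be a symplectic potential with $d{\bf u}=\xi_1\,dx_1+\xi_2\,dx_2$, that is, $\nabla{\bf u}(x(H,r))=\xi(H,r)$ on $\mathbb H$. Let $(X,g)$ be a smooth Riemannian $4$-manifold on which ${\bf u}$ defines the metric in action-angle coordinates: there is a smooth map $\Phi:\mathring P\times\mathbb R^2\to X$, $(x,\theta)\mapsto\Phi(x,\theta)$,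 with dense image and $$\Phi^*g=\sum_{j,k}{\bf u}_{jk}\,dx_j\,dx_k+\sum_{j,k}{\bf u}^{jk}\,d\theta_j\,d\theta_k ,$$ where $({\bf u}_{jk})$ is the Hessian of ${\bf u}$ and $({\bf u}^{jk})$ its inverse. (This is so for the scalar-flat toric Kähler metric with symplectic potential ${\bf u}$ on the symplectic toric $4$-manifold with moment polygon $P$; there $\Phi$ is $2\pi$-periodic in $\theta_1,\theta_2$ and identifies $\mathring P\times\mathbb T^2$ with the open dense set of points where the torus acts freely.) Then $\mathrm{Ric}(g)=0$ on $X$ if and only if there is a nonzero vector $\eta\in\mathbb R^2$ such that $$\eta\cdot\nu_j=1\quad\text{for all } j=1,\dots,d,\qquad\text{and}\qquad \eta\cdot\nu=0 .$$ -/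

import Mathlib

open Real Set Matrix Manifold
open scoped ContDiff Topology Bundle

noncomputable section

namespace ToricRicci

/-- The determinant `det(v, w) = v₁ w₂ - v₂ w₁` of two plane vectors. -/
def det2 {R : Type*} [CommRing R] (v w : Fin 2 → R) : R := v 0 * w 1 - v 1 * w 0

/-- An integral vector seen as a vector of `ℝ²`. -/
def toReal2 (v : Fin 2 → ℤ) : Fin 2 → ℝ := fun k => (v k : ℝ)

/-! ### Moment polygons -/

/-- The affine function `ℓ_j(x) = ⟨x, ν_j⟩ + λ_j`. -/
def ell {n : ℕ} (N : Fin (n + 1) → Fin 2 → ℤ) (lam : Fin (n + 1) → ℝ) (j : Fin (n + 1))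
    (x : Fin 2 → ℝ) : ℝ :=
  x ⬝ᵥ toReal2 (N j) + lam j

/-- The polygonal region `{x ∈ ℝ² : ℓ_j(x) ≥ 0 for all j}`. -/
def region {n : ℕ} (N : Fin (n + 1) → Fin 2 → ℤ) (lam : Fin (n + 1) → ℝ) : Set (Fin 2 → ℝ) :=
  {x | ∀ j, 0 ≤ ell N lam j x}

/-- The part of the polygonal region on the line `ℓ_j = 0`. -/
def edge {n : ℕ} (N : Fin (n + 1) → Fin 2 → ℤ) (lam : Fin (n + 1) → ℝ) (j : Fin (n + 1)) :
    Set (Fin 2 → ℝ) :=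
  {x | x ∈ region N lam ∧ ell N lam j x = 0}

/-- A strictly unbounded moment polygon with `d = n + 1` edges `E_1, …, E_d` (indexed here by
`0, …, n`) and primitive interior normals `ν_1, …, ν_d`, in the usual order: `E_1` and `E_d` are the
unbounded edges (and are not parallel), consecutive edges meet, and
`det(ν_{i-1}, ν_i) = -1`. -/
structure MomentPolygon (n : ℕ) where
  /-- the primitive interior normals `ν_j` -/
  normal : Fin (n + 1) → Fin 2 → ℤ
  /-- the constants `λ_j` -/
  offset : Fin (n + 1) → ℝ
  /-- `P` is a two-dimensional region -/
  interior_nonempty : (interior (region normal offset)).Nonempty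
  /-- each `E_j` is an edge, that is, more than a point -/
  edge_nontrivial : ∀ j, (edge normal offset j).Nontrivial
  /-- no edge is listed twice -/
  edge_injective : Function.Injective (edge normal offset)
  primitive : ∀ j, IsCoprime (normal j 0) (normal j 1)
  /-- the normals of two edges that meet form a basis of `ℤ²` -/
  basis : ∀ i j, i ≠ j → (edge normal offset i ∩ edge normal offset j).Nonempty →
    IsUnit (det2 (normal i) (normal j))
  unbounded_edges : ∀ j, ¬ Bornology.IsBounded (edge normal offset j) ↔ j = 0 ∨ j = Fin.last n
  consecutive_meet : ∀ i : Fin n,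
    (edge normal offset i.castSucc ∩ edge normal offset i.succ).Nonempty
  consecutive_det : ∀ i : Fin n, det2 (normal i.castSucc) (normal i.succ) = -1
  /-- the two unbounded edges are not parallel -/
  not_parallel : det2 (normal 0) (normal (Fin.last n)) ≠ 0

namespace MomentPolygon

variable {n : ℕ}

/-- The polygon as a subset of `ℝ²`. -/
def carrier (P : MomentPolygon n) : Set (Fin 2 → ℝ) := region P.normal P.offset

/-- The normals as vectors of `ℝ²`. -/
def nu (P : MomentPolygon n) (j : Fin (n + 1)) : Fin 2 → ℝ := toReal2 (P.normal j)

end MomentPolygon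

/-! ### The functions `ξ` and the action coordinates on the half-plane `r > 0` -/

/-- `ρ = √((H + a)² + r²)`. -/
def rho (a H r : ℝ) : ℝ := √((H + a) ^ 2 + r ^ 2)

/-- `ξ = log r · ν_1 + ½ ∑_{i=1}^{d-1} log (H + a_i + √((H+a_i)²+r²)) · (ν_{i+1} - ν_i) + H · ν`,
where `k = 0, 1` selects the coordinate `ξ_1`, `ξ_2`. -/
def xi {n : ℕ} (P : MomentPolygon n) (a : Fin n → ℝ) (nu : Fin 2 → ℝ) (k : Fin 2) (H r : ℝ) : ℝ :=
  P.nu 0 k * log r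
    + (1 / 2) * ∑ i : Fin n, (P.nu i.succ k - P.nu i.castSucc k) * log (H + a i + rho (a i) H r)
    + nu k * H

/-- The primitives `x_1`, `x_2` of the `1`-forms `ε_1 = r (∂_r ξ_2 dH - ∂_H ξ_2 dr)` and
`ε_2 = -r (∂_r ξ_1 dH - ∂_H ξ_1 dr)`, with additive constants `c_1`, `c_2`
(see `hasDerivAt_actionMap_H` and `hasDerivAt_actionMap_r`). -/
def actionMap {n : ℕ} (P : MomentPolygon n) (a : Fin n → ℝ) (nu c : Fin 2 → ℝ) (H r : ℝ) :
    Fin 2 → ℝ :=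
  ![P.nu 0 1 * H
      + (1 / 2) * ∑ i : Fin n, (P.nu i.succ 1 - P.nu i.castSucc 1) * (H + a i - rho (a i) H r)
      - nu 1 * r ^ 2 / 2 + c 0,
    -(P.nu 0 0 * H
      + (1 / 2) * ∑ i : Fin n, (P.nu i.succ 0 - P.nu i.castSucc 0) * (H + a i - rho (a i) H r)
      - nu 0 * r ^ 2 / 2) + c 1]

/-- The real numbers `a_1 < ⋯ < a_{d-1}` and the additive constants `c` are adjusted to the polygon:
`⟨c, ν_j⟩ + λ_j = ∑_{i=1}^{j-1} a_i det(ν_{i+1} - ν_i, ν_j)` for `j = 1, …, d`. This says that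
`H ↦ x(H, 0)` maps `-a_j < H < -a_{j-1}` into the line `ℓ_j = 0` for every `j` (where `a_0 = -∞`
and `a_d = +∞`). The system is triangular in the `a_i`; its solutions exist and are
unique up to a translation of the variable `H`. (If the first vertex of `P` is the origin, one may
take `c = 0` and `a_1 = 0`.) -/
def Adjusted {n : ℕ} (P : MomentPolygon n) (a : Fin n → ℝ) (c : Fin 2 → ℝ) : Prop :=
  ∀ j : Fin (n + 1), c ⬝ᵥ P.nu j + P.offset j
    = ∑ i : Fin n with i.castSucc < j, a i * det2 (P.nu i.succ - P.nu i.castSucc) (P.nu j)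

/-- `u` is a symplectic potential of the construction: a smooth function on the interior of `P`
with `du = ξ_1 dx_1 + ξ_2 dx_2`. -/
structure IsPotential {n : ℕ} (P : MomentPolygon n) (a : Fin n → ℝ) (nu c : Fin 2 → ℝ)
    (u : (Fin 2 → ℝ) → ℝ) : Prop where
  smooth : ContDiffOn ℝ ∞ u (interior P.carrier)
  grad : ∀ H r : ℝ, 0 < r → ∀ k : Fin 2,
    fderiv ℝ u (actionMap P a nu c H r) (Pi.single k 1) = xi P a nu k H r

/-! ### Toric Kähler metrics in action-angle coordinates -/

/-- The Hessian matrix of a function on `ℝ²`. -/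
def hess (u : (Fin 2 → ℝ) → ℝ) (x : Fin 2 → ℝ) : Matrix (Fin 2) (Fin 2) ℝ :=
  Matrix.of fun j k =>
    fderiv ℝ (fun y => fderiv ℝ u y (Pi.single k 1)) x (Pi.single j 1)

/-- The metric `∑ u_{jk} dx_j dx_k + ∑ u^{jk} dθ_j dθ_k` at a point over `x`, evaluated on the two
tangent vectors `v = (v_x, v_θ)` and `w = (w_x, w_θ)`; here `(u^{jk})` is the inverse of the
Hessian `(u_{jk})` of `u`. -/
def toricMetric (u : (Fin 2 → ℝ) → ℝ) (x : Fin 2 → ℝ) (v w : (Fin 2 → ℝ) × (Fin 2 → ℝ)) : ℝ :=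
  v.1 ⬝ᵥ (hess u x *ᵥ w.1) + v.2 ⬝ᵥ ((hess u x)⁻¹ *ᵥ w.2)

/-! ### The Ricci tensor of a Riemannian manifold -/

/-- The partial derivative `∂_i f`. -/
def pd {m : ℕ} (i : Fin m) (f : EuclideanSpace ℝ (Fin m) → ℝ) (y : EuclideanSpace ℝ (Fin m)) : ℝ :=
  fderiv ℝ f y (EuclideanSpace.single i 1)

/-- The Christoffel symbols
`Γ^k_{ij} = ½ ∑_l g^{kl} (∂_i g_{jl} + ∂_j g_{il} - ∂_l g_{ij})`. -/
def christoffel {m : ℕ} (G : EuclideanSpace ℝ (Fin m) → Matrix (Fin m) (Fin m) ℝ)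
    (k i j : Fin m) (y : EuclideanSpace ℝ (Fin m)) : ℝ :=
  (1 / 2) * ∑ l, (G y)⁻¹ k l *
    (pd i (fun z => G z j l) y + pd j (fun z => G z i l) y - pd l (fun z => G z i j) y)

/-- The Ricci tensor `R_{ij} = ∑_k (∂_k Γ^k_{ij} - ∂_j Γ^k_{ik})
+ ∑_{k,l} (Γ^k_{kl} Γ^l_{ij} - Γ^k_{jl} Γ^l_{ik})`. -/
def ricci {m : ℕ} (G : EuclideanSpace ℝ (Fin m) → Matrix (Fin m) (Fin m) ℝ)
    (i j : Fin m) (y : EuclideanSpace ℝ (Fin m)) : ℝ :=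
  ∑ k, (pd k (christoffel G k i j) y - pd j (christoffel G k i k) y)
    + ∑ k, ∑ l, (christoffel G k k l y * christoffel G l i j y
        - christoffel G k j l y * christoffel G l i k y)

section Manifold

variable {m : ℕ} {X : Type*} [TopologicalSpace X] [ChartedSpace (EuclideanSpace ℝ (Fin m)) X]
  [IsManifold (𝓡 m) ∞ X]

/-- The matrix `(g_{ij})` of a Riemannian metric in a chart `e`, as a function on the
target of `e`. -/
def metricInChart
    (g : Bundle.ContMDiffRiemannianMetric (𝓡 m) ∞ (EuclideanSpace ℝ (Fin m))
      (fun p : X => TangentSpace (𝓡 m) p))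
    (e : OpenPartialHomeomorph X (EuclideanSpace ℝ (Fin m))) (y : EuclideanSpace ℝ (Fin m)) :
    Matrix (Fin m) (Fin m) ℝ :=
  Matrix.of fun i j => g.inner (e.symm y)
    (mfderiv (𝓡 m) (𝓡 m) e.symm y (EuclideanSpace.single i (1 : ℝ)))
    (mfderiv (𝓡 m) (𝓡 m) e.symm y (EuclideanSpace.single j (1 : ℝ)))

/-- `Ric(g) = 0`: the components of the Ricci tensor vanish in every chart of the atlas. -/
def RicciFlat
    (g : Bundle.ContMDiffRiemannianMetric (𝓡 m) ∞ (EuclideanSpace ℝ (Fin m))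
      (fun p : X => TangentSpace (𝓡 m) p)) : Prop :=
  ∀ e ∈ atlas (EuclideanSpace ℝ (Fin m)) X, ∀ y ∈ e.target, ∀ i j,
    ricci (metricInChart g e) i j y = 0

end Manifold

/-- Action-angle coordinates for the metric with symplectic potential `u`: a smooth map
`Φ : P̊ × ℝ² → X`, `(x, θ) ↦ Φ(x, θ)`, which has dense image and pulls `g` back to
`∑ u_{jk} dx_j dx_k + ∑ u^{jk} dθ_j dθ_k`. On a symplectic toric manifold with
moment polygon `P`, the map `Φ` is `2π`-periodic in `θ_1, θ_2` and identifies `P̊ × 𝕋²` with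
the open dense set of points with free torus orbit. -/
structure IsActionAngle {n : ℕ} (P : MomentPolygon n) (u : (Fin 2 → ℝ) → ℝ)
    {X : Type*} [TopologicalSpace X] [ChartedSpace (EuclideanSpace ℝ (Fin 4)) X]
    [IsManifold (𝓡 4) ∞ X]
    (g : Bundle.ContMDiffRiemannianMetric (𝓡 4) ∞ (EuclideanSpace ℝ (Fin 4))
      (fun p : X => TangentSpace (𝓡 4) p))
    (Φ : (Fin 2 → ℝ) × (Fin 2 → ℝ) → X) : Prop where
  smooth : ContMDiffOn 𝓘(ℝ, (Fin 2 → ℝ) × (Fin 2 → ℝ)) (𝓡 4) ∞ Φ (interior P.carrier ×ˢ univ)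
  dense : Dense (Φ '' (interior P.carrier ×ˢ univ))
  pullback : ∀ q ∈ interior P.carrier ×ˢ (univ : Set (Fin 2 → ℝ)),
    ∀ v w : (Fin 2 → ℝ) × (Fin 2 → ℝ),
      g.inner (Φ q) (mfderiv 𝓘(ℝ, (Fin 2 → ℝ) × (Fin 2 → ℝ)) (𝓡 4) Φ q v)
        (mfderiv 𝓘(ℝ, (Fin 2 → ℝ) × (Fin 2 → ℝ)) (𝓡 4) Φ q w) = toricMetric u q.1 v w

/-! ### The action coordinates are primitives of `ε_1`, `ε_2` -/

theorem rho_pos {a H r : ℝ} (hr : 0 < r) : 0 < rho a H r := by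
  unfold rho; positivity

theorem add_rho_pos {a H r : ℝ} (hr : 0 < r) : 0 < H + a + rho a H r := by
  have h : |H + a| < rho a H r := by
    unfold rho
    rw [← Real.sqrt_sq_eq_abs]
    exact Real.sqrt_lt_sqrt (sq_nonneg _) (by nlinarith [sq_pos_of_pos hr])
  linarith [neg_abs_le (H + a)]

theorem hasDerivAt_rho_H {a H r : ℝ} (hr : 0 < r) :
    HasDerivAt (fun h => rho a h r) ((H + a) / rho a H r) H := by
  have h1 : HasDerivAt (fun h : ℝ => (h + a) ^ 2 + r ^ 2) (2 * (H + a)) H := by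
    simpa using (((hasDerivAt_id H).add_const a).pow 2).add_const (r ^ 2)
  have h2 := h1.sqrt (by positivity)
  refine h2.congr_deriv ?_
  have := (rho_pos (a := a) (H := H) hr).ne'
  unfold rho at *
  field_simp

theorem hasDerivAt_rho_r {a H r : ℝ} (hr : 0 < r) :
    HasDerivAt (fun s => rho a H s) (r / rho a H r) r := by
  have h1 : HasDerivAt (fun s : ℝ => (H + a) ^ 2 + s ^ 2) (2 * r) r := by
    simpa using ((hasDerivAt_id r).pow 2).const_add ((H + a) ^ 2)
  have h2 := h1.sqrt (by positivity)
  refine h2.congr_deriv ?_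
  have := (rho_pos (a := a) (H := H) hr).ne'
  unfold rho at *
  field_simp

theorem hasDerivAt_xi_H {n : ℕ} (P : MomentPolygon n) (a : Fin n → ℝ) (nu : Fin 2 → ℝ)
    (k : Fin 2) {H r : ℝ} (hr : 0 < r) :
    HasDerivAt (fun h => xi P a nu k h r)
      ((1 / 2) * ∑ i : Fin n, (P.nu i.succ k - P.nu i.castSucc k) * (1 / rho (a i) H r) + nu k)
      H := by
  have hs : HasDerivAt (fun h => ∑ i : Fin n, (P.nu i.succ k - P.nu i.castSucc k) *
      log (h + a i + rho (a i) h r))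
      (∑ i : Fin n, (P.nu i.succ k - P.nu i.castSucc k) * (1 / rho (a i) H r)) H := by
    refine HasDerivAt.fun_sum fun i _ => HasDerivAt.const_mul _ ?_
    have h1 := (((hasDerivAt_id H).add_const (a i)).add (hasDerivAt_rho_H (a := a i) hr)).log
      (add_rho_pos (a := a i) (H := H) hr).ne'
    refine h1.congr_deriv ?_
    have e1 := (rho_pos (a := a i) (H := H) hr).ne'
    have e2 := (add_rho_pos (a := a i) (H := H) hr).ne'
    simp only [Pi.add_apply, id]
    field_simp
    ring
  exact (((hs.const_mul (1 / 2)).const_add (P.nu 0 k * log r)).add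
    ((hasDerivAt_id H).const_mul (nu k))).congr_deriv (by ring)

theorem hasDerivAt_xi_r {n : ℕ} (P : MomentPolygon n) (a : Fin n → ℝ) (nu : Fin 2 → ℝ)
    (k : Fin 2) {H r : ℝ} (hr : 0 < r) :
    HasDerivAt (fun s => xi P a nu k H s)
      (P.nu 0 k / r + (1 / 2) * ∑ i : Fin n, (P.nu i.succ k - P.nu i.castSucc k) *
        ((1 - (H + a i) / rho (a i) H r) / r)) r := by
  have hs : HasDerivAt (fun s => ∑ i : Fin n, (P.nu i.succ k - P.nu i.castSucc k) *
      log (H + a i + rho (a i) H s))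
      (∑ i : Fin n, (P.nu i.succ k - P.nu i.castSucc k) *
        ((1 - (H + a i) / rho (a i) H r) / r)) r := by
    refine HasDerivAt.fun_sum fun i _ => HasDerivAt.const_mul _ ?_
    have h1 := ((hasDerivAt_rho_r (a := a i) (H := H) hr).const_add (H + a i)).log
      (add_rho_pos (a := a i) (H := H) hr).ne'
    refine h1.congr_deriv ?_
    have e1 := (rho_pos (a := a i) (H := H) hr).ne'
    have e2 := (add_rho_pos (a := a i) (H := H) hr).ne'
    have e3 : rho (a i) H r ^ 2 = (H + a i) ^ 2 + r ^ 2 := by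
      unfold rho; exact Real.sq_sqrt (by positivity)
    field_simp
    linear_combination -e3
  have h3 := (((Real.hasDerivAt_log hr.ne').const_mul (P.nu 0 k)).add
    (hs.const_mul (1 / 2))).add_const (nu k * H)
  simpa [xi, div_eq_mul_inv] using h3

/-- `∂x_1/∂H = r ∂_r ξ_2` and `∂x_2/∂H = -r ∂_r ξ_1`. -/
theorem hasDerivAt_actionMap_H {n : ℕ} (P : MomentPolygon n) (a : Fin n → ℝ) (nu c : Fin 2 → ℝ)
    {H r : ℝ} (hr : 0 < r) :
    HasDerivAt (fun h => actionMap P a nu c h r)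
      ![r * deriv (fun s => xi P a nu 1 H s) r, -(r * deriv (fun s => xi P a nu 0 H s) r)] H := by
  have key : ∀ k : Fin 2, HasDerivAt (fun h => P.nu 0 k * h + (1 / 2) * ∑ i : Fin n,
      (P.nu i.succ k - P.nu i.castSucc k) * (h + a i - rho (a i) h r) - nu k * r ^ 2 / 2)
      (r * deriv (fun s => xi P a nu k H s) r) H := by
    intro k
    have hs : HasDerivAt (fun h => ∑ i : Fin n, (P.nu i.succ k - P.nu i.castSucc k) *
        (h + a i - rho (a i) h r)) (∑ i : Fin n, (P.nu i.succ k - P.nu i.castSucc k) *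
        (1 - (H + a i) / rho (a i) H r)) H :=
      HasDerivAt.fun_sum fun i _ => HasDerivAt.const_mul _
        (((hasDerivAt_id H).add_const (a i)).sub (hasDerivAt_rho_H hr))
    refine ((((hasDerivAt_id H).const_mul (P.nu 0 k)).add
      (hs.const_mul (1 / 2))).sub_const (nu k * r ^ 2 / 2)).congr_deriv ?_
    have e : r * ∑ i : Fin n, (P.nu i.succ k - P.nu i.castSucc k) *
        ((1 - (H + a i) / rho (a i) H r) / r) = ∑ i : Fin n,
        (P.nu i.succ k - P.nu i.castSucc k) * (1 - (H + a i) / rho (a i) H r) := by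
      rw [Finset.mul_sum]
      refine Finset.sum_congr rfl fun i _ => ?_
      field_simp
    have e' : r * (P.nu 0 k / r) = P.nu 0 k := by field_simp
    rw [(hasDerivAt_xi_r P a nu k hr).deriv]
    linear_combination (-1 / 2) * e - e'
  rw [hasDerivAt_pi]
  intro k
  fin_cases k
  · exact (key 1).add_const (c 0)
  · exact (key 0).neg.add_const (c 1)

/-- `∂x_1/∂r = -r ∂_H ξ_2` and `∂x_2/∂r = r ∂_H ξ_1`. -/
theorem hasDerivAt_actionMap_r {n : ℕ} (P : MomentPolygon n) (a : Fin n → ℝ) (nu c : Fin 2 → ℝ)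
    {H r : ℝ} (hr : 0 < r) :
    HasDerivAt (fun s => actionMap P a nu c H s)
      ![-(r * deriv (fun h => xi P a nu 1 h r) H), r * deriv (fun h => xi P a nu 0 h r) H] r := by
  have key : ∀ k : Fin 2, HasDerivAt (fun s => P.nu 0 k * H + (1 / 2) * ∑ i : Fin n,
      (P.nu i.succ k - P.nu i.castSucc k) * (H + a i - rho (a i) H s) - nu k * s ^ 2 / 2)
      (-(r * deriv (fun h => xi P a nu k h r) H)) r := by
    intro k
    have hs : HasDerivAt (fun s => ∑ i : Fin n, (P.nu i.succ k - P.nu i.castSucc k) *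
        (H + a i - rho (a i) H s)) (∑ i : Fin n, (P.nu i.succ k - P.nu i.castSucc k) *
        (-(r / rho (a i) H r))) r :=
      HasDerivAt.fun_sum fun i _ => HasDerivAt.const_mul _
        ((hasDerivAt_rho_r hr).const_sub (H + a i))
    have hq : HasDerivAt (fun s : ℝ => nu k * s ^ 2 / 2) (nu k * r) r := by
      refine (((hasDerivAt_pow 2 r).const_mul (nu k)).div_const 2).congr_deriv ?_
      simp only [Nat.cast_ofNat, Nat.add_one_sub_one, pow_one]
      ring
    refine (((hs.const_mul (1 / 2)).const_add (P.nu 0 k * H)).sub hq).congr_deriv ?_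
    have e : ∑ i : Fin n, (P.nu i.succ k - P.nu i.castSucc k) * (-(r / rho (a i) H r))
        = -r * ∑ i : Fin n, (P.nu i.succ k - P.nu i.castSucc k) * (1 / rho (a i) H r) := by
      rw [Finset.mul_sum]
      refine Finset.sum_congr rfl fun i _ => ?_
      ring
    rw [(hasDerivAt_xi_H P a nu k hr).deriv]
    linear_combination (1 / 2) * e
  rw [hasDerivAt_pi]
  intro k
  fin_cases k
  · exact (key 1).add_const (c 0)
  · exact ((key 0).neg.congr_deriv (neg_neg _)).add_const (c 1)

end ToricRicci

end

/-!
# Ricci-flat scalar-flat toric metrics on strictly unbounded moment polygons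

A toric metric `∑ U_{jk} dx_j dx_k + ∑ U^{jk} dθ_j dθ_k` with `U` a Hessian matrix is Kähler, and
its Ricci form is governed by `log det U`: the Ricci tensor vanishes if and only if the vector field
`W = U⁻¹ ∇ log det U` is locally constant (`IsHessianLike.ricciTensor_eq_zero_iff`). This is
computed directly from the Christoffel symbols. Since the Ricci tensor transforms as a tensor
(`IsMetricPullback.ricciTensor_eq`) and is continuous, and the image of the action-angle coordinates
is dense, `g` is Ricci-flat if and only if `W` has derivative zero on the interior of the polygon
(`IsActionAngle.ricciFlat_iff`).

For the potential at hand, `∇u = ξ`, and differentiating along `x(H, r)` expresses the Hessian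
through the derivatives of `ξ` and gives `det U = r⁻²` (`IsPotential.det_hess`). In the coordinates
`ξ` the field `W` is the gradient of `log det U = -2 log r`, which means that `W` pairs to `0` with
`∂ξ/∂H` and to `-2 / r` with `∂ξ/∂r`. So `W` equals a constant vector `-2 η` exactly when
`⟨η, ξ⟩ = log r` up to a constant. By the formula for `ξ` and the independence of the functions
`1 / ρ_i` (`MomentPolygon.eq_zero_of_sum_div_rho`) this says that `⟨η, ν_j⟩ = 1` for all `j` and
`⟨η, ν⟩ = 0` (`MomentPolygon.dotProduct_xiDeriv_iff`).

Two geometric facts make these computations meaningful. The map `(H, r) ↦ ξ` has positive Jacobian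
determinant (`MomentPolygon.det2_xiDeriv_pos`), by concavity of the unit half-circle and the
clockwise turning of the normals. The map `(H, r) ↦ x` is onto the interior of the polygon
(`MomentPolygon.exists_actionMap_eq`): it is open, proper, and maps the boundary of the half-plane
to the boundary of the polygon.
-/

noncomputable section

namespace ToricRicci

/-! ### Calculus of matrix-valued functions -/

section Calculus

variable {E : Type*} [NormedAddCommGroup E] [NormedSpace ℝ E] {ι κ μ : Type*}

/-- The derivative of `f` along the vector `b i`; a family `b` of vectors plays the role of a
coordinate frame. -/
def dirDeriv (b : ι → E) (i : ι) (f : E → ℝ) (y : E) : ℝ := fderiv ℝ f y (b i)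

/-- The entrywise derivative of a matrix-valued function along the vector `b i`. -/
def matDeriv (b : ι → E) (i : ι) (A : E → Matrix κ μ ℝ) (y : E) : Matrix κ μ ℝ :=
  Matrix.of fun k l => dirDeriv b i (fun z => A z k l) y

/-- A matrix-valued function is smooth at a point if its entries are. -/
def MatSmoothAt (A : E → Matrix κ μ ℝ) (y : E) : Prop :=
  ∀ k l, ContDiffAt ℝ ∞ (fun z => A z k l) y

variable {b : ι → E} {i j : ι} {y : E}

theorem contDiffAt_dirDeriv {f : E → ℝ} (hf : ContDiffAt ℝ ∞ f y) (i : ι) :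
    ContDiffAt ℝ ∞ (dirDeriv b i f) y :=
  (hf.fderiv_right (m := ∞) (by simp)).clm_apply contDiffAt_const

theorem dirDeriv_congr {f g : E → ℝ} (h : f =ᶠ[𝓝 y] g) : dirDeriv b i f y = dirDeriv b i g y := by
  unfold dirDeriv; rw [h.fderiv_eq]

theorem dirDeriv_add {f g : E → ℝ} (hf : ContDiffAt ℝ ∞ f y) (hg : ContDiffAt ℝ ∞ g y) :
    dirDeriv b i (fun z => f z + g z) y = dirDeriv b i f y + dirDeriv b i g y := by
  unfold dirDeriv
  rw [fderiv_fun_add (hf.differentiableAt (by simp)) (hg.differentiableAt (by simp))]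
  rfl

theorem dirDeriv_mul {f g : E → ℝ} (hf : ContDiffAt ℝ ∞ f y) (hg : ContDiffAt ℝ ∞ g y) :
    dirDeriv b i (fun z => f z * g z) y = dirDeriv b i f y * g y + f y * dirDeriv b i g y := by
  unfold dirDeriv
  rw [fderiv_fun_mul (hf.differentiableAt (by simp)) (hg.differentiableAt (by simp))]
  simp only [_root_.add_apply, _root_.smul_apply, smul_eq_mul]
  ring

theorem dirDeriv_const_mul {f : E → ℝ} (c : ℝ) (hf : ContDiffAt ℝ ∞ f y) :
    dirDeriv b i (fun z => c * f z) y = c * dirDeriv b i f y := by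
  unfold dirDeriv
  rw [fderiv_const_mul (hf.differentiableAt (by simp))]
  rfl

theorem dirDeriv_sum {α : Type*} {s : Finset α} {f : α → E → ℝ}
    (hf : ∀ a ∈ s, ContDiffAt ℝ ∞ (f a) y) :
    dirDeriv b i (fun z => ∑ a ∈ s, f a z) y = ∑ a ∈ s, dirDeriv b i (f a) y := by
  unfold dirDeriv
  rw [fderiv_fun_sum fun a ha => (hf a ha).differentiableAt (by simp)]
  simp

theorem dirDeriv_comm {f : E → ℝ} (hf : ContDiffAt ℝ ∞ f y) (i j : ι) :
    dirDeriv b i (dirDeriv b j f) y = dirDeriv b j (dirDeriv b i f) y := by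
  have hd : DifferentiableAt ℝ (fderiv ℝ f) y :=
    (hf.fderiv_right (m := ∞) (by simp)).differentiableAt (by simp)
  have hs : IsSymmSndFDerivAt ℝ f y := hf.isSymmSndFDerivAt (by
    simp only [minSmoothness_of_isRCLikeNormedField]; exact ENat.LEInfty.out)
  have key : ∀ i j, dirDeriv b i (dirDeriv b j f) y = fderiv ℝ (fderiv ℝ f) y (b i) (b j) := by
    intro i j
    unfold dirDeriv
    rw [fderiv_clm_apply hd (by fun_prop)]
    simp
  rw [key, key, hs.eq]

theorem MatSmoothAt.sum {α : Type*} {s : Finset α} {A : α → E → Matrix κ μ ℝ}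
    (hA : ∀ a ∈ s, MatSmoothAt (A a) y) : MatSmoothAt (fun z => ∑ a ∈ s, A a z) y := by
  intro k l
  simp only [Matrix.sum_apply]
  exact ContDiffAt.sum fun a ha => hA a ha k l

theorem MatSmoothAt.smul {f : E → ℝ} {A : E → Matrix κ μ ℝ} (hf : ContDiffAt ℝ ∞ f y)
    (hA : MatSmoothAt A y) : MatSmoothAt (fun z => f z • A z) y := fun k l => hf.mul (hA k l)

theorem MatSmoothAt.mul {ν : Type*} [Fintype μ] {A : E → Matrix κ μ ℝ} {B : E → Matrix μ ν ℝ}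
    (hA : MatSmoothAt A y) (hB : MatSmoothAt B y) : MatSmoothAt (fun z => A z * B z) y := by
  intro k l
  simp only [Matrix.mul_apply]
  exact ContDiffAt.sum fun a _ => (hA k a).mul (hB a l)

theorem MatSmoothAt.transpose {A : E → Matrix κ μ ℝ} (hA : MatSmoothAt A y) :
    MatSmoothAt (fun z => (A z)ᵀ) y := fun k l => hA l k

theorem MatSmoothAt.matDeriv {A : E → Matrix κ μ ℝ} (hA : MatSmoothAt A y) (i : ι) :
    MatSmoothAt (matDeriv b i A) y := fun k l => contDiffAt_dirDeriv (hA k l) i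

theorem MatSmoothAt.det [Fintype κ] [DecidableEq κ] {A : E → Matrix κ κ ℝ}
    (hA : MatSmoothAt A y) : ContDiffAt ℝ ∞ (fun z => (A z).det) y := by
  simp only [Matrix.det_apply]
  exact ContDiffAt.sum fun σ _ => (contDiffAt_prod fun k _ => hA _ _).const_smul _

theorem MatSmoothAt.inv [Fintype κ] [DecidableEq κ] {A : E → Matrix κ κ ℝ}
    (hA : MatSmoothAt A y) (hdet : IsUnit (A y).det) : MatSmoothAt (fun z => (A z)⁻¹) y := by
  intro k l
  simp only [Matrix.inv_def, Ring.inverse_eq_inv', Matrix.smul_apply, smul_eq_mul,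
    Matrix.adjugate_apply]
  refine (hA.det.inv hdet.ne_zero).mul ?_
  refine MatSmoothAt.det fun p q => ?_
  by_cases hp : p = l
  · subst hp; simpa using contDiffAt_const
  · simpa [Matrix.updateRow_ne hp] using hA p q

theorem matDeriv_congr {A B : E → Matrix κ μ ℝ} (h : A =ᶠ[𝓝 y] B) :
    matDeriv b i A y = matDeriv b i B y := by
  ext k l
  exact dirDeriv_congr (h.mono fun z hz => by simp only [hz])

theorem matDeriv_add {A B : E → Matrix κ μ ℝ} (hA : MatSmoothAt A y) (hB : MatSmoothAt B y) :
    matDeriv b i (fun z => A z + B z) y = matDeriv b i A y + matDeriv b i B y := by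
  ext k l
  exact dirDeriv_add (hA k l) (hB k l)

theorem matDeriv_sum {α : Type*} {s : Finset α} {A : α → E → Matrix κ μ ℝ}
    (hA : ∀ a ∈ s, MatSmoothAt (A a) y) :
    matDeriv b i (fun z => ∑ a ∈ s, A a z) y = ∑ a ∈ s, matDeriv b i (A a) y := by
  ext k l
  simp only [matDeriv, Matrix.sum_apply, Matrix.of_apply]
  exact dirDeriv_sum fun a ha => hA a ha k l

theorem matDeriv_smul {f : E → ℝ} {A : E → Matrix κ μ ℝ} (hf : ContDiffAt ℝ ∞ f y)
    (hA : MatSmoothAt A y) :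
    matDeriv b i (fun z => f z • A z) y = dirDeriv b i f y • A y + f y • matDeriv b i A y := by
  ext k l
  exact dirDeriv_mul hf (hA k l)

theorem matDeriv_mul {ν : Type*} [Fintype μ] {A : E → Matrix κ μ ℝ} {B : E → Matrix μ ν ℝ}
    (hA : MatSmoothAt A y) (hB : MatSmoothAt B y) :
    matDeriv b i (fun z => A z * B z) y = matDeriv b i A y * B y + A y * matDeriv b i B y := by
  ext k l
  simp only [matDeriv, Matrix.mul_apply, Matrix.add_apply, Matrix.of_apply]
  rw [dirDeriv_sum fun a _ => (hA k a).mul (hB a l), ← Finset.sum_add_distrib]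
  exact Finset.sum_congr rfl fun a _ => dirDeriv_mul (hA k a) (hB a l)

theorem matDeriv_transpose {A : E → Matrix κ μ ℝ} :
    matDeriv b i (fun z => (A z)ᵀ) y = (matDeriv b i A y)ᵀ := rfl

theorem matSmoothAt_const (A : Matrix κ μ ℝ) (y : E) : MatSmoothAt (fun _ => A) y :=
  fun _ _ => contDiffAt_const

theorem matDeriv_const (b : ι → E) (i : ι) (A : Matrix κ μ ℝ) (y : E) :
    matDeriv b i (fun _ => A) y = 0 := by
  ext k l
  simp [matDeriv, dirDeriv]

theorem matDeriv_const_smul {A : E → Matrix κ μ ℝ} (c : ℝ) (hA : MatSmoothAt A y) :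
    matDeriv b i (fun z => c • A z) y = c • matDeriv b i A y := by
  ext k l
  exact dirDeriv_const_mul c (hA k l)

theorem contDiffAt_trace [Fintype κ] {A : E → Matrix κ κ ℝ} (hA : MatSmoothAt A y) :
    ContDiffAt ℝ ∞ (fun z => (A z).trace) y :=
  ContDiffAt.sum fun k _ => hA k k

theorem dirDeriv_trace [Fintype κ] {A : E → Matrix κ κ ℝ} (hA : MatSmoothAt A y) :
    dirDeriv b i (fun z => (A z).trace) y = (matDeriv b i A y).trace :=
  dirDeriv_sum fun k _ => hA k k

theorem matDeriv_comm {A : E → Matrix κ μ ℝ} (hA : MatSmoothAt A y) (i j : ι) :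
    matDeriv b i (matDeriv b j A) y = matDeriv b j (matDeriv b i A) y := by
  ext k l
  exact dirDeriv_comm (hA k l) i j

/-- `∂(A⁻¹) = -A⁻¹ (∂A) A⁻¹`, from differentiating `A⁻¹ A = 1`. -/
theorem matDeriv_inv [Fintype κ] [DecidableEq κ] {A : E → Matrix κ κ ℝ}
    (hA : MatSmoothAt A y) (hdet : IsUnit (A y).det) :
    matDeriv b i (fun z => (A z)⁻¹) y = -((A y)⁻¹ * matDeriv b i A y * (A y)⁻¹) := by
  have h1 : matDeriv b i (fun z => (A z)⁻¹ * A z) y = 0 := by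
    have hev : (fun z => (A z)⁻¹ * A z) =ᶠ[𝓝 y] fun _ => 1 := by
      filter_upwards [hA.det.continuousAt.eventually_ne hdet.ne_zero] with z hz
      exact Matrix.nonsing_inv_mul _ (isUnit_iff_ne_zero.2 hz)
    rw [matDeriv_congr hev]
    ext k l
    simp [matDeriv, dirDeriv]
  rw [matDeriv_mul (hA.inv hdet) hA] at h1
  have h2 := congrArg (· * (A y)⁻¹) h1
  simp only [add_mul, zero_mul, Matrix.mul_assoc, Matrix.mul_nonsing_inv _ hdet, mul_one] at h2
  rw [Matrix.mul_assoc]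
  exact eq_neg_of_add_eq_zero_left h2

end Calculus

/-! ### The Ricci tensor of a metric with respect to a frame -/

section Ricci

variable {E : Type*} [NormedAddCommGroup E] [NormedSpace ℝ E] {ι : Type*}

/-- The Christoffel symbols of the first kind,
`½ (∂_i g_{jl} + ∂_j g_{il} - ∂_l g_{ij})`. -/
def lowerChristoffel (b : ι → E) (G : E → Matrix ι ι ℝ) (i j l : ι) (y : E) : ℝ :=
  (1 / 2) * (dirDeriv b i (fun z => G z j l) y + dirDeriv b j (fun z => G z i l) y
    - dirDeriv b l (fun z => G z i j) y)

variable {b : ι → E} {G : E → Matrix ι ι ℝ} {y : E}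

theorem contDiffAt_lowerChristoffel (hG : MatSmoothAt G y) (i j l : ι) :
    ContDiffAt ℝ ∞ (lowerChristoffel b G i j l) y :=
  contDiffAt_const.mul (((contDiffAt_dirDeriv (hG j l) i).add
    (contDiffAt_dirDeriv (hG i l) j)).sub (contDiffAt_dirDeriv (hG i j) l))

variable [Fintype ι] [DecidableEq ι]

/-- The connection matrix `(Γ_i)^k_j = Γ^k_{ij}` of a metric. -/
def connMatrix (b : ι → E) (G : E → Matrix ι ι ℝ) (i : ι) (y : E) : Matrix ι ι ℝ :=
  Matrix.of fun k j => ∑ l, (G y)⁻¹ k l * lowerChristoffel b G i j l y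

/-- The curvature matrix `∂_i Γ_j - ∂_j Γ_i + Γ_i Γ_j - Γ_j Γ_i`. -/
def curvMatrix (b : ι → E) (G : E → Matrix ι ι ℝ) (i j : ι) (y : E) : Matrix ι ι ℝ :=
  matDeriv b i (connMatrix b G j) y - matDeriv b j (connMatrix b G i) y
    + connMatrix b G i y * connMatrix b G j y - connMatrix b G j y * connMatrix b G i y

/-- The Ricci tensor, as a trace of the curvature matrices. -/
def ricciTensor (b : ι → E) (G : E → Matrix ι ι ℝ) (i j : ι) (y : E) : ℝ :=
  ∑ k, curvMatrix b G k j y k i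

theorem MatSmoothAt.connMatrix (hG : MatSmoothAt G y) (hdet : IsUnit (G y).det) (i : ι) :
    MatSmoothAt (connMatrix b G i) y := fun k j => by
  simp only [ToricRicci.connMatrix, Matrix.of_apply]
  exact ContDiffAt.sum fun l _ => (hG.inv hdet k l).mul (contDiffAt_lowerChristoffel hG i j l)

theorem continuousAt_ricciTensor (hG : MatSmoothAt G y) (hdet : IsUnit (G y).det) (i j : ι) :
    ContinuousAt (ricciTensor b G i j) y := by
  have hc := fun i => hG.connMatrix (b := b) hdet i
  have : ContDiffAt ℝ ∞ (ricciTensor b G i j) y := by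
    unfold ricciTensor curvMatrix
    refine ContDiffAt.sum fun k _ => ?_
    exact ((((hc j).matDeriv k k i).sub ((hc k).matDeriv j k i)).add
      ((hc k).mul (hc j) k i)).sub ((hc j).mul (hc k) k i)
  exact this.continuousAt

/-- `G` times the connection matrix is the matrix of Christoffel symbols of the first kind. -/
theorem mul_connMatrix (hdet : IsUnit (G y).det) (i l j : ι) :
    (G y * connMatrix b G i y) l j = lowerChristoffel b G i j l y := by
  have : connMatrix b G i y = (G y)⁻¹ * Matrix.of fun l j => lowerChristoffel b G i j l y := by
    ext k j; simp [connMatrix, Matrix.mul_apply]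
  rw [this, Matrix.mul_nonsing_inv_cancel_left _ _ hdet]
  rfl

/-- The torsion-free symmetry `Γ^k_{ij} = Γ^k_{ji}`. -/
theorem connMatrix_symm (hsymm : ∀ᶠ z in 𝓝 y, (G z)ᵀ = G z) (i j k : ι) :
    connMatrix b G i y k j = connMatrix b G j y k i := by
  have h : ∀ l, dirDeriv b l (fun z => G z i j) y = dirDeriv b l (fun z => G z j i) y :=
    fun l => dirDeriv_congr (hsymm.mono fun z hz => (congrFun (congrFun hz i) j).symm)
  simp only [connMatrix, Matrix.of_apply, lowerChristoffel]
  refine Finset.sum_congr rfl fun l _ => ?_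
  rw [h l]
  ring

end Ricci

section Euclidean

variable {m : ℕ} {G : EuclideanSpace ℝ (Fin m) → Matrix (Fin m) (Fin m) ℝ}
  {y : EuclideanSpace ℝ (Fin m)}

/-- The standard frame of `ℝ^m`. -/
def stdFrame (m : ℕ) (i : Fin m) : EuclideanSpace ℝ (Fin m) := EuclideanSpace.single i 1

theorem christoffel_eq_connMatrix (k i j : Fin m) :
    christoffel G k i j = fun z => connMatrix (stdFrame m) G i z k j := by
  funext z
  simp only [christoffel, connMatrix, Matrix.of_apply, lowerChristoffel, Finset.mul_sum]
  refine Finset.sum_congr rfl fun l _ => ?_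
  simp only [pd, dirDeriv, stdFrame]
  ring

/-- For a symmetric matrix function the coordinate formula for the Ricci tensor is the trace of the
curvature matrices. -/
theorem ricci_eq_ricciTensor (hsymm : ∀ᶠ z in 𝓝 y, (G z)ᵀ = G z) (i j : Fin m) :
    ricci G i j y = ricciTensor (stdFrame m) G i j y := by
  have hpd : ∀ k f, pd k f y = dirDeriv (stdFrame m) k f y := fun _ _ => rfl
  have hs : ∀ k i j : Fin m, dirDeriv (stdFrame m) k (christoffel G k i j) y
      = matDeriv (stdFrame m) k (connMatrix (stdFrame m) G j) y k i := by
    intro k i j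
    rw [christoffel_eq_connMatrix]
    exact dirDeriv_congr (hsymm.eventually_nhds.mono fun z hz => connMatrix_symm hz i j k)
  have hs' : ∀ k i j : Fin m, dirDeriv (stdFrame m) j (christoffel G k i k) y
      = matDeriv (stdFrame m) j (connMatrix (stdFrame m) G k) y k i := by
    intro k i j
    rw [christoffel_eq_connMatrix]
    exact dirDeriv_congr (hsymm.eventually_nhds.mono fun z hz => connMatrix_symm hz i k k)
  simp only [ricci, ricciTensor, curvMatrix, ← Finset.sum_add_distrib, Matrix.add_apply,
    Matrix.sub_apply, Matrix.mul_apply, hpd, hs, hs']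
  refine Finset.sum_congr rfl fun k _ => ?_
  rw [add_sub_assoc, ← Finset.sum_sub_distrib]
  congr 1
  refine Finset.sum_congr rfl fun l _ => ?_
  simp only [christoffel_eq_connMatrix]
  rw [connMatrix_symm hsymm i j l, connMatrix_symm hsymm i k l]

end Euclidean

/-! ### The transformation law of the Ricci tensor -/

section Pullback

variable {E : Type*} [NormedAddCommGroup E] [NormedSpace ℝ E] {ι : Type*} {m : ℕ}

/-- The Jacobian matrix of `ψ` with respect to a frame of the source and the standard frame of the
target. -/
def jacobian (b : ι → E) (ψ : E → EuclideanSpace ℝ (Fin m)) (y : E) : Matrix (Fin m) ι ℝ :=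
  Matrix.of fun d k => dirDeriv b k (fun z => ψ z d) y

variable {b : ι → E} {ψ : E → EuclideanSpace ℝ (Fin m)} {y : E}

theorem ContDiffAt.euclidean_apply (hψ : ContDiffAt ℝ ∞ ψ y) (d : Fin m) :
    ContDiffAt ℝ ∞ (fun z => ψ z d) y := contDiffAt_euclidean.1 hψ d

theorem matSmoothAt_jacobian (hψ : ContDiffAt ℝ ∞ ψ y) : MatSmoothAt (jacobian b ψ) y :=
  fun d k => contDiffAt_dirDeriv (ContDiffAt.euclidean_apply hψ d) k

theorem jacobian_apply (hψ : DifferentiableAt ℝ ψ y) (d : Fin m) (k : ι) :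
    jacobian b ψ y d k = fderiv ℝ ψ y (b k) d := by
  have h := (EuclideanSpace.proj d : EuclideanSpace ℝ (Fin m) →L[ℝ] ℝ).hasFDerivAt.comp y
    hψ.hasFDerivAt
  exact congrArg (fun L => L (b k)) h.fderiv

/-- Symmetry of second derivatives. -/
theorem matDeriv_jacobian_symm (hψ : ContDiffAt ℝ ∞ ψ y) (i j : ι) (d : Fin m) :
    matDeriv b i (jacobian b ψ) y d j = matDeriv b j (jacobian b ψ) y d i :=
  dirDeriv_comm (ContDiffAt.euclidean_apply hψ d) i j

theorem sum_smul_single (v : EuclideanSpace ℝ (Fin m)) :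
    v = ∑ a, v a • EuclideanSpace.single a (1 : ℝ) := by
  ext k
  simp [Finset.sum_apply, Pi.single_apply]

theorem dirDeriv_comp {f : EuclideanSpace ℝ (Fin m) → ℝ} (hf : ContDiffAt ℝ ∞ f (ψ y))
    (hψ : ContDiffAt ℝ ∞ ψ y) (i : ι) :
    dirDeriv b i (fun z => f (ψ z)) y
      = ∑ a, jacobian b ψ y a i * dirDeriv (stdFrame m) a f (ψ y) := by
  have hd := hψ.differentiableAt (by simp)
  have h := (hf.differentiableAt (by simp)).hasFDerivAt.comp y hd.hasFDerivAt
  have h2 : dirDeriv b i (fun z => f (ψ z)) y = fderiv ℝ f (ψ y) (fderiv ℝ ψ y (b i)) :=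
    congrArg (fun L => L (b i)) h.fderiv
  rw [h2, sum_smul_single (fderiv ℝ ψ y (b i)), map_sum]
  refine Finset.sum_congr rfl fun a _ => ?_
  rw [map_smul, jacobian_apply hd]
  rfl

theorem matDeriv_comp {κ μ : Type*} {A : EuclideanSpace ℝ (Fin m) → Matrix κ μ ℝ}
    (hA : MatSmoothAt A (ψ y)) (hψ : ContDiffAt ℝ ∞ ψ y) (i : ι) :
    matDeriv b i (fun z => A (ψ z)) y
      = ∑ a, jacobian b ψ y a i • matDeriv (stdFrame m) a A (ψ y) := by
  ext k l
  simp only [Matrix.sum_apply, Matrix.smul_apply, smul_eq_mul]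
  exact dirDeriv_comp (hA k l) hψ i

theorem MatSmoothAt.comp {κ μ : Type*} {A : EuclideanSpace ℝ (Fin m) → Matrix κ μ ℝ}
    (hA : MatSmoothAt A (ψ y)) (hψ : ContDiffAt ℝ ∞ ψ y) : MatSmoothAt (fun z => A (ψ z)) y :=
  fun k l => (hA k l).comp y hψ

variable {G : EuclideanSpace ℝ (Fin m) → Matrix (Fin m) (Fin m) ℝ} {G' : E → Matrix ι ι ℝ}

/-- The Christoffel symbols of the first kind of a pulled back metric. -/
theorem lowerChristoffel_pullback (hψ : ContDiffAt ℝ ∞ ψ y) (hG : MatSmoothAt G (ψ y))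
    (hsymm : ∀ᶠ z in 𝓝 (ψ y), (G z)ᵀ = G z)
    (hG' : G' =ᶠ[𝓝 y] fun z => (jacobian b ψ z)ᵀ * G (ψ z) * jacobian b ψ z) (i j l : ι) :
    lowerChristoffel b G' i j l y
      = ∑ a, ∑ c, matDeriv b i (jacobian b ψ) y a j * G (ψ y) a c * jacobian b ψ y c l
        + ∑ a, ∑ c, ∑ e, jacobian b ψ y a i * jacobian b ψ y c j * jacobian b ψ y e l
          * lowerChristoffel (stdFrame m) G a c e (ψ y) := by
  set S := jacobian b ψ with hS
  have hSs : MatSmoothAt S y := matSmoothAt_jacobian hψ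
  have hGs : MatSmoothAt (fun z => G (ψ z)) y := hG.comp hψ
  set D : ι → Matrix (Fin m) ι ℝ := fun i => matDeriv b i S y with hD
  set K : Fin m → Matrix (Fin m) (Fin m) ℝ := fun a => matDeriv (stdFrame m) a G (ψ y) with hK
  have hDs : ∀ i j d, D i d j = D j d i := fun i j d => matDeriv_jacobian_symm hψ i j d
  have hGsym : ∀ a c, G (ψ y) a c = G (ψ y) c a := fun a c =>
    (congrFun (congrFun hsymm.self_of_nhds a) c).symm
  have key : ∀ i j l, dirDeriv b i (fun z => G' z j l) y
      = (∑ a, ∑ c, D i a j * G (ψ y) a c * S y c l) + (∑ a, ∑ c, D i a l * G (ψ y) a c * S y c j)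
        + ∑ a, ∑ c, ∑ e, S y a i * S y c j * S y e l * K a c e := by
    intro i j l
    have h1 : dirDeriv b i (fun z => G' z j l) y = matDeriv b i G' y j l := rfl
    rw [h1, matDeriv_congr hG', matDeriv_mul (hSs.transpose.mul hGs) hSs,
      matDeriv_mul hSs.transpose hGs, matDeriv_transpose, matDeriv_comp hG hψ]
    simp only [Matrix.add_mul, Matrix.add_apply]
    have e1 : ((matDeriv b i S y)ᵀ * G (ψ y) * S y) j l
        = ∑ a, ∑ c, D i a j * G (ψ y) a c * S y c l := by
      simp only [Matrix.mul_apply, Finset.sum_mul, Matrix.transpose_apply]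
      rw [Finset.sum_comm]
    have e2 : ((S y)ᵀ * G (ψ y) * matDeriv b i S y) j l
        = ∑ a, ∑ c, D i a l * G (ψ y) a c * S y c j := by
      simp only [Matrix.mul_apply, Finset.sum_mul, Matrix.transpose_apply]
      refine Finset.sum_congr rfl fun a _ => Finset.sum_congr rfl fun c _ => ?_
      rw [hGsym c a]; simp only [hD]; ring
    have e3 : ((S y)ᵀ * (∑ a, S y a i • K a) * S y) j l
        = ∑ a, ∑ c, ∑ e, S y a i * S y c j * S y e l * K a c e := by
      simp only [Matrix.mul_apply, Finset.sum_mul, Matrix.transpose_apply, Matrix.sum_apply,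
        Matrix.smul_apply, smul_eq_mul, Finset.mul_sum]
      rw [Finset.sum_comm]
      conv_rhs => rw [Finset.sum_comm]
      refine Finset.sum_congr rfl fun c _ => ?_
      rw [Finset.sum_comm]
      refine Finset.sum_congr rfl fun a _ => Finset.sum_congr rfl fun e _ => ?_
      ring
    rw [e1, e2, e3]
    ring
  have hlow : ∀ a c e, lowerChristoffel (stdFrame m) G a c e (ψ y)
      = (1 / 2) * (K a c e + K c a e - K e a c) := fun _ _ _ => rfl
  have e4 : ∑ a, ∑ c, ∑ e, S y a i * S y c j * S y e l
      * lowerChristoffel (stdFrame m) G a c e (ψ y)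
      = (1 / 2) * ((∑ a, ∑ c, ∑ e, S y a i * S y c j * S y e l * K a c e)
        + (∑ a, ∑ c, ∑ e, S y a j * S y c i * S y e l * K a c e)
        - ∑ a, ∑ c, ∑ e, S y a l * S y c i * S y e j * K a c e) := by
    have f1 : (∑ a, ∑ c, ∑ e, S y a j * S y c i * S y e l * K a c e)
        = ∑ a, ∑ c, ∑ e, S y a i * S y c j * S y e l * K c a e := by
      rw [Finset.sum_comm]
      refine Finset.sum_congr rfl fun a _ => Finset.sum_congr rfl fun c _ =>
        Finset.sum_congr rfl fun e _ => ?_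
      ring
    have f2 : (∑ a, ∑ c, ∑ e, S y a l * S y c i * S y e j * K a c e)
        = ∑ a, ∑ c, ∑ e, S y a i * S y c j * S y e l * K e a c := by
      rw [Finset.sum_comm]
      refine Finset.sum_congr rfl fun a _ => ?_
      rw [Finset.sum_comm]
      refine Finset.sum_congr rfl fun c _ => Finset.sum_congr rfl fun e _ => ?_
      ring
    rw [f1, f2]
    simp only [← Finset.sum_add_distrib, ← Finset.sum_sub_distrib, Finset.mul_sum]
    refine Finset.sum_congr rfl fun a _ => Finset.sum_congr rfl fun c _ =>
        Finset.sum_congr rfl fun e _ => ?_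
    rw [hlow]; ring
  rw [e4]
  simp only [lowerChristoffel]
  rw [key i j l, key j i l, key l i j]
  simp only [hDs j i, hDs l i, hDs l j]
  ring

variable [Fintype ι] [DecidableEq ι]

/-- `G'` is the pullback of the nondegenerate metric `G` by a smooth map `ψ` between open sets of
the same dimension, and is nondegenerate as well. The frame `b` of the source only enters through
the Jacobian matrix of `ψ`. -/
structure IsMetricPullback (b : ι → E) (ψ : E → EuclideanSpace ℝ (Fin m))
    (G : EuclideanSpace ℝ (Fin m) → Matrix (Fin m) (Fin m) ℝ) (G' : E → Matrix ι ι ℝ)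
    (s : Set E) : Prop where
  isOpen : IsOpen s
  card_eq : Fintype.card ι = m
  contDiffAt : ∀ z ∈ s, ContDiffAt ℝ ∞ ψ z
  smooth : ∀ z ∈ s, MatSmoothAt G (ψ z)
  isUnit_det : ∀ z ∈ s, IsUnit (G (ψ z)).det
  symm : ∀ z ∈ s, ∀ᶠ w in 𝓝 (ψ z), (G w)ᵀ = G w
  eq : ∀ z ∈ s, G' z = (jacobian b ψ z)ᵀ * G (ψ z) * jacobian b ψ z
  isUnit_det' : ∀ z ∈ s, IsUnit (G' z).det

namespace IsMetricPullback

variable {s : Set E}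

theorem matSmoothAt (h : IsMetricPullback b ψ G G' s) (hy : y ∈ s) : MatSmoothAt G' y := by
  have h1 : MatSmoothAt (fun z => (jacobian b ψ z)ᵀ * G (ψ z) * jacobian b ψ z) y :=
    ((matSmoothAt_jacobian (h.contDiffAt y hy)).transpose.mul
      ((h.smooth y hy).comp (h.contDiffAt y hy))).mul (matSmoothAt_jacobian (h.contDiffAt y hy))
  intro k l
  refine (h1 k l).congr_of_eventuallyEq ?_
  filter_upwards [h.isOpen.mem_nhds hy] with z hz
  rw [h.eq z hz]

/-- The Jacobian matrix is invertible. -/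
theorem exists_inverse (h : IsMetricPullback b ψ G G' s) (hy : y ∈ s) : ∃ T : Matrix ι (Fin m) ℝ,
    T * jacobian b ψ y = 1 ∧ jacobian b ψ y * T = 1 := by
  have hleft : (G' y)⁻¹ * ((jacobian b ψ y)ᵀ * G (ψ y)) * jacobian b ψ y = 1 := by
    rw [Matrix.mul_assoc, ← h.eq y hy, Matrix.nonsing_inv_mul _ (h.isUnit_det' y hy)]
  exact ⟨_, hleft, (Matrix.mul_eq_one_comm_of_card_eq _ _ _ (by simpa using h.card_eq)).1 hleft⟩

/-- The transformation law of the connection matrices: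
`S Γ'_i = ∂_i S + (∑_a S_{ai} Γ_a) S` where `S` is the Jacobian matrix. -/
theorem jacobian_mul_connMatrix (h : IsMetricPullback b ψ G G' s) (hy : y ∈ s) (i : ι) :
    jacobian b ψ y * connMatrix b G' i y = matDeriv b i (jacobian b ψ) y
      + (∑ a, jacobian b ψ y a i • connMatrix (stdFrame m) G a (ψ y)) * jacobian b ψ y := by
  have hψ := h.contDiffAt y hy
  have hG := h.smooth y hy
  have hdet := h.isUnit_det y hy
  have hdet' := h.isUnit_det' y hy
  have hsymm := h.symm y hy
  have hcard := h.card_eq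
  have hG' : G' =ᶠ[𝓝 y] fun z => (jacobian b ψ z)ᵀ * G (ψ z) * jacobian b ψ z := by
    filter_upwards [h.isOpen.mem_nhds hy] with z hz using h.eq z hz
  set S := jacobian b ψ y with hS
  have hGy : G' y = Sᵀ * G (ψ y) * S := hG'.self_of_nhds
  have hleft : (G' y)⁻¹ * (Sᵀ * G (ψ y)) * S = 1 := by
    rw [Matrix.mul_assoc, ← hGy, Matrix.nonsing_inv_mul _ hdet']
  have hright : S * ((G' y)⁻¹ * (Sᵀ * G (ψ y))) = 1 :=
    (Matrix.mul_eq_one_comm_of_card_eq _ _ _ (by simpa using hcard)).1 hleft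
  have hcancel : ∀ A B : Matrix (Fin m) ι ℝ, Sᵀ * G (ψ y) * A = Sᵀ * G (ψ y) * B → A = B := by
    intro A B h
    have h2 := congrArg (fun C => S * ((G' y)⁻¹ * C)) h
    rwa [← Matrix.mul_assoc _ _ A, ← Matrix.mul_assoc _ _ B, ← Matrix.mul_assoc S _ A,
      ← Matrix.mul_assoc S _ B, hright, Matrix.one_mul, Matrix.one_mul] at h2
  apply hcancel
  rw [← Matrix.mul_assoc, ← hGy, Matrix.mul_add]
  ext l j
  rw [mul_connMatrix hdet', lowerChristoffel_pullback hψ hG hsymm hG', Matrix.add_apply]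
  have hGsym : ∀ a c, G (ψ y) a c = G (ψ y) c a := fun a c =>
    (congrFun (congrFun hsymm.self_of_nhds a) c).symm
  congr 1
  · simp only [Matrix.mul_apply, Finset.sum_mul, Matrix.transpose_apply]
    refine Finset.sum_congr rfl fun a _ => Finset.sum_congr rfl fun c _ => ?_
    rw [hGsym c a]; ring
  · have h3 : Sᵀ * G (ψ y) * ((∑ a, S a i • connMatrix (stdFrame m) G a (ψ y)) * S)
        = ∑ a, S a i • (Sᵀ * ((G (ψ y) * connMatrix (stdFrame m) G a (ψ y)) * S)) := by
      simp only [Matrix.mul_sum, Matrix.sum_mul, Matrix.smul_mul, Matrix.mul_smul, Matrix.mul_assoc]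
    rw [h3]
    simp only [Matrix.sum_apply, Matrix.smul_apply, smul_eq_mul]
    refine Finset.sum_congr rfl fun a _ => ?_
    have h4 : ∀ M : Matrix (Fin m) (Fin m) ℝ, (Sᵀ * (M * S)) l j
        = ∑ c, ∑ e, S e l * M e c * S c j := by
      intro M
      rw [← Matrix.mul_assoc]
      simp only [Matrix.mul_apply, Finset.sum_mul, Matrix.transpose_apply]
    rw [h4]
    simp only [mul_connMatrix hdet, Finset.mul_sum]
    refine Finset.sum_congr rfl fun c _ => Finset.sum_congr rfl fun e _ => ?_
    ring

/-- The transformation law of the curvature matrices. -/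
theorem jacobian_mul_curvMatrix (h : IsMetricPullback b ψ G G' s) (hy : y ∈ s) (i j : ι) :
    jacobian b ψ y * curvMatrix b G' i j y
      = (∑ a, ∑ c, (jacobian b ψ y a i * jacobian b ψ y c j) •
          curvMatrix (stdFrame m) G a c (ψ y)) * jacobian b ψ y := by
  set S := jacobian b ψ with hS
  set B : ι → E → Matrix (Fin m) (Fin m) ℝ := fun i z =>
    ∑ a, S z a i • connMatrix (stdFrame m) G a (ψ z) with hB
  have hψ := h.contDiffAt y hy
  have hSs : MatSmoothAt S y := matSmoothAt_jacobian hψ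
  have hΓ : ∀ a, MatSmoothAt (connMatrix (stdFrame m) G a) (ψ y) := fun a =>
    (h.smooth y hy).connMatrix (h.isUnit_det y hy) a
  have hΓ' : ∀ i, MatSmoothAt (connMatrix b G' i) y := fun i =>
    (h.matSmoothAt hy).connMatrix (h.isUnit_det' y hy) i
  have hBs : ∀ i, MatSmoothAt (B i) y := fun i =>
    MatSmoothAt.sum fun a _ => MatSmoothAt.smul (hSs a i) ((hΓ a).comp hψ)
  have hconn : ∀ i, S y * connMatrix b G' i y = matDeriv b i S y + B i y * S y := fun i =>
    h.jacobian_mul_connMatrix hy i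
  have hder : ∀ i j, matDeriv b i S y * connMatrix b G' j y
      + S y * matDeriv b i (connMatrix b G' j) y
      = matDeriv b i (matDeriv b j S) y + (matDeriv b i (B j) y * S y
        + B j y * matDeriv b i S y) := by
    intro i j
    rw [← matDeriv_mul hSs (hΓ' j), ← matDeriv_mul (hBs j) hSs,
      ← matDeriv_add (hSs.matDeriv j) ((hBs j).mul hSs)]
    refine matDeriv_congr ?_
    filter_upwards [h.isOpen.mem_nhds hy] with z hz
    exact h.jacobian_mul_connMatrix hz j
  have hhalf : ∀ i j, S y * (matDeriv b i (connMatrix b G' j) y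
      + connMatrix b G' i y * connMatrix b G' j y) = matDeriv b i (matDeriv b j S) y
      + (B j y * matDeriv b i S y + B i y * matDeriv b j S y)
      + (matDeriv b i (B j) y + B i y * B j y) * S y := by
    intro i j
    have h1 : S y * (connMatrix b G' i y * connMatrix b G' j y)
        = matDeriv b i S y * connMatrix b G' j y + B i y * matDeriv b j S y
          + B i y * B j y * S y := by
      rw [← Matrix.mul_assoc, hconn i, Matrix.add_mul, Matrix.mul_assoc (B i y), hconn j,
        Matrix.mul_add, Matrix.mul_assoc (B i y), add_assoc]
    rw [Matrix.mul_add, h1, Matrix.add_mul, eq_sub_of_add_eq' (hder i j)]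
    abel
  have hcurv : S y * curvMatrix b G' i j y
      = (matDeriv b i (B j) y - matDeriv b j (B i) y + B i y * B j y - B j y * B i y) * S y := by
    have h1 : curvMatrix b G' i j y = (matDeriv b i (connMatrix b G' j) y
        + connMatrix b G' i y * connMatrix b G' j y) - (matDeriv b j (connMatrix b G' i) y
        + connMatrix b G' j y * connMatrix b G' i y) := by
      unfold curvMatrix; abel
    rw [h1, Matrix.mul_sub, hhalf i j, hhalf j i, matDeriv_comm hSs i j]
    simp only [Matrix.add_mul, Matrix.sub_mul]
    abel
  rw [hcurv]
  congr 1
  have hdB : ∀ i j, matDeriv b i (B j) y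
      = (∑ a, matDeriv b i S y a j • connMatrix (stdFrame m) G a (ψ y))
        + ∑ a, ∑ c, (S y a i * S y c j) •
          matDeriv (stdFrame m) a (connMatrix (stdFrame m) G c) (ψ y) := by
    intro i j
    rw [hB, matDeriv_sum fun a _ => MatSmoothAt.smul (hSs a j) ((hΓ a).comp hψ)]
    have h2 : ∀ a, matDeriv b i (fun z => S z a j • connMatrix (stdFrame m) G a (ψ z)) y
        = matDeriv b i S y a j • connMatrix (stdFrame m) G a (ψ y)
          + ∑ c, (S y c i * S y a j) •
            matDeriv (stdFrame m) c (connMatrix (stdFrame m) G a) (ψ y) := by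
      intro a
      rw [matDeriv_smul (hSs a j) ((hΓ a).comp hψ), matDeriv_comp (hΓ a) hψ, Finset.smul_sum]
      simp only [smul_smul, mul_comm]
      rfl
    simp only [h2, Finset.sum_add_distrib]
    rw [Finset.sum_comm (γ := Fin m)]
  have hBB : ∀ i j, B i y * B j y = ∑ a, ∑ c, (S y a i * S y c j) •
      (connMatrix (stdFrame m) G a (ψ y) * connMatrix (stdFrame m) G c (ψ y)) := by
    intro i j
    simp only [hB, Matrix.sum_mul, Matrix.mul_sum, Matrix.smul_mul, Matrix.mul_smul, smul_smul,
      Finset.smul_sum]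
    rw [Finset.sum_comm]
    simp only [mul_comm]
  have hswap : ∀ F : Fin m → Fin m → Matrix (Fin m) (Fin m) ℝ,
      ∑ a, ∑ c, (S y a j * S y c i) • F a c = ∑ a, ∑ c, (S y a i * S y c j) • F c a := by
    intro F
    rw [Finset.sum_comm]
    simp only [mul_comm]
  have hsym : ∀ a, matDeriv b j S y a i = matDeriv b i S y a j := fun a =>
    matDeriv_jacobian_symm hψ j i a
  rw [hdB i j, hdB j i, hBB i j, hBB j i, hswap, hswap]
  simp only [hsym, curvMatrix, smul_add, smul_sub, Finset.sum_add_distrib, Finset.sum_sub_distrib]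
  abel

/-- The Ricci tensor is a tensor. -/
theorem ricciTensor_eq (h : IsMetricPullback b ψ G G' s) (hy : y ∈ s) (i j : ι) :
    ricciTensor b G' i j y = ∑ e, ∑ c, jacobian b ψ y e i * jacobian b ψ y c j *
      ricciTensor (stdFrame m) G e c (ψ y) := by
  obtain ⟨T, hTS, hST⟩ := h.exists_inverse hy
  set S := jacobian b ψ y with hS
  set R : Fin m → Fin m → Matrix (Fin m) (Fin m) ℝ := fun a c =>
    curvMatrix (stdFrame m) G a c (ψ y) with hR
  have h1 : ∀ k, curvMatrix b G' k j y = ∑ c, S c j • ∑ a, S a k • (T * (R a c * S)) := by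
    intro k
    have h2 := congrArg (fun M => T * M) (h.jacobian_mul_curvMatrix hy k j)
    rw [← Matrix.mul_assoc, ← hS, hTS, Matrix.one_mul] at h2
    rw [h2, Finset.sum_comm]
    simp only [Matrix.sum_mul, Matrix.mul_sum, Matrix.smul_mul, Matrix.mul_smul, Finset.smul_sum,
      smul_smul, mul_comm, hR]
  have h3 : ∀ c a, ∑ k, S a k * (T * (R a c * S)) k i = (R a c * S) a i := by
    intro c a
    rw [← Matrix.mul_apply, ← Matrix.mul_assoc, hST, Matrix.one_mul]
  have h4 : ricciTensor b G' i j y = ∑ c, S c j * ∑ a, (R a c * S) a i := by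
    simp only [ricciTensor, h1, Matrix.sum_apply, Matrix.smul_apply, smul_eq_mul]
    rw [Finset.sum_comm]
    refine Finset.sum_congr rfl fun c _ => ?_
    rw [← Finset.mul_sum, Finset.sum_comm]
    simp only [h3]
  rw [h4, Finset.sum_comm]
  refine Finset.sum_congr rfl fun c _ => ?_
  simp only [ricciTensor, Matrix.mul_apply, Finset.mul_sum]
  rw [Finset.sum_comm]
  refine Finset.sum_congr rfl fun e _ => Finset.sum_congr rfl fun a _ => ?_
  ring

theorem ricciTensor_eq_zero_iff (h : IsMetricPullback b ψ G G' s) (hy : y ∈ s) :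
    (∀ i j, ricciTensor b G' i j y = 0) ↔ ∀ i j, ricciTensor (stdFrame m) G i j (ψ y) = 0 := by
  constructor
  · intro h0
    obtain ⟨T, -, hST⟩ := h.exists_inverse hy
    set S := jacobian b ψ y with hS
    set R : Matrix (Fin m) (Fin m) ℝ :=
      Matrix.of fun i j => ricciTensor (stdFrame m) G i j (ψ y) with hR
    have h1 : Sᵀ * R * S = 0 := by
      ext i j
      rw [Matrix.zero_apply, ← h0 i j, h.ricciTensor_eq hy]
      simp only [Matrix.mul_apply, Finset.sum_mul, Matrix.transpose_apply, hR, Matrix.of_apply]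
      rw [Finset.sum_comm]
      refine Finset.sum_congr rfl fun e _ => Finset.sum_congr rfl fun a _ => ?_
      rw [← hS]; ring
    have h2 : R = Tᵀ * (Sᵀ * R * S) * T := by
      have h3 : Tᵀ * Sᵀ = 1 := by rw [← Matrix.transpose_mul, hST, Matrix.transpose_one]
      rw [Matrix.mul_assoc, Matrix.mul_assoc, Matrix.mul_assoc, hST, ← Matrix.mul_assoc, h3,
        Matrix.one_mul, Matrix.mul_one]
    rw [h1, Matrix.mul_zero, Matrix.zero_mul] at h2
    exact fun i j => congrFun (congrFun h2 i) j
  · intro h0 i j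
    rw [h.ricciTensor_eq hy]
    simp [h0]

end IsMetricPullback

end Pullback

/-! ### The connection of a toric metric -/

section Toric

/-- The frame `∂/∂x_k` of the `x`-plane. -/
def actionFrame (k : Fin 2) : Fin 2 → ℝ := Pi.single k 1

/-- The frame `∂/∂x_k`, `∂/∂θ_k` of the space of action-angle coordinates. -/
def toricFrame : Fin 2 ⊕ Fin 2 → (Fin 2 → ℝ) × (Fin 2 → ℝ) :=
  Sum.elim (fun k => (Pi.single k 1, 0)) (fun k => (0, Pi.single k 1))

/-- The matrix of the metric `∑ U_{jk} dx_j dx_k + ∑ U^{jk} dθ_j dθ_k`. -/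
def toricMatrix (U : (Fin 2 → ℝ) → Matrix (Fin 2) (Fin 2) ℝ)
    (q : (Fin 2 → ℝ) × (Fin 2 → ℝ)) : Matrix (Fin 2 ⊕ Fin 2) (Fin 2 ⊕ Fin 2) ℝ :=
  Matrix.fromBlocks (U q.1) 0 0 (U q.1)⁻¹

/-- The matrix function `U` behaves on `D` like the Hessian of a smooth function, with nonvanishing
determinant: the symmetry of `∂_a U_{kl}` in all three indices is `deriv_symm` together with
`symm`. -/
structure IsHessianLike (U : (Fin 2 → ℝ) → Matrix (Fin 2) (Fin 2) ℝ) (D : Set (Fin 2 → ℝ)) :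
    Prop where
  isOpen : IsOpen D
  smooth : ∀ x ∈ D, MatSmoothAt U x
  symm : ∀ x ∈ D, ∀ k l, U x k l = U x l k
  deriv_symm : ∀ x ∈ D, ∀ a k l, matDeriv actionFrame a U x k l = matDeriv actionFrame k U x a l
  isUnit_det : ∀ x ∈ D, IsUnit (U x).det

theorem fderiv_apply_eq_sum (f : (Fin 2 → ℝ) → ℝ) (x v : Fin 2 → ℝ) :
    fderiv ℝ f x v = ∑ j, v j * dirDeriv actionFrame j f x := by
  have h : v = ∑ j, v j • (Pi.single j 1 : Fin 2 → ℝ) := by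
    ext k; simp [Finset.sum_apply, Pi.single_apply]
  conv_lhs => rw [h, map_sum]
  simp only [map_smul, smul_eq_mul]
  rfl

variable {q : (Fin 2 → ℝ) × (Fin 2 → ℝ)}

theorem dirDeriv_fst_inl {f : (Fin 2 → ℝ) → ℝ} (hf : ContDiffAt ℝ ∞ f q.1) (a : Fin 2) :
    dirDeriv toricFrame (Sum.inl a) (fun p => f p.1) q = dirDeriv actionFrame a f q.1 := by
  have h := (hf.differentiableAt (by simp)).hasFDerivAt.comp q hasFDerivAt_fst
  exact congrArg (fun L => L (toricFrame (Sum.inl a))) h.fderiv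

theorem dirDeriv_fst_inr {f : (Fin 2 → ℝ) → ℝ} (hf : ContDiffAt ℝ ∞ f q.1) (a : Fin 2) :
    dirDeriv toricFrame (Sum.inr a) (fun p => f p.1) q = 0 := by
  have h := (hf.differentiableAt (by simp)).hasFDerivAt.comp q hasFDerivAt_fst
  refine (congrArg (fun L => L (toricFrame (Sum.inr a))) h.fderiv).trans ?_
  simp [toricFrame]

section Blocks

variable {A B C D : (Fin 2 → ℝ) → Matrix (Fin 2) (Fin 2) ℝ}

theorem matDeriv_fromBlocks_inl (hA : MatSmoothAt A q.1) (hB : MatSmoothAt B q.1)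
    (hC : MatSmoothAt C q.1) (hD : MatSmoothAt D q.1) (a : Fin 2) :
    matDeriv toricFrame (Sum.inl a)
      (fun p => Matrix.fromBlocks (A p.1) (B p.1) (C p.1) (D p.1)) q
      = Matrix.fromBlocks (matDeriv actionFrame a A q.1) (matDeriv actionFrame a B q.1)
        (matDeriv actionFrame a C q.1) (matDeriv actionFrame a D q.1) := by
  ext k l
  rcases k with k | k <;> rcases l with l | l
  · exact dirDeriv_fst_inl (hA k l) a
  · exact dirDeriv_fst_inl (hB k l) a
  · exact dirDeriv_fst_inl (hC k l) a
  · exact dirDeriv_fst_inl (hD k l) a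

theorem matDeriv_fromBlocks_inr (hA : MatSmoothAt A q.1) (hB : MatSmoothAt B q.1)
    (hC : MatSmoothAt C q.1) (hD : MatSmoothAt D q.1) (a : Fin 2) :
    matDeriv toricFrame (Sum.inr a)
      (fun p => Matrix.fromBlocks (A p.1) (B p.1) (C p.1) (D p.1)) q = 0 := by
  ext k l
  rcases k with k | k <;> rcases l with l | l
  · exact dirDeriv_fst_inr (hA k l) a
  · exact dirDeriv_fst_inr (hB k l) a
  · exact dirDeriv_fst_inr (hC k l) a
  · exact dirDeriv_fst_inr (hD k l) a

end Blocks

variable (U : (Fin 2 → ℝ) → Matrix (Fin 2) (Fin 2) ℝ)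

/-- The `xx`-block `½ U⁻¹ ∂_i U` of the connection matrix along `∂/∂x_i`. -/
def connXX (i : Fin 2) (x : Fin 2 → ℝ) : Matrix (Fin 2) (Fin 2) ℝ :=
  (1 / 2 : ℝ) • ((U x)⁻¹ * matDeriv actionFrame i U x)

/-- The `θθ`-block of the connection matrix along `∂/∂x_i`. -/
def connTT (i : Fin 2) (x : Fin 2 → ℝ) : Matrix (Fin 2) (Fin 2) ℝ :=
  (-1 / 2 : ℝ) • (matDeriv actionFrame i U x * (U x)⁻¹)

/-- The `xθ`-block of the connection matrix along `∂/∂θ_j`. -/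
def connXT (j : Fin 2) (x : Fin 2 → ℝ) : Matrix (Fin 2) (Fin 2) ℝ :=
  (1 / 2 : ℝ) • ∑ p, (U x)⁻¹ p j • ((U x)⁻¹ * matDeriv actionFrame p U x * (U x)⁻¹)

/-- The `θx`-block of the connection matrix along `∂/∂θ_j`. -/
def connTX (j : Fin 2) (x : Fin 2 → ℝ) : Matrix (Fin 2) (Fin 2) ℝ :=
  (-1 / 2 : ℝ) • ∑ p, (U x)⁻¹ p j • matDeriv actionFrame p U x

variable {U} {D : Set (Fin 2 → ℝ)}

namespace IsHessianLike

variable {x : Fin 2 → ℝ}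

theorem smooth_inv (h : IsHessianLike U D) (hx : x ∈ D) : MatSmoothAt (fun z => (U z)⁻¹) x :=
  (h.smooth x hx).inv (h.isUnit_det x hx)

theorem inv_symm (h : IsHessianLike U D) (hx : x ∈ D) (k l : Fin 2) :
    (U x)⁻¹ k l = (U x)⁻¹ l k := by
  have h1 : (U x)ᵀ = U x := by ext k l; exact h.symm x hx l k
  have h2 : ((U x)⁻¹)ᵀ = (U x)⁻¹ := by rw [Matrix.transpose_nonsing_inv, h1]
  exact (congrFun (congrFun h2 k) l).symm

theorem deriv_swap (h : IsHessianLike U D) (hx : x ∈ D) (a k l : Fin 2) :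
    matDeriv actionFrame a U x k l = matDeriv actionFrame a U x l k :=
  dirDeriv_congr (by filter_upwards [h.isOpen.mem_nhds hx] with z hz using h.symm z hz k l)

theorem isUnit_det_toricMatrix (h : IsHessianLike U D) (hq : q.1 ∈ D) :
    IsUnit (toricMatrix U q).det := by
  have := h.isUnit_det _ hq
  simp only [toricMatrix, Matrix.det_fromBlocks_zero₂₁]
  exact this.mul ((Matrix.isUnit_nonsing_inv_det_iff).2 this)

theorem inv_toricMatrix (h : IsHessianLike U D) (hq : q.1 ∈ D) :
    (toricMatrix U q)⁻¹ = Matrix.fromBlocks (U q.1)⁻¹ 0 0 (U q.1) := by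
  have := h.isUnit_det _ hq
  apply Matrix.inv_eq_right_inv
  simp [toricMatrix, Matrix.fromBlocks_multiply, Matrix.mul_nonsing_inv _ this,
    Matrix.nonsing_inv_mul _ this]

theorem matDeriv_toricMatrix_inl (h : IsHessianLike U D) (hq : q.1 ∈ D) (a : Fin 2) :
    matDeriv toricFrame (Sum.inl a) (toricMatrix U) q
      = Matrix.fromBlocks (matDeriv actionFrame a U q.1) 0 0
        (-((U q.1)⁻¹ * matDeriv actionFrame a U q.1 * (U q.1)⁻¹)) := by
  have h1 := matDeriv_fromBlocks_inl (q := q) (h.smooth _ hq) (matSmoothAt_const 0 _)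
    (matSmoothAt_const 0 _) (h.smooth_inv hq) a
  rw [matDeriv_const, matDeriv_inv (h.smooth _ hq) (h.isUnit_det _ hq)] at h1
  exact h1

theorem matDeriv_toricMatrix_inr (h : IsHessianLike U D) (hq : q.1 ∈ D) (a : Fin 2) :
    matDeriv toricFrame (Sum.inr a) (toricMatrix U) q = 0 :=
  matDeriv_fromBlocks_inr (q := q) (h.smooth _ hq) (matSmoothAt_const 0 _)
    (matSmoothAt_const 0 _) (h.smooth_inv hq) a

theorem lowerChristoffel_toricMatrix (i j l : Fin 2 ⊕ Fin 2) :
    lowerChristoffel toricFrame (toricMatrix U) i j l q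
      = (1 / 2) * (matDeriv toricFrame i (toricMatrix U) q j l
        + matDeriv toricFrame j (toricMatrix U) q i l
        - matDeriv toricFrame l (toricMatrix U) q i j) := rfl

/-- `U⁻¹ (∂_a U) U⁻¹` is symmetric. -/
theorem conj_symm (h : IsHessianLike U D) (hx : x ∈ D) (a k l : Fin 2) :
    ((U x)⁻¹ * matDeriv actionFrame a U x * (U x)⁻¹) k l
      = ((U x)⁻¹ * matDeriv actionFrame a U x * (U x)⁻¹) l k := by
  have h1 : ((U x)⁻¹)ᵀ = (U x)⁻¹ := by ext k l; exact h.inv_symm hx l k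
  have h2 : (matDeriv actionFrame a U x)ᵀ = matDeriv actionFrame a U x := by
    ext k l; exact h.deriv_swap hx a l k
  have h3 : ((U x)⁻¹ * matDeriv actionFrame a U x * (U x)⁻¹)ᵀ
      = (U x)⁻¹ * matDeriv actionFrame a U x * (U x)⁻¹ := by
    rw [Matrix.transpose_mul, Matrix.transpose_mul, h1, h2, Matrix.mul_assoc]
  exact (congrFun (congrFun h3 k) l).symm

/-- `∑_l U_{kl} (U⁻¹ (∂_a U) U⁻¹)_{jl} = ((∂_a U) U⁻¹)_{kj}`. -/
theorem sum_mul_conj (h : IsHessianLike U D) (hx : x ∈ D) (a k j : Fin 2) :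
    ∑ l, U x k l * ((U x)⁻¹ * matDeriv actionFrame a U x * (U x)⁻¹) j l
      = (matDeriv actionFrame a U x * (U x)⁻¹) k j := by
  simp only [h.conj_symm hx a j]
  rw [← Matrix.mul_apply, Matrix.mul_assoc,
    Matrix.mul_nonsing_inv_cancel_left _ _ (h.isUnit_det x hx)]

/-- The connection matrix along `∂/∂x_i` is block diagonal. -/
theorem connMatrix_inl (h : IsHessianLike U D) (hq : q.1 ∈ D) (i : Fin 2) :
    connMatrix toricFrame (toricMatrix U) (Sum.inl i) q
      = Matrix.fromBlocks (connXX U i q.1) 0 0 (connTT U i q.1) := by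
  have hs := h.deriv_symm _ hq
  have hs' := h.deriv_swap hq
  ext k j
  rcases k with k | k <;> rcases j with j | j
  · simp only [connMatrix, lowerChristoffel_toricMatrix, h.inv_toricMatrix hq,
      h.matDeriv_toricMatrix_inl hq, connXX, Matrix.mul_apply, Fintype.sum_sum_type,
      Matrix.of_apply, Matrix.fromBlocks_apply₁₁, Matrix.fromBlocks_apply₁₂, Matrix.zero_apply,
      zero_mul, Finset.sum_const_zero, add_zero, Matrix.smul_apply, smul_eq_mul, Finset.mul_sum]
    refine Finset.sum_congr rfl fun l _ => ?_
    rw [hs l i j, hs j i l, hs' i l j]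
    ring
  · simp [connMatrix, lowerChristoffel_toricMatrix, h.inv_toricMatrix hq,
      h.matDeriv_toricMatrix_inl hq, h.matDeriv_toricMatrix_inr hq]
  · simp [connMatrix, lowerChristoffel_toricMatrix, h.inv_toricMatrix hq,
      h.matDeriv_toricMatrix_inl hq, h.matDeriv_toricMatrix_inr hq]
  · simp only [connMatrix, lowerChristoffel_toricMatrix, h.inv_toricMatrix hq,
      h.matDeriv_toricMatrix_inl hq, h.matDeriv_toricMatrix_inr hq, connTT, Fintype.sum_sum_type,
      Matrix.of_apply, Matrix.fromBlocks_apply₂₂, Matrix.fromBlocks_apply₂₁, Matrix.zero_apply,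
      zero_mul, Finset.sum_const_zero, zero_add, Matrix.smul_apply, smul_eq_mul, Matrix.neg_apply,
      ← h.sum_mul_conj hq, Finset.mul_sum]
    refine Finset.sum_congr rfl fun l _ => ?_
    ring

/-- The connection matrix along `∂/∂θ_i` has only off-diagonal blocks. -/
theorem connMatrix_inr (h : IsHessianLike U D) (hq : q.1 ∈ D) (i : Fin 2) :
    connMatrix toricFrame (toricMatrix U) (Sum.inr i) q
      = Matrix.fromBlocks 0 (connXT U i q.1) (connTX U i q.1) 0 := by
  have hV := h.inv_symm hq
  have hs := h.deriv_symm _ hq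
  have hs' := h.deriv_swap hq
  ext k j
  rcases k with k | k <;> rcases j with j | j
  · simp [connMatrix, lowerChristoffel_toricMatrix, h.inv_toricMatrix hq,
      h.matDeriv_toricMatrix_inl hq, h.matDeriv_toricMatrix_inr hq]
  · simp only [connMatrix, lowerChristoffel_toricMatrix, h.inv_toricMatrix hq,
      h.matDeriv_toricMatrix_inl hq, h.matDeriv_toricMatrix_inr hq, connXT, Fintype.sum_sum_type,
      Matrix.of_apply, Matrix.fromBlocks_apply₁₁, Matrix.fromBlocks_apply₁₂, Matrix.zero_apply,
      Matrix.fromBlocks_apply₂₂, zero_mul, Finset.sum_const_zero, add_zero, Matrix.smul_apply,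
      smul_eq_mul, Matrix.neg_apply, Matrix.sum_apply, Finset.mul_sum]
    -- the third derivatives in a normal form, so that `ring` can compare the two sides
    have e1 : matDeriv actionFrame 0 U q.1 1 0 = matDeriv actionFrame 0 U q.1 0 1 := hs' 0 1 0
    have e2 : matDeriv actionFrame 1 U q.1 0 0 = matDeriv actionFrame 0 U q.1 0 1 :=
      (hs 1 0 0).trans e1
    have e3 : matDeriv actionFrame 1 U q.1 0 1 = matDeriv actionFrame 0 U q.1 1 1 := hs 1 0 1
    have e4 : matDeriv actionFrame 1 U q.1 1 0 = matDeriv actionFrame 0 U q.1 1 1 :=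
      (hs' 1 1 0).trans e3
    fin_cases k <;> fin_cases j <;> fin_cases i <;>
    · simp only [Fin.mk_zero, Fin.mk_one, Fin.isValue, Matrix.mul_apply,
        Fin.sum_univ_two, e1, e2, e3, e4, hV 1 0]
      ring
  · simp only [connMatrix, lowerChristoffel_toricMatrix, h.inv_toricMatrix hq,
      h.matDeriv_toricMatrix_inl hq, h.matDeriv_toricMatrix_inr hq, connTX, Fintype.sum_sum_type,
      Matrix.of_apply, Matrix.fromBlocks_apply₂₂, Matrix.fromBlocks_apply₂₁, Matrix.zero_apply,
      zero_mul, Finset.sum_const_zero, zero_add, Matrix.smul_apply, smul_eq_mul, Matrix.neg_apply,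
      Matrix.sum_apply]
    trans ∑ l, (-1 / 2) * (U q.1 k l * ((U q.1)⁻¹ * matDeriv actionFrame j U q.1 * (U q.1)⁻¹) i l)
    · refine Finset.sum_congr rfl fun l _ => ?_
      ring
    rw [← Finset.mul_sum, h.sum_mul_conj hq, Matrix.mul_apply]
    congr 1
    refine Finset.sum_congr rfl fun p _ => ?_
    rw [hs' j k p, hs j p k, hs' p j k, mul_comm]
  · simp [connMatrix, lowerChristoffel_toricMatrix, h.inv_toricMatrix hq,
      h.matDeriv_toricMatrix_inl hq, h.matDeriv_toricMatrix_inr hq]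

end IsHessianLike

end Toric

/-! ### The curvature of a toric metric -/

section ToricRicciTensor

/-- The gradient `∂_c log det U = tr (U⁻¹ ∂_c U)`. -/
def logDetGrad (U : (Fin 2 → ℝ) → Matrix (Fin 2) (Fin 2) ℝ) (c : Fin 2) (x : Fin 2 → ℝ) : ℝ :=
  ((U x)⁻¹ * matDeriv actionFrame c U x).trace

/-- The vector `U⁻¹ ∇ log det U`. If `U` is the Hessian of `u`, this is the gradient of
`log det U` as a function of `∇ u`. -/
def logDetField (U : (Fin 2 → ℝ) → Matrix (Fin 2) (Fin 2) ℝ) (j : Fin 2) (x : Fin 2 → ℝ) : ℝ :=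
  ∑ c, (U x)⁻¹ j c * logDetGrad U c x

variable {q : (Fin 2 → ℝ) × (Fin 2 → ℝ)} {U : (Fin 2 → ℝ) → Matrix (Fin 2) (Fin 2) ℝ}
  {D : Set (Fin 2 → ℝ)} {x : Fin 2 → ℝ}

namespace IsHessianLike

/-- Jacobi's formula for the derivative of the determinant. -/
theorem dirDeriv_det (h : IsHessianLike U D) (hx : x ∈ D) (c : Fin 2) :
    dirDeriv actionFrame c (fun z => (U z).det) x = (U x).det * logDetGrad U c x := by
  have hs := h.smooth x hx
  have h1 : (fun z => (U z).det) = fun z => U z 0 0 * U z 1 1 + (-1) * (U z 0 1 * U z 1 0) := by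
    funext z; rw [Matrix.det_fin_two]; ring
  have hdet : (U x).det ≠ 0 := (h.isUnit_det x hx).ne_zero
  rw [h1, dirDeriv_add ((hs 0 0).mul (hs 1 1)) (contDiffAt_const.mul ((hs 0 1).mul (hs 1 0))),
    dirDeriv_const_mul _ ((hs 0 1).mul (hs 1 0)), dirDeriv_mul (hs 0 0) (hs 1 1),
    dirDeriv_mul (hs 0 1) (hs 1 0)]
  have hm : ∀ k l, dirDeriv actionFrame c (fun z => U z k l) x = matDeriv actionFrame c U x k l :=
    fun _ _ => rfl
  simp only [hm, logDetGrad, Matrix.inv_def, Ring.inverse_eq_inv', Matrix.smul_mul,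
    Matrix.trace_smul, smul_eq_mul, mul_inv_cancel_left₀ hdet]
  rw [Matrix.adjugate_fin_two]
  simp only [Matrix.trace, Matrix.diag_apply, Fin.sum_univ_two, Matrix.mul_apply, Matrix.of_apply,
    Matrix.cons_val_zero, Matrix.cons_val_one, Matrix.cons_val', Matrix.cons_val_fin_one]
  ring

/-- The gradient of `log det U` is recovered from `U⁻¹ ∇ log det U`. -/
theorem logDetGrad_eq_sum (h : IsHessianLike U D) (hx : x ∈ D) (c : Fin 2) :
    logDetGrad U c x = ∑ b, U x c b * logDetField U b x := by
  have h1 : logDetGrad U c x = (U x *ᵥ ((U x)⁻¹ *ᵥ fun c => logDetGrad U c x)) c := by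
    rw [Matrix.mulVec_mulVec, Matrix.mul_nonsing_inv _ (h.isUnit_det x hx), Matrix.one_mulVec]
  exact h1

theorem sum_mul_logDetGrad (h : IsHessianLike U D) (hx : x ∈ D) (v : Fin 2 → ℝ) :
    ∑ b, (∑ j, v j * U x j b) * logDetField U b x = ∑ j, v j * logDetGrad U j x := by
  simp only [h.logDetGrad_eq_sum hx, Finset.mul_sum, Finset.sum_mul]
  rw [Finset.sum_comm]
  exact Finset.sum_congr rfl fun j _ => Finset.sum_congr rfl fun b _ => by ring

theorem contDiffAt_logDetGrad (h : IsHessianLike U D) (hx : x ∈ D) (c : Fin 2) :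
    ContDiffAt ℝ ∞ (logDetGrad U c) x :=
  contDiffAt_trace ((h.smooth_inv hx).mul ((h.smooth x hx).matDeriv c))

theorem contDiffAt_logDetField (h : IsHessianLike U D) (hx : x ∈ D) (j : Fin 2) :
    ContDiffAt ℝ ∞ (logDetField U j) x :=
  ContDiffAt.sum fun c _ => (h.smooth_inv hx j c).mul (h.contDiffAt_logDetGrad hx c)

theorem dirDeriv_logDetGrad (h : IsHessianLike U D) (hx : x ∈ D) (a c : Fin 2) :
    dirDeriv actionFrame a (logDetGrad U c) x
      = (-((U x)⁻¹ * matDeriv actionFrame a U x * (U x)⁻¹) * matDeriv actionFrame c U x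
        + (U x)⁻¹ * matDeriv actionFrame a (matDeriv actionFrame c U) x).trace := by
  have h1 := dirDeriv_trace (b := actionFrame) (i := a)
    ((h.smooth_inv hx).mul ((h.smooth x hx).matDeriv (b := actionFrame) c))
  rw [matDeriv_mul (h.smooth_inv hx) ((h.smooth x hx).matDeriv c),
    matDeriv_inv (h.smooth x hx) (h.isUnit_det x hx)] at h1
  exact h1

theorem dirDeriv_logDetField (h : IsHessianLike U D) (hx : x ∈ D) (a j : Fin 2) :
    dirDeriv actionFrame a (logDetField U j) x
      = ∑ c, ((-((U x)⁻¹ * matDeriv actionFrame a U x * (U x)⁻¹)) j c * logDetGrad U c x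
        + (U x)⁻¹ j c * dirDeriv actionFrame a (logDetGrad U c) x) := by
  have h1 := dirDeriv_sum (b := actionFrame) (i := a) (s := Finset.univ)
    fun c _ => (h.smooth_inv hx j c).mul (h.contDiffAt_logDetGrad hx c)
  refine h1.trans (Finset.sum_congr rfl fun c _ => ?_)
  rw [dirDeriv_mul (h.smooth_inv hx j c) (h.contDiffAt_logDetGrad hx c),
    ← matDeriv_inv (h.smooth x hx) (h.isUnit_det x hx)]
  rfl

theorem smooth_connXX (h : IsHessianLike U D) (hx : x ∈ D) (i : Fin 2) :
    MatSmoothAt (connXX U i) x :=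
  MatSmoothAt.smul contDiffAt_const ((h.smooth_inv hx).mul ((h.smooth x hx).matDeriv i))

theorem smooth_connTT (h : IsHessianLike U D) (hx : x ∈ D) (i : Fin 2) :
    MatSmoothAt (connTT U i) x :=
  MatSmoothAt.smul contDiffAt_const (((h.smooth x hx).matDeriv i).mul (h.smooth_inv hx))

theorem smooth_conj (h : IsHessianLike U D) (hx : x ∈ D) (p : Fin 2) :
    MatSmoothAt (fun z => (U z)⁻¹ * matDeriv actionFrame p U z * (U z)⁻¹) x :=
  ((h.smooth_inv hx).mul ((h.smooth x hx).matDeriv p)).mul (h.smooth_inv hx)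

theorem smooth_connXT (h : IsHessianLike U D) (hx : x ∈ D) (j : Fin 2) :
    MatSmoothAt (connXT U j) x :=
  MatSmoothAt.smul contDiffAt_const (MatSmoothAt.sum fun p _ =>
    MatSmoothAt.smul (h.smooth_inv hx p j) (h.smooth_conj hx p))

theorem smooth_connTX (h : IsHessianLike U D) (hx : x ∈ D) (j : Fin 2) :
    MatSmoothAt (connTX U j) x :=
  MatSmoothAt.smul contDiffAt_const (MatSmoothAt.sum fun p _ =>
    MatSmoothAt.smul (h.smooth_inv hx p j) ((h.smooth x hx).matDeriv p))

theorem matDeriv_conj (h : IsHessianLike U D) (hx : x ∈ D) (k p : Fin 2) :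
    matDeriv actionFrame k (fun z => (U z)⁻¹ * matDeriv actionFrame p U z * (U z)⁻¹) x
      = (-((U x)⁻¹ * matDeriv actionFrame k U x * (U x)⁻¹) * matDeriv actionFrame p U x
          + (U x)⁻¹ * matDeriv actionFrame k (matDeriv actionFrame p U) x) * (U x)⁻¹
        + (U x)⁻¹ * matDeriv actionFrame p U x *
          -((U x)⁻¹ * matDeriv actionFrame k U x * (U x)⁻¹) := by
  rw [matDeriv_mul ((h.smooth_inv hx).mul ((h.smooth x hx).matDeriv p)) (h.smooth_inv hx),
    matDeriv_mul (h.smooth_inv hx) ((h.smooth x hx).matDeriv p),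
    matDeriv_inv (h.smooth x hx) (h.isUnit_det x hx)]

theorem matDeriv_connXX (h : IsHessianLike U D) (hx : x ∈ D) (k i : Fin 2) :
    matDeriv actionFrame k (connXX U i) x
      = (1 / 2 : ℝ) •
        (-((U x)⁻¹ * matDeriv actionFrame k U x * (U x)⁻¹) * matDeriv actionFrame i U x
          + (U x)⁻¹ * matDeriv actionFrame k (matDeriv actionFrame i U) x) := by
  have h1 := matDeriv_const_smul (b := actionFrame) (i := k) (1 / 2)
    ((h.smooth_inv hx).mul ((h.smooth x hx).matDeriv (b := actionFrame) i))
  rw [matDeriv_mul (h.smooth_inv hx) ((h.smooth x hx).matDeriv i),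
    matDeriv_inv (h.smooth x hx) (h.isUnit_det x hx)] at h1
  exact h1

theorem matDeriv_connXT (h : IsHessianLike U D) (hx : x ∈ D) (k j : Fin 2) :
    matDeriv actionFrame k (connXT U j) x
      = (1 / 2 : ℝ) • ∑ p, ((-((U x)⁻¹ * matDeriv actionFrame k U x * (U x)⁻¹)) p j •
          ((U x)⁻¹ * matDeriv actionFrame p U x * (U x)⁻¹) + (U x)⁻¹ p j •
          matDeriv actionFrame k
            (fun z => (U z)⁻¹ * matDeriv actionFrame p U z * (U z)⁻¹) x) := by
  have h1 := matDeriv_const_smul (b := actionFrame) (i := k) (1 / 2)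
    (MatSmoothAt.sum (s := Finset.univ) fun p _ =>
      MatSmoothAt.smul (h.smooth_inv hx p j) (h.smooth_conj hx p))
  rw [matDeriv_sum fun p _ => MatSmoothAt.smul (h.smooth_inv hx p j) (h.smooth_conj hx p)] at h1
  refine h1.trans ?_
  congr 1
  refine Finset.sum_congr rfl fun p _ => ?_
  rw [matDeriv_smul (h.smooth_inv hx p j) (h.smooth_conj hx p),
    ← matDeriv_inv (h.smooth x hx) (h.isUnit_det x hx)]
  rfl

theorem matDeriv_connTX (h : IsHessianLike U D) (hx : x ∈ D) (k j : Fin 2) :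
    matDeriv actionFrame k (connTX U j) x
      = (-1 / 2 : ℝ) • ∑ p, ((-((U x)⁻¹ * matDeriv actionFrame k U x * (U x)⁻¹)) p j •
          matDeriv actionFrame p U x + (U x)⁻¹ p j •
          matDeriv actionFrame k (matDeriv actionFrame p U) x) := by
  have hs : ∀ p, MatSmoothAt (matDeriv actionFrame p U) x := fun p => (h.smooth x hx).matDeriv p
  have h1 := matDeriv_const_smul (b := actionFrame) (i := k) (-1 / 2)
    (MatSmoothAt.sum (s := Finset.univ) fun p _ =>
      MatSmoothAt.smul (h.smooth_inv hx p j) (hs p))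
  rw [matDeriv_sum fun p _ => MatSmoothAt.smul (h.smooth_inv hx p j) (hs p)] at h1
  refine h1.trans ?_
  congr 1
  refine Finset.sum_congr rfl fun p _ => ?_
  rw [matDeriv_smul (h.smooth_inv hx p j) (hs p),
    ← matDeriv_inv (h.smooth x hx) (h.isUnit_det x hx)]
  rfl

theorem eventually_fst_mem (h : IsHessianLike U D) (hq : q.1 ∈ D) : ∀ᶠ p in 𝓝 q, p.1 ∈ D :=
  continuous_fst.continuousAt.eventually_mem (h.isOpen.mem_nhds hq)

theorem matDeriv_connMatrix_inl_inl (h : IsHessianLike U D) (hq : q.1 ∈ D) (k i : Fin 2) :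
    matDeriv toricFrame (Sum.inl k) (connMatrix toricFrame (toricMatrix U) (Sum.inl i)) q
      = Matrix.fromBlocks (matDeriv actionFrame k (connXX U i) q.1) 0 0
        (matDeriv actionFrame k (connTT U i) q.1) := by
  rw [matDeriv_congr ((h.eventually_fst_mem hq).mono fun p hp => h.connMatrix_inl hp i)]
  have h1 := matDeriv_fromBlocks_inl (q := q) (h.smooth_connXX hq i) (matSmoothAt_const 0 _)
    (matSmoothAt_const 0 _) (h.smooth_connTT hq i) k
  rwa [matDeriv_const] at h1

theorem matDeriv_connMatrix_inr_inl (h : IsHessianLike U D) (hq : q.1 ∈ D) (k i : Fin 2) :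
    matDeriv toricFrame (Sum.inr k) (connMatrix toricFrame (toricMatrix U) (Sum.inl i)) q = 0 := by
  rw [matDeriv_congr ((h.eventually_fst_mem hq).mono fun p hp => h.connMatrix_inl hp i)]
  exact matDeriv_fromBlocks_inr (q := q) (h.smooth_connXX hq i) (matSmoothAt_const 0 _)
    (matSmoothAt_const 0 _) (h.smooth_connTT hq i) k

theorem matDeriv_connMatrix_inl_inr (h : IsHessianLike U D) (hq : q.1 ∈ D) (k i : Fin 2) :
    matDeriv toricFrame (Sum.inl k) (connMatrix toricFrame (toricMatrix U) (Sum.inr i)) q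
      = Matrix.fromBlocks 0 (matDeriv actionFrame k (connXT U i) q.1)
        (matDeriv actionFrame k (connTX U i) q.1) 0 := by
  rw [matDeriv_congr ((h.eventually_fst_mem hq).mono fun p hp => h.connMatrix_inr hp i)]
  have h1 := matDeriv_fromBlocks_inl (q := q) (matSmoothAt_const 0 _) (h.smooth_connXT hq i)
    (h.smooth_connTX hq i) (matSmoothAt_const 0 _) k
  rwa [matDeriv_const] at h1

theorem matDeriv_connMatrix_inr_inr (h : IsHessianLike U D) (hq : q.1 ∈ D) (k i : Fin 2) :
    matDeriv toricFrame (Sum.inr k) (connMatrix toricFrame (toricMatrix U) (Sum.inr i)) q = 0 := by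
  rw [matDeriv_congr ((h.eventually_fst_mem hq).mono fun p hp => h.connMatrix_inr hp i)]
  exact matDeriv_fromBlocks_inr (q := q) (matSmoothAt_const 0 _) (h.smooth_connXT hq i)
    (h.smooth_connTX hq i) (matSmoothAt_const 0 _) k

theorem ricciTensor_inl_inr (h : IsHessianLike U D) (hq : q.1 ∈ D) (i j : Fin 2) :
    ricciTensor toricFrame (toricMatrix U) (Sum.inl i) (Sum.inr j) q = 0 := by
  simp [ricciTensor, curvMatrix, h.matDeriv_connMatrix_inl_inr hq, h.connMatrix_inl hq,
    h.matDeriv_connMatrix_inr_inr hq, h.matDeriv_connMatrix_inr_inl hq, h.connMatrix_inr hq,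
    Matrix.fromBlocks_multiply]

theorem ricciTensor_inr_inl (h : IsHessianLike U D) (hq : q.1 ∈ D) (i j : Fin 2) :
    ricciTensor toricFrame (toricMatrix U) (Sum.inr i) (Sum.inl j) q = 0 := by
  simp [ricciTensor, curvMatrix, h.matDeriv_connMatrix_inl_inr hq, h.connMatrix_inl hq,
    h.matDeriv_connMatrix_inl_inl hq, h.matDeriv_connMatrix_inr_inl hq, h.connMatrix_inr hq,
    Matrix.fromBlocks_multiply]

theorem ricciTensor_inr_inr_eq_sum (h : IsHessianLike U D) (hq : q.1 ∈ D) (i j : Fin 2) :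
    ricciTensor toricFrame (toricMatrix U) (Sum.inr i) (Sum.inr j) q
      = ∑ k, (matDeriv actionFrame k (connXT U j) q.1 + connXX U k q.1 * connXT U j q.1
        - connXT U j q.1 * connTT U k q.1) k i
        + ∑ k, (connTX U k q.1 * connXT U j q.1 - connTX U j q.1 * connXT U k q.1) k i := by
  simp [ricciTensor, curvMatrix, h.matDeriv_connMatrix_inl_inr hq, h.connMatrix_inl hq,
    h.matDeriv_connMatrix_inr_inr hq, h.matDeriv_connMatrix_inr_inl hq, h.connMatrix_inr hq,
    Matrix.fromBlocks_multiply]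
  ring

theorem ricciTensor_inl_inl_eq_sum (h : IsHessianLike U D) (hq : q.1 ∈ D) (i j : Fin 2) :
    ricciTensor toricFrame (toricMatrix U) (Sum.inl i) (Sum.inl j) q
      = ∑ k, (matDeriv actionFrame k (connXX U j) q.1 - matDeriv actionFrame j (connXX U k) q.1
        + connXX U k q.1 * connXX U j q.1 - connXX U j q.1 * connXX U k q.1) k i
        + ∑ k, (-matDeriv actionFrame j (connTX U k) q.1 + connTX U k q.1 * connXX U j q.1
          - connTT U j q.1 * connTX U k q.1) k i := by
  simp [ricciTensor, curvMatrix, h.matDeriv_connMatrix_inl_inr hq, h.connMatrix_inl hq,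
    h.matDeriv_connMatrix_inl_inl hq, h.matDeriv_connMatrix_inr_inl hq, h.connMatrix_inr hq,
    Matrix.fromBlocks_multiply]
  ring

end IsHessianLike

end ToricRicciTensor

/-! ### The Ricci tensor of a toric metric -/

section ToricRicciFormula

variable {q : (Fin 2 → ℝ) × (Fin 2 → ℝ)} {U : (Fin 2 → ℝ) → Matrix (Fin 2) (Fin 2) ℝ}
  {D : Set (Fin 2 → ℝ)} {x : Fin 2 → ℝ}

namespace IsHessianLike

theorem sndDeriv_symm (h : IsHessianLike U D) (hx : x ∈ D) (a b k l : Fin 2) :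
    matDeriv actionFrame a (matDeriv actionFrame b U) x k l
      = matDeriv actionFrame a (matDeriv actionFrame k U) x b l :=
  dirDeriv_congr (by filter_upwards [h.isOpen.mem_nhds hx] with z hz using h.deriv_symm z hz b k l)

theorem sndDeriv_swap (h : IsHessianLike U D) (hx : x ∈ D) (a b k l : Fin 2) :
    matDeriv actionFrame a (matDeriv actionFrame b U) x k l
      = matDeriv actionFrame a (matDeriv actionFrame b U) x l k :=
  dirDeriv_congr (by filter_upwards [h.isOpen.mem_nhds hx] with z hz using h.deriv_swap hz b k l)

/-- The partial derivatives of third order are symmetric. -/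
theorem deriv_canonical (h : IsHessianLike U D) (hx : x ∈ D) :
    (matDeriv actionFrame 0 U x 1 0 = matDeriv actionFrame 0 U x 0 1 ∧
      matDeriv actionFrame 1 U x 0 0 = matDeriv actionFrame 0 U x 0 1) ∧
    (matDeriv actionFrame 1 U x 0 1 = matDeriv actionFrame 0 U x 1 1 ∧
      matDeriv actionFrame 1 U x 1 0 = matDeriv actionFrame 0 U x 1 1) := by
  have hs := h.deriv_symm _ hx
  have hs' := h.deriv_swap hx
  exact ⟨⟨hs' 0 1 0, (hs 1 0 0).trans (hs' 0 1 0)⟩, hs 1 0 1, (hs' 1 1 0).trans (hs 1 0 1)⟩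

/-- The partial derivatives of fourth order are symmetric. -/
theorem sndDeriv_canonical (h : IsHessianLike U D) (hx : x ∈ D)
    {Q : Fin 2 → Fin 2 → Matrix (Fin 2) (Fin 2) ℝ}
    (hQdef : ∀ a b, matDeriv actionFrame a (matDeriv actionFrame b U) x = Q a b) :
    (Q 0 0 1 0 = Q 0 0 0 1 ∧ Q 0 1 0 0 = Q 0 0 0 1 ∧ Q 1 0 0 0 = Q 0 0 0 1) ∧
    (Q 0 1 0 1 = Q 0 0 1 1 ∧ Q 0 1 1 0 = Q 0 0 1 1 ∧ Q 1 0 0 1 = Q 0 0 1 1 ∧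
      Q 1 0 1 0 = Q 0 0 1 1 ∧ Q 1 1 0 0 = Q 0 0 1 1) ∧
    (Q 1 0 1 1 = Q 0 1 1 1 ∧ Q 1 1 0 1 = Q 0 1 1 1 ∧ Q 1 1 1 0 = Q 0 1 1 1) := by
  have hs := h.sndDeriv_symm hx
  have hw := h.sndDeriv_swap hx
  have hc : ∀ a b, Q a b = Q b a := fun a b => by
    rw [← hQdef, ← hQdef, matDeriv_comm (h.smooth x hx)]
  simp only [hQdef] at hs hw
  have e1 := hw 0 0 1 0
  have e2 := (hs 0 1 0 0).trans e1
  have e4 := hs 0 1 0 1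
  have e5 := (hw 0 1 1 0).trans e4
  have e7 : Q 1 0 1 0 = Q 0 0 1 1 := by rw [hc, e5]
  have e9 : Q 1 0 1 1 = Q 0 1 1 1 := by rw [hc]
  have e10 := (hs 1 1 0 1).trans e9
  exact ⟨⟨e1, e2, by rw [hc, e2]⟩, ⟨e4, e5, by rw [hc, e4], e7, (hs 1 1 0 0).trans e7⟩,
    e9, e10, (hw 1 1 1 0).trans e10⟩

/-- The Ricci tensor along the torus directions is
`½ ∑_a U^{ia} ∂_a (U⁻¹ ∇ log det U)_j`. -/
theorem ricciTensor_inr_inr (h : IsHessianLike U D) (hq : q.1 ∈ D) (i j : Fin 2) :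
    ricciTensor toricFrame (toricMatrix U) (Sum.inr i) (Sum.inr j) q
      = (1 / 2) * ∑ a, (U q.1)⁻¹ i a * dirDeriv actionFrame a (logDetField U j) q.1 := by
  have hV := h.inv_symm hq 1 0
  obtain ⟨⟨t1, t2⟩, t3, t4⟩ := h.deriv_canonical hq
  obtain ⟨Q, hQ⟩ : ∃ Q : Fin 2 → Fin 2 → Matrix (Fin 2) (Fin 2) ℝ,
    ∀ a b, matDeriv actionFrame a (matDeriv actionFrame b U) q.1 = Q a b := ⟨_, fun _ _ => rfl⟩
  obtain ⟨T, hT⟩ : ∃ T : Fin 2 → Matrix (Fin 2) (Fin 2) ℝ,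
    ∀ a, matDeriv actionFrame a U q.1 = T a := ⟨_, fun _ => rfl⟩
  obtain ⟨⟨q1, q2, q3⟩, ⟨q4, q5, q6, q7, q8⟩, q9, q10, q11⟩ := h.sndDeriv_canonical hq hQ
  simp only [h.ricciTensor_inr_inr_eq_sum hq, h.dirDeriv_logDetField hq, h.dirDeriv_logDetGrad hq,
    h.matDeriv_connXT hq, h.matDeriv_conj hq, logDetGrad, connXX, connXT, connTX, connTT, hQ, hT]
  simp only [hT] at t1 t2 t3 t4
  generalize (U q.1)⁻¹ = V at *
  fin_cases i <;> fin_cases j <;>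
  · simp only [Fin.mk_zero, Fin.mk_one, Fin.isValue, Matrix.mul_apply,
      Fin.sum_univ_two, Matrix.trace, Matrix.diag_apply, Matrix.add_apply, Matrix.sub_apply,
      Matrix.neg_apply, Matrix.smul_apply, smul_eq_mul, hV,
      t1, t2, t3, t4, q1, q2, q3, q4, q5, q6, q7, q8, q9, q10, q11]
    ring

/-- The Ricci tensor along the `x`-plane, in terms of the derivatives of `log det U`. -/
theorem ricciTensor_inl_inl (h : IsHessianLike U D) (hq : q.1 ∈ D) (i j : Fin 2) :
    ricciTensor toricFrame (toricMatrix U) (Sum.inl i) (Sum.inl j) q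
      = (1 / 2) * (dirDeriv actionFrame i (logDetGrad U j) q.1
        - ∑ c, (matDeriv actionFrame i U q.1 * (U q.1)⁻¹) j c * logDetGrad U c q.1) := by
  have hV := h.inv_symm hq 1 0
  obtain ⟨⟨t1, t2⟩, t3, t4⟩ := h.deriv_canonical hq
  obtain ⟨Q, hQ⟩ : ∃ Q : Fin 2 → Fin 2 → Matrix (Fin 2) (Fin 2) ℝ,
    ∀ a b, matDeriv actionFrame a (matDeriv actionFrame b U) q.1 = Q a b := ⟨_, fun _ _ => rfl⟩
  obtain ⟨T, hT⟩ : ∃ T : Fin 2 → Matrix (Fin 2) (Fin 2) ℝ,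
    ∀ a, matDeriv actionFrame a U q.1 = T a := ⟨_, fun _ => rfl⟩
  obtain ⟨⟨q1, q2, q3⟩, ⟨q4, q5, q6, q7, q8⟩, q9, q10, q11⟩ := h.sndDeriv_canonical hq hQ
  simp only [h.ricciTensor_inl_inl_eq_sum hq, h.dirDeriv_logDetGrad hq,
    h.matDeriv_connXX hq, h.matDeriv_connTX hq, logDetGrad, connXX, connTX, connTT, hQ, hT]
  simp only [hT] at t1 t2 t3 t4
  generalize (U q.1)⁻¹ = V at *
  fin_cases i <;> fin_cases j <;>
  · simp only [Fin.mk_zero, Fin.mk_one, Fin.isValue, Matrix.mul_apply,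
      Fin.sum_univ_two, Matrix.trace, Matrix.diag_apply, Matrix.add_apply, Matrix.sub_apply,
      Matrix.neg_apply, Matrix.smul_apply, smul_eq_mul, hV,
      t1, t2, t3, t4, q1, q2, q3, q4, q5, q6, q7, q8, q9, q10, q11]
    ring

/-- The toric metric is Ricci-flat if and only if `U⁻¹ ∇ log det U` is locally constant. -/
theorem ricciTensor_eq_zero_iff (h : IsHessianLike U D) (hq : q.1 ∈ D) :
    (∀ i j, ricciTensor toricFrame (toricMatrix U) i j q = 0)
      ↔ ∀ a j, dirDeriv actionFrame a (logDetField U j) q.1 = 0 := by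
  have hUV := Matrix.mul_nonsing_inv _ (h.isUnit_det _ hq)
  constructor
  · intro h0 a j
    have h1 : (U q.1)⁻¹ *ᵥ (fun a => dirDeriv actionFrame a (logDetField U j) q.1) = 0 := by
      funext i
      have h2 := (h.ricciTensor_inr_inr hq i j).symm.trans (h0 _ _)
      simpa [Matrix.mulVec, dotProduct] using h2
    have h3 := congrArg (fun v => U q.1 *ᵥ v) h1
    simp only [Matrix.mulVec_mulVec, hUV, Matrix.one_mulVec, Matrix.mulVec_zero] at h3
    exact congrFun h3 a
  · intro h0
    have hgrad : ∀ c, logDetGrad U c =ᶠ[𝓝 q.1] fun z => ∑ b, U z c b * logDetField U b z := by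
      intro c
      filter_upwards [h.isOpen.mem_nhds hq] with z hz using h.logDetGrad_eq_sum hz c
    have hd : ∀ i c, dirDeriv actionFrame i (logDetGrad U c) q.1
        = ∑ b, matDeriv actionFrame i U q.1 c b * logDetField U b q.1 := by
      intro i c
      rw [dirDeriv_congr (hgrad c),
        dirDeriv_sum fun b _ => (h.smooth _ hq c b).mul (h.contDiffAt_logDetField hq b)]
      refine Finset.sum_congr rfl fun b _ => ?_
      rw [dirDeriv_mul (h.smooth _ hq c b) (h.contDiffAt_logDetField hq b), h0, mul_zero, add_zero]
      rfl
    intro i j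
    rcases i with i | i <;> rcases j with j | j
    · rw [h.ricciTensor_inl_inl hq, hd]
      simp only [logDetField, Matrix.mul_apply, Finset.sum_mul, Finset.mul_sum]
      rw [Finset.sum_comm]
      simp [mul_assoc]
    · exact h.ricciTensor_inl_inr hq i j
    · exact h.ricciTensor_inr_inl hq i j
    · rw [h.ricciTensor_inr_inr hq]
      simp [h0]

end IsHessianLike

end ToricRicciFormula

/-! ### The matrix of a Riemannian metric in a chart -/

section Chart

variable {m : ℕ} {X : Type*} [TopologicalSpace X] [ChartedSpace (EuclideanSpace ℝ (Fin m)) X]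
  [IsManifold (𝓡 m) ∞ X]

theorem contDiffOn_metricInChart
    (g : Bundle.ContMDiffRiemannianMetric (𝓡 m) ∞ (EuclideanSpace ℝ (Fin m))
      (fun p : X => TangentSpace (𝓡 m) p))
    {e : OpenPartialHomeomorph X (EuclideanSpace ℝ (Fin m))}
    (he : e ∈ atlas (EuclideanSpace ℝ (Fin m)) X) (i j : Fin m) :
    ContDiffOn ℝ ∞ (fun y => metricInChart g e y i j) e.target := by
  have hsymm : ContMDiffOn (𝓡 m) (𝓡 m) ∞ e.symm e.target :=
    contMDiffOn_symm_of_mem_maximalAtlas (IsManifold.subset_maximalAtlas he)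
  have hv : ∀ v : EuclideanSpace ℝ (Fin m), ContMDiffOn (𝓡 m) (𝓡 m).tangent ∞
      (fun y => (⟨e.symm y, mfderiv (𝓡 m) (𝓡 m) e.symm y v⟩ : TangentBundle (𝓡 m) X))
      e.target := by
    intro v
    have h1 := hsymm.contMDiffOn_tangentMapWithin (m := ∞) (by simp) e.open_target.uniqueMDiffOn
    have h2 : ContMDiffOn (𝓡 m) (𝓡 m).tangent ∞
        (fun y => (⟨y, v⟩ : TangentBundle (𝓡 m) (EuclideanSpace ℝ (Fin m)))) e.target :=
      contMDiffOn_vectorSpace_iff_contDiffOn.2 contDiffOn_const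
    refine (h1.comp h2 fun y hy => hy).congr fun y hy => ?_
    simp only [Function.comp, tangentMapWithin]
    rw [mfderivWithin_of_isOpen e.open_target hy]
  rw [← contMDiffOn_iff_contDiffOn]
  intro y hy
  have h := ContMDiffWithinAt.clm_bundle_apply₂ (F₁ := EuclideanSpace ℝ (Fin m))
    (F₂ := EuclideanSpace ℝ (Fin m))
    (F₃ := ℝ) (E₃ := fun _ : X => ℝ)
    ((g.contMDiff.contMDiffAt (x := e.symm y)).comp_contMDiffWithinAt y (hsymm y hy))
    (hv (EuclideanSpace.single i 1) y hy) (hv (EuclideanSpace.single j 1) y hy)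
  exact (Bundle.contMDiffWithinAt_totalSpace.1 h).2

theorem metricInChart_isSymm
    (g : Bundle.ContMDiffRiemannianMetric (𝓡 m) ∞ (EuclideanSpace ℝ (Fin m))
      (fun p : X => TangentSpace (𝓡 m) p))
    (e : OpenPartialHomeomorph X (EuclideanSpace ℝ (Fin m))) (y : EuclideanSpace ℝ (Fin m)) :
    (metricInChart g e y)ᵀ = metricInChart g e y := by
  ext i j
  exact g.symm _ _ _

theorem inner_mfderiv_chart_symm
    (g : Bundle.ContMDiffRiemannianMetric (𝓡 m) ∞ (EuclideanSpace ℝ (Fin m))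
      (fun p : X => TangentSpace (𝓡 m) p))
    (e : OpenPartialHomeomorph X (EuclideanSpace ℝ (Fin m))) (y v w : EuclideanSpace ℝ (Fin m)) :
    g.inner (e.symm y) (mfderiv (𝓡 m) (𝓡 m) e.symm y v) (mfderiv (𝓡 m) (𝓡 m) e.symm y w)
      = ∑ i, ∑ j, v i * metricInChart g e y i j * w j := by
  have hd : ∀ z : EuclideanSpace ℝ (Fin m), mfderiv (𝓡 m) (𝓡 m) e.symm y z
      = ∑ i, z i • mfderiv (𝓡 m) (𝓡 m) e.symm y (EuclideanSpace.single i (1 : ℝ)) := by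
    intro z
    conv_lhs => rw [sum_smul_single z]
    erw [map_sum]
    refine Finset.sum_congr rfl fun i _ => ?_
    erw [map_smul]
  rw [hd v, hd w]
  simp only [map_sum, map_smul, _root_.sum_apply, _root_.smul_apply,
    smul_eq_mul, Finset.mul_sum]
  rw [Finset.sum_comm]
  refine Finset.sum_congr rfl fun i _ => Finset.sum_congr rfl fun j _ => ?_
  simp only [metricInChart, Matrix.of_apply]
  ring

theorem isUnit_det_metricInChart
    (g : Bundle.ContMDiffRiemannianMetric (𝓡 m) ∞ (EuclideanSpace ℝ (Fin m))
      (fun p : X => TangentSpace (𝓡 m) p))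
    {e : OpenPartialHomeomorph X (EuclideanSpace ℝ (Fin m))}
    (he : e ∈ atlas (EuclideanSpace ℝ (Fin m)) X) {y : EuclideanSpace ℝ (Fin m)}
    (hy : y ∈ e.target) : IsUnit (metricInChart g e y).det := by
  have hmax := IsManifold.subset_maximalAtlas (I := 𝓡 m) (n := ∞) he
  have hinj : ∀ v : EuclideanSpace ℝ (Fin m), mfderiv (𝓡 m) (𝓡 m) e.symm y v = 0 → v = 0 := by
    intro v hv
    have h1 : MDifferentiableAt (𝓡 m) (𝓡 m) e.symm y :=
      ((contMDiffOn_symm_of_mem_maximalAtlas hmax).contMDiffAt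
        (e.open_target.mem_nhds hy)).mdifferentiableAt (by simp)
    have h2 : MDifferentiableAt (𝓡 m) (𝓡 m) e (e.symm y) :=
      ((contMDiffOn_of_mem_maximalAtlas hmax).contMDiffAt
        (e.open_source.mem_nhds (e.map_target hy))).mdifferentiableAt (by simp)
    have h3 := mfderiv_comp y h2 h1
    have h4 : mfderiv (𝓡 m) (𝓡 m) (e ∘ e.symm) y = ContinuousLinearMap.id ℝ _ := by
      rw [Filter.EventuallyEq.mfderiv_eq (f := id), mfderiv_id]
      filter_upwards [e.open_target.mem_nhds hy] with z hz using e.right_inv hz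
    rw [h4] at h3
    have h5 := congrArg (fun L => L v) h3
    have h6 : v = mfderiv (𝓡 m) (𝓡 m) e (e.symm y) (mfderiv (𝓡 m) (𝓡 m) e.symm y v) := h5
    rw [hv] at h6
    exact h6.trans (map_zero _)
  rw [isUnit_iff_ne_zero]
  intro h0
  obtain ⟨v, hv0, hv⟩ := Matrix.exists_mulVec_eq_zero_iff.2 h0
  set v' : EuclideanSpace ℝ (Fin m) := WithLp.toLp 2 v
  have hne : mfderiv (𝓡 m) (𝓡 m) e.symm y v' ≠ 0 := fun h => hv0 (by
    have := hinj v' h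
    ext i
    exact congrArg (fun z : EuclideanSpace ℝ (Fin m) => z i) this)
  have hpos := g.pos _ _ hne
  rw [inner_mfderiv_chart_symm] at hpos
  have : ∑ i, ∑ j, v' i * metricInChart g e y i j * v' j = v ⬝ᵥ (metricInChart g e y *ᵥ v) := by
    simp only [dotProduct, Matrix.mulVec, Finset.mul_sum]
    exact Finset.sum_congr rfl fun i _ => Finset.sum_congr rfl fun j _ => by simp [v']; ring
  rw [this, hv] at hpos
  simp at hpos

end Chart

/-! ### Ricci-flatness in action-angle coordinates -/

section ActionAngle

variable {n : ℕ} {P : MomentPolygon n} {u : (Fin 2 → ℝ) → ℝ}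
  {X : Type*} [TopologicalSpace X] [ChartedSpace (EuclideanSpace ℝ (Fin 4)) X]
  [IsManifold (𝓡 4) ∞ X]
  {g : Bundle.ContMDiffRiemannianMetric (𝓡 4) ∞ (EuclideanSpace ℝ (Fin 4))
    (fun p : X => TangentSpace (𝓡 4) p)}
  {Φ : (Fin 2 → ℝ) × (Fin 2 → ℝ) → X}

theorem toricMetric_toricFrame (x : Fin 2 → ℝ) (θ : Fin 2 → ℝ) (i j : Fin 2 ⊕ Fin 2) :
    toricMetric u x (toricFrame i) (toricFrame j) = toricMatrix (hess u) (x, θ) i j := by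
  rcases i with i | i <;> rcases j with j | j <;>
    simp [toricMetric, toricFrame, toricMatrix]

/-- Action-angle coordinates, read in a chart of the manifold, pull the metric of the chart back to
the toric metric. -/
theorem IsActionAngle.isMetricPullback (hΦ : IsActionAngle P u g Φ)
    (h : IsHessianLike (hess u) (interior P.carrier))
    {e : OpenPartialHomeomorph X (EuclideanSpace ℝ (Fin 4))}
    (he : e ∈ atlas (EuclideanSpace ℝ (Fin 4)) X) :
    IsMetricPullback toricFrame (fun q => e (Φ q)) (metricInChart g e) (toricMatrix (hess u))
      ((interior P.carrier ×ˢ univ) ∩ Φ ⁻¹' e.source) := by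
  have hopen : IsOpen (interior P.carrier ×ˢ (univ : Set (Fin 2 → ℝ))) :=
    isOpen_interior.prod isOpen_univ
  have hs : IsOpen ((interior P.carrier ×ˢ univ) ∩ Φ ⁻¹' e.source) :=
    hΦ.smooth.continuousOn.isOpen_inter_preimage hopen e.open_source
  have hmax := IsManifold.subset_maximalAtlas (I := 𝓡 4) (n := ∞) he
  have hψ : ∀ z ∈ (interior P.carrier ×ˢ univ) ∩ Φ ⁻¹' e.source,
      ContDiffAt ℝ ∞ (fun q => e (Φ q)) z := by
    intro z hz
    rw [← contMDiffAt_iff_contDiffAt]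
    exact ((contMDiffOn_of_mem_maximalAtlas hmax).contMDiffAt
      (e.open_source.mem_nhds hz.2)).comp z (hΦ.smooth.contMDiffAt (hopen.mem_nhds hz.1))
  refine ⟨hs, by simp, hψ, ?_, ?_, ?_, ?_, ?_⟩
  · intro z hz k l
    exact (contDiffOn_metricInChart g he k l).contDiffAt
      (e.open_target.mem_nhds (e.map_source hz.2))
  · exact fun z hz => isUnit_det_metricInChart g he (e.map_source hz.2)
  · exact fun z _ => Filter.Eventually.of_forall fun w => metricInChart_isSymm g e w
  · intro z hz
    have hd : DifferentiableAt ℝ (fun q => e (Φ q)) z := (hψ z hz).differentiableAt (by simp)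
    have hev : Φ =ᶠ[𝓝 z] e.symm ∘ (fun q => e (Φ q)) := by
      filter_upwards [hs.mem_nhds hz] with w hw using (e.left_inv hw.2).symm
    have hsymm : MDifferentiableAt (𝓡 4) (𝓡 4) e.symm (e (Φ z)) :=
      ((contMDiffOn_symm_of_mem_maximalAtlas hmax).contMDiffAt
        (e.open_target.mem_nhds (e.map_source hz.2))).mdifferentiableAt (by simp)
    have hmf : ∀ v : (Fin 2 → ℝ) × (Fin 2 → ℝ),
        (mfderiv 𝓘(ℝ, (Fin 2 → ℝ) × (Fin 2 → ℝ)) (𝓡 4) Φ z v : EuclideanSpace ℝ (Fin 4))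
          = mfderiv (𝓡 4) (𝓡 4) e.symm (e (Φ z)) (fderiv ℝ (fun q => e (Φ q)) z v) := by
      intro v
      have h1 := hev.mfderiv_eq (I := 𝓘(ℝ, (Fin 2 → ℝ) × (Fin 2 → ℝ))) (I' := 𝓡 4)
      have h2 := mfderiv_comp z hsymm hd.mdifferentiableAt
      rw [mfderiv_eq_fderiv] at h2
      have h3 := h1.trans h2
      exact congrArg (fun L => L v) h3
    ext i j
    obtain ⟨x, θ⟩ := z
    rw [← toricMetric_toricFrame x θ, ← hΦ.pullback (x, θ) hz.1]
    have hB : ∀ p p' : X, p = p' → ∀ v w : EuclideanSpace ℝ (Fin 4),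
        g.inner p v w = g.inner p' v w := by rintro p _ rfl v w; rfl
    refine (hB _ _ (e.left_inv hz.2).symm _ _).trans ?_
    rw [hmf, hmf]
    refine (inner_mfderiv_chart_symm g e (e (Φ (x, θ))) _ _).trans ?_
    simp only [Matrix.mul_apply, Finset.sum_mul, Matrix.transpose_apply, jacobian_apply hd]
    rw [Finset.sum_comm]
  · exact fun z hz => h.isUnit_det_toricMatrix hz.1.1

/-- A Riemannian manifold with action-angle coordinates is Ricci-flat if and only if the vector
field `U⁻¹ ∇ log det U`, where `U` is the Hessian of the symplectic potential, has vanishing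
derivative on the interior of the polygon. -/
theorem IsActionAngle.ricciFlat_iff (hΦ : IsActionAngle P u g Φ)
    (h : IsHessianLike (hess u) (interior P.carrier)) :
    RicciFlat g ↔ ∀ x ∈ interior P.carrier, ∀ a j,
      dirDeriv actionFrame a (logDetField (hess u) j) x = 0 := by
  have heq : ∀ (e : OpenPartialHomeomorph X (EuclideanSpace ℝ (Fin 4))) y i j,
      ricci (metricInChart g e) i j y = ricciTensor (stdFrame 4) (metricInChart g e) i j y :=
    fun e y i j => ricci_eq_ricciTensor
      (Filter.Eventually.of_forall fun w => metricInChart_isSymm g e w) i j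
  constructor
  · intro hR x hx
    have he := chart_mem_atlas (EuclideanSpace ℝ (Fin 4)) (Φ (x, 0))
    have hq : (x, (0 : Fin 2 → ℝ)) ∈ (interior P.carrier ×ˢ univ) ∩
        Φ ⁻¹' (chartAt (EuclideanSpace ℝ (Fin 4)) (Φ (x, 0))).source :=
      ⟨⟨hx, mem_univ _⟩, mem_chart_source _ _⟩
    refine (h.ricciTensor_eq_zero_iff (q := (x, 0)) hx).1 ?_
    refine ((hΦ.isMetricPullback h he).ricciTensor_eq_zero_iff hq).2 fun i j => ?_
    rw [← heq]
    exact hR _ he _ (OpenPartialHomeomorph.map_source _ hq.2) i j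
  · intro h0 e he y hy i j
    rw [heq]
    have hcont : ContinuousAt (ricciTensor (stdFrame 4) (metricInChart g e) i j) y :=
      continuousAt_ricciTensor (fun k l => (contDiffOn_metricInChart g he k l).contDiffAt
        (e.open_target.mem_nhds hy)) (isUnit_det_metricInChart g he hy) i j
    have hcl : y ∈ closure (e '' (e.source ∩ Φ '' (interior P.carrier ×ˢ univ))) := by
      have h1 := hΦ.dense.open_subset_closure_inter e.open_source (e.map_target hy)
      have h2 := mem_closure_image (e.continuousAt (e.map_target hy)) h1
      rwa [e.right_inv hy] at h2
    have hzero : ∀ w ∈ e '' (e.source ∩ Φ '' (interior P.carrier ×ˢ univ)),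
        ricciTensor (stdFrame 4) (metricInChart g e) i j w = 0 := by
      rintro _ ⟨_, ⟨hs, q, hq, rfl⟩, rfl⟩
      exact ((hΦ.isMetricPullback h he).ricciTensor_eq_zero_iff ⟨hq, hs⟩).1
        ((h.ricciTensor_eq_zero_iff hq.1).2 (h0 q.1 hq.1)) i j
    by_contra hne
    obtain ⟨w, hw, hw0⟩ := ((mem_closure_iff_frequently.1 hcl).and_eventually
      (hcont.eventually_ne hne)).exists
    exact hw0 (hzero w hw)

end ActionAngle

/-! ### Moment polygons -/

namespace MomentPolygon

variable {n : ℕ} (P : MomentPolygon n)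

theorem det2_nu (i j : Fin (n + 1)) :
    det2 (P.nu i) (P.nu j) = (det2 (P.normal i) (P.normal j) : ℤ) := by
  simp [det2, nu, toReal2]

theorem det2_nu_consecutive (i : Fin n) : det2 (P.nu i.castSucc) (P.nu i.succ) = -1 := by
  rw [det2_nu, P.consecutive_det]; simp

theorem pos_size {n : ℕ} (P : MomentPolygon n) : 0 < n := by
  by_contra h
  obtain rfl : n = 0 := by omega
  exact P.not_parallel (by simp [det2, mul_comm])

theorem ell_eq (j : Fin (n + 1)) (x : Fin 2 → ℝ) :
    ell P.normal P.offset j x = x 0 * P.nu j 0 + x 1 * P.nu j 1 + P.offset j := by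
  simp [ell, nu, dotProduct, Fin.sum_univ_two]

theorem continuous_ell (j : Fin (n + 1)) : Continuous (ell P.normal P.offset j) := by
  have : ell P.normal P.offset j = fun x => x 0 * P.nu j 0 + x 1 * P.nu j 1 + P.offset j :=
    funext (P.ell_eq j)
  rw [this]
  fun_prop

theorem isOpen_ell_pos : IsOpen {x | ∀ j, 0 < ell P.normal P.offset j x} := by
  simp only [ofPred_forall]
  exact isOpen_iInter_of_finite fun j => isOpen_lt continuous_const (P.continuous_ell j)

theorem nu_sq_add_sq_pos (j : Fin (n + 1)) : 0 < P.nu j 0 ^ 2 + P.nu j 1 ^ 2 := by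
  by_contra hneg
  have h0 : P.nu j 0 = 0 := by nlinarith [sq_nonneg (P.nu j 0), sq_nonneg (P.nu j 1)]
  have h1 : P.nu j 1 = 0 := by nlinarith [sq_nonneg (P.nu j 0), sq_nonneg (P.nu j 1)]
  obtain ⟨a, b, hab⟩ := P.primitive j
  have h0' : P.normal j 0 = 0 := by simpa [nu, toReal2] using h0
  have h1' : P.normal j 1 = 0 := by simpa [nu, toReal2] using h1
  simp [h0', h1'] at hab

theorem interior_carrier : interior P.carrier = {x | ∀ j, 0 < ell P.normal P.offset j x} := by
  apply Subset.antisymm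
  · intro x hx j
    refine lt_of_le_of_ne (interior_subset hx j) fun h0 => ?_
    -- moving against the normal leaves the polygon at once
    have hc : ContinuousAt (fun t : ℝ => (x - t • P.nu j : Fin 2 → ℝ)) 0 := by fun_prop
    have hev : ∀ᶠ t : ℝ in 𝓝 0, x - t • P.nu j ∈ P.carrier := by
      refine hc.eventually_mem ?_
      simpa using mem_interior_iff_mem_nhds.1 hx
    obtain ⟨t, ht, ht0⟩ := ((hev.filter_mono nhdsWithin_le_nhds).and
      (self_mem_nhdsWithin : Ioi (0 : ℝ) ∈ 𝓝[>] 0)).exists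
    have h1 := ht j
    have h2 := P.nu_sq_add_sq_pos j
    rw [P.ell_eq] at h1 h0
    simp only [Pi.sub_apply, Pi.smul_apply, smul_eq_mul] at h1
    have h3 : 0 < t * (P.nu j 0 ^ 2 + P.nu j 1 ^ 2) := mul_pos ht0 h2
    nlinarith
  · exact interior_maximal (fun x hx j => (hx j).le) P.isOpen_ell_pos

theorem convex_interior_carrier : Convex ℝ (interior P.carrier) := by
  rw [P.interior_carrier]
  intro x hx y hy s t hs ht hst j
  have h1 := hx j
  have h2 := hy j
  rw [P.ell_eq] at *
  have h3 : (s • x + t • y) 0 * P.nu j 0 + (s • x + t • y) 1 * P.nu j 1 + P.offset j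
      = s * (x 0 * P.nu j 0 + x 1 * P.nu j 1 + P.offset j)
        + t * (y 0 * P.nu j 0 + y 1 * P.nu j 1 + P.offset j) := by
    simp only [Pi.add_apply, Pi.smul_apply, smul_eq_mul]
    linear_combination (-P.offset j) * hst
  rw [h3]
  rcases hs.eq_or_lt with rfl | hs
  · have : t = 1 := by linarith
    subst this; linarith
  · exact add_pos_of_pos_of_nonneg (mul_pos hs h1) (mul_nonneg ht h2.le)

/-- An edge is bounded if the normals of two other edges lie on different sides of its normal. -/
theorem isBounded_edge {j k m : Fin (n + 1)} (hk : 0 < det2 (P.nu j) (P.nu k))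
    (hm : det2 (P.nu j) (P.nu m) < 0) : Bornology.IsBounded (edge P.normal P.offset j) := by
  obtain ⟨v, hv, -⟩ := (P.edge_nontrivial j)
  set α := det2 (P.nu j) (P.nu k) with hα
  set β := det2 (P.nu j) (P.nu m) with hβ
  set A := ell P.normal P.offset k v
  set B := ell P.normal P.offset m v
  have hc : Continuous fun s : ℝ => (![v 0 + s * P.nu j 1, v 1 - s * P.nu j 0] : Fin 2 → ℝ) := by
    fun_prop
  refine ((isCompact_Icc (a := B / β) (b := A / α)).image hc).isBounded.subset ?_
  intro x hx
  have hN := P.nu_sq_add_sq_pos j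
  have hx0 := hx.2
  have hv0 := hv.2
  rw [P.ell_eq] at hx0 hv0
  -- `s` is the coordinate of `x - v` along the edge
  set s := ((x 0 - v 0) * P.nu j 1 - (x 1 - v 1) * P.nu j 0) / (P.nu j 0 ^ 2 + P.nu j 1 ^ 2)
    with hs
  have hsm : s * (P.nu j 0 ^ 2 + P.nu j 1 ^ 2)
      = (x 0 - v 0) * P.nu j 1 - (x 1 - v 1) * P.nu j 0 := div_mul_cancel₀ _ hN.ne'
  have e0 : x 0 = v 0 + s * P.nu j 1 := by
    apply mul_right_cancel₀ hN.ne'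
    linear_combination (-P.nu j 1) * hsm + P.nu j 0 * hx0 - P.nu j 0 * hv0
  have e1 : x 1 = v 1 - s * P.nu j 0 := by
    apply mul_right_cancel₀ hN.ne'
    linear_combination (P.nu j 0) * hsm + P.nu j 1 * hx0 - P.nu j 1 * hv0
  have hell : ∀ l, ell P.normal P.offset l x
      = ell P.normal P.offset l v - s * det2 (P.nu j) (P.nu l) := by
    intro l
    rw [P.ell_eq, P.ell_eq, e0, e1, det2]
    ring
  have h1 := hx.1 k
  have h2 := hx.1 m
  rw [hell] at h1 h2
  refine ⟨s, ⟨?_, ?_⟩, ?_⟩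
  · rw [div_le_iff_of_neg hm]; linarith
  · rw [le_div_iff₀ hk]; linarith
  · ext i; fin_cases i <;> simp [e0, e1]

theorem det2_nu_zero_nonpos (k : Fin (n + 1)) : det2 (P.nu 0) (P.nu k) ≤ 0 := by
  by_contra! h
  obtain ⟨m, rfl⟩ : ∃ m, n = m + 1 := ⟨n - 1, by have := P.pos_size; omega⟩
  have h1 := P.det2_nu_consecutive 0
  exact (P.unbounded_edges 0).2 (Or.inl rfl)
    (P.isBounded_edge h (m := (0 : Fin (m + 1)).succ) (by simp at h1 ⊢; linarith))

theorem det2_nu_last_nonneg (k : Fin (n + 1)) : 0 ≤ det2 (P.nu (Fin.last n)) (P.nu k) := by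
  by_contra! h
  obtain ⟨m, rfl⟩ : ∃ m, n = m + 1 := ⟨n - 1, by have := P.pos_size; omega⟩
  have h1 := P.det2_nu_consecutive (Fin.last m)
  rw [Fin.succ_last] at h1
  refine (P.unbounded_edges (Fin.last _)).2 (Or.inr rfl)
    (P.isBounded_edge (k := (Fin.last m).castSucc) ?_ h)
  simp only [det2] at h1 ⊢
  linarith

theorem det2_nu_zero_last_neg : det2 (P.nu 0) (P.nu (Fin.last n)) < 0 := by
  refine lt_of_le_of_ne (P.det2_nu_zero_nonpos _) fun h => P.not_parallel ?_
  rw [det2_nu] at h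
  exact_mod_cast h

theorem det2_nu_last_pos {k : Fin n} : 0 < det2 (P.nu (Fin.last n)) (P.nu k.castSucc) := by
  refine lt_of_le_of_ne (P.det2_nu_last_nonneg _) fun h => ?_
  have h1 := P.det2_nu_consecutive k
  have h2 := P.det2_nu_zero_last_neg
  have h3 := P.det2_nu_zero_nonpos k.castSucc
  have h4 := P.det2_nu_last_nonneg k.succ
  have h5 : det2 (P.nu k.castSucc) (P.nu k.succ) * det2 (P.nu 0) (P.nu (Fin.last n))
      = det2 (P.nu (Fin.last n)) (P.nu k.castSucc) * -det2 (P.nu 0) (P.nu k.succ)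
        + det2 (P.nu 0) (P.nu k.castSucc) * det2 (P.nu (Fin.last n)) (P.nu k.succ) := by
    simp only [det2]; ring
  rw [h1, ← h] at h5
  nlinarith

/-- The normals turn clockwise, by less than a half-turn in total. -/
theorem det2_nu_neg (i j : Fin (n + 1)) : i < j → det2 (P.nu i) (P.nu j) < 0 := by
  induction j using Fin.induction with
  | zero => intro h; simp at h
  | succ k ih =>
    intro h
    have h1 := P.det2_nu_consecutive k
    rcases (Fin.le_castSucc_iff.2 h).eq_or_lt with rfl | hlt
    · linarith
    · have hi : i = (⟨i, (show i.val < k.val from hlt).trans k.2⟩ : Fin n).castSucc := rfl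
      have h2 : 0 < det2 (P.nu (Fin.last n)) (P.nu i) := by rw [hi]; exact P.det2_nu_last_pos
      have h3 : 0 < det2 (P.nu (Fin.last n)) (P.nu k.castSucc) := P.det2_nu_last_pos
      have h4 := P.det2_nu_last_nonneg k.succ
      have h5 := ih hlt
      have h6 : det2 (P.nu i) (P.nu k.succ) * det2 (P.nu (Fin.last n)) (P.nu k.castSucc)
          = det2 (P.nu i) (P.nu k.castSucc) * det2 (P.nu (Fin.last n)) (P.nu k.succ)
            + det2 (P.nu k.castSucc) (P.nu k.succ) * det2 (P.nu (Fin.last n)) (P.nu i) := by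
        simp only [det2]; ring
      rw [h1] at h6
      by_contra! hcon
      nlinarith [mul_nonneg hcon h3.le, mul_nonneg (neg_nonneg.2 h5.le) h4]

/-- All normals are nonnegative combinations of the first and the last one. -/
theorem det2_nu_nonneg_of_ends {w : Fin 2 → ℝ} (h0 : 0 ≤ det2 w (P.nu 0))
    (h1 : 0 ≤ det2 w (P.nu (Fin.last n))) (j : Fin (n + 1)) : 0 ≤ det2 w (P.nu j) := by
  have h2 := P.det2_nu_zero_last_neg
  have h3 := P.det2_nu_zero_nonpos j
  have h4 := P.det2_nu_last_nonneg j
  have h5 : det2 w (P.nu j) * -det2 (P.nu 0) (P.nu (Fin.last n))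
      = det2 (P.nu (Fin.last n)) (P.nu j) * det2 w (P.nu 0)
        + -det2 (P.nu 0) (P.nu j) * det2 w (P.nu (Fin.last n)) := by
    simp only [det2]; ring
  by_contra! hcon
  nlinarith [mul_nonneg h4 h0, mul_nonneg (neg_nonneg.2 h3) h1]

/-- The partial sums `∑_{k < j} a_k (ν_{k+1} - ν_k)`. -/
def partialSum (a : Fin n → ℝ) (j : Fin (n + 1)) : Fin 2 → ℝ :=
  ∑ k : Fin n with k.castSucc < j, a k • (P.nu k.succ - P.nu k.castSucc)

theorem partialSum_succ (a : Fin n → ℝ) (k : Fin n) :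
    P.partialSum a k.succ
      = P.partialSum a k.castSucc + a k • (P.nu k.succ - P.nu k.castSucc) := by
  have : (Finset.univ.filter fun i : Fin n => i.castSucc < k.succ)
      = insert k (Finset.univ.filter fun i : Fin n => i.castSucc < k.castSucc) := by
    ext i
    simp only [Finset.mem_filter, Finset.mem_univ, true_and, Finset.mem_insert,
      Fin.castSucc_lt_castSucc_iff, Fin.castSucc_lt_succ_iff]
    exact le_iff_eq_or_lt
  unfold partialSum
  rw [this, Finset.sum_insert (by simp), add_comm]

theorem sum_mul_det2 (a : Fin n → ℝ) (j : Fin (n + 1)) (w : Fin 2 → ℝ) :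
    ∑ k : Fin n with k.castSucc < j, a k * det2 (P.nu k.succ - P.nu k.castSucc) w
      = det2 (P.partialSum a j) w := by
  simp only [det2, partialSum, Finset.sum_apply, Pi.smul_apply, smul_eq_mul, Finset.sum_mul,
    ← Finset.sum_sub_distrib]
  exact Finset.sum_congr rfl fun k _ => by ring

/-- The numbers `a_i` adjusted to the polygon increase: `a_{i+1} - a_i` is the value of `ℓ_{i+2}` at
the vertex where `E_i` and `E_{i+1}` meet. -/
theorem strictMono_of_adjusted {a : Fin n → ℝ} {c : Fin 2 → ℝ} (hac : Adjusted P a c) :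
    StrictMono a := by
  obtain ⟨m, rfl⟩ : ∃ m, n = m + 1 := ⟨n - 1, by have := P.pos_size; omega⟩
  rw [Fin.strictMono_iff_lt_succ]
  intro i
  have hd01 := P.det2_nu_consecutive i.castSucc
  have hd12 := P.det2_nu_consecutive i.succ
  have hs1 := P.partialSum_succ a i.castSucc
  have hs2 := P.partialSum_succ a i.succ
  have hA : ∀ j, c 0 * P.nu j 0 + c 1 * P.nu j 1 + P.offset j
      = det2 (P.partialSum a j) (P.nu j) := by
    intro j
    rw [← P.sum_mul_det2, ← hac j]
    simp [dotProduct, Fin.sum_univ_two]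
  have hA0 := hA i.castSucc.castSucc
  have hA1 := hA i.castSucc.succ
  have hA2 := hA i.succ.succ
  have hs10 := congrFun hs1 0
  have hs11 := congrFun hs1 1
  have hs20 := congrFun hs2 0
  have hs21 := congrFun hs2 1
  have hedge := P.edge_nontrivial i.castSucc.succ
  have hidx : i.succ.castSucc = i.castSucc.succ := rfl
  simp only [hidx] at hs20 hs21 hd12
  generalize i.castSucc.castSucc = j0 at *
  generalize i.castSucc.succ = j1 at *
  generalize i.succ.succ = j2 at *
  simp only [Pi.add_apply, Pi.smul_apply, Pi.sub_apply, smul_eq_mul] at hs10 hs11 hs20 hs21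
  simp only [det2] at hd01 hd12 hA0 hA1 hA2
  set d := P.nu j0 0 * P.nu j2 1 - P.nu j0 1 * P.nu j2 0 with hd
  have h20 : P.nu j2 0 = -P.nu j0 0 - d * P.nu j1 0 := by
    linear_combination P.nu j2 0 * hd01 + P.nu j0 0 * hd12 + P.nu j1 0 * hd
  have h21 : P.nu j2 1 = -P.nu j0 1 - d * P.nu j1 1 := by
    linear_combination P.nu j2 1 * hd01 + P.nu j0 1 * hd12 + P.nu j1 1 * hd
  clear_value d
  have key : ∀ x, ell P.normal P.offset j1 x = 0 →
      ell P.normal P.offset j2 x = a i.succ - a i.castSucc - ell P.normal P.offset j0 x := by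
    intro x hx
    rw [P.ell_eq] at hx
    rw [P.ell_eq, P.ell_eq]
    rw [hs20, hs21, h20, h21] at hA2
    rw [hs10, hs11] at hA1 hA2
    rw [h20, h21]
    linear_combination hA0 + hA2 + d * hA1 - d * hx + (a i.castSucc - a i.succ) * hd01
  obtain ⟨x, hx, y, hy, hxy⟩ := hedge
  by_contra! hle
  have hzero : ∀ z ∈ edge P.normal P.offset j1, ell P.normal P.offset j0 z = 0 := by
    intro z hz
    have h1 := key z hz.2
    have h2 := hz.1 j2
    have h3 := hz.1 j0
    linarith
  have hx0 := hzero x hx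
  have hy0 := hzero y hy
  have hx1 := hx.2
  have hy1 := hy.2
  rw [P.ell_eq] at hx0 hy0 hx1 hy1
  refine hxy (funext fun k => ?_)
  fin_cases k
  · simp only [Fin.zero_eta]
    linear_combination (x 0 - y 0) * hd01 - P.nu j1 1 * (hx0 - hy0) + P.nu j0 1 * (hx1 - hy1)
  · simp only [Fin.mk_one]
    linear_combination (x 1 - y 1) * hd01 - P.nu j0 0 * (hx1 - hy1) + P.nu j1 0 * (hx0 - hy0)

end MomentPolygon

/-! ### The action coordinates map into the polygon -/

section RealInequalities

theorem sq_rho (a H r : ℝ) : rho a H r ^ 2 = (H + a) ^ 2 + r ^ 2 := by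
  unfold rho; exact Real.sq_sqrt (by positivity)

theorem abs_le_rho (a H r : ℝ) : |H + a| ≤ rho a H r := by
  unfold rho
  rw [← Real.sqrt_sq_eq_abs]
  exact Real.sqrt_le_sqrt (by nlinarith [sq_nonneg r])

theorem abs_rho_sub_lt {a b H r : ℝ} (hr : 0 < r) (hab : a < b) :
    |rho b H r - rho a H r| < b - a := by
  have ha := rho_pos (a := a) (H := H) hr
  have hb := rho_pos (a := b) (H := H) hr
  have ha2 := sq_rho a H r
  have hb2 := sq_rho b H r
  have h1 : (H + a) * (H + b) + r ^ 2 < rho a H r * rho b H r := by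
    refine lt_of_le_of_lt (le_abs_self _) (abs_lt_of_sq_lt_sq ?_ (by positivity))
    rw [mul_pow, ha2, hb2]
    nlinarith [mul_pos (pow_pos hr 2) (pow_pos (sub_pos.2 hab) 2)]
  refine abs_lt_of_sq_lt_sq ?_ (by linarith)
  nlinarith

theorem div_rho_lt_one {a H r : ℝ} (hr : 0 < r) : (H + a) / rho a H r < 1 := by
  rw [div_lt_one (rho_pos hr)]
  nlinarith [sq_rho a H r, rho_pos (a := a) (H := H) hr, pow_pos hr 2]

theorem neg_one_lt_div_rho {a H r : ℝ} (hr : 0 < r) : -1 < (H + a) / rho a H r := by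
  rw [lt_div_iff₀ (rho_pos hr)]
  linarith [add_rho_pos (a := a) (H := H) hr]

theorem div_rho_lt_div_rho {a b H r : ℝ} (hr : 0 < r) (hab : a < b) :
    (H + a) / rho a H r < (H + b) / rho b H r := by
  have ha := rho_pos (a := a) (H := H) hr
  have hb := rho_pos (a := b) (H := H) hr
  have ha2 := sq_rho a H r
  have hb2 := sq_rho b H r
  rw [div_lt_div_iff₀ ha hb]
  have hr2 := pow_pos hr 2
  rcases le_or_gt 0 (H + a) with h | h
  · refine lt_of_pow_lt_pow_left₀ 2 (by nlinarith) ?_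
    rw [mul_pow, mul_pow, ha2, hb2]
    nlinarith [mul_pos hr2 (show 0 < (H + b) ^ 2 - (H + a) ^ 2 by nlinarith)]
  · rcases le_or_gt 0 (H + b) with h' | h'
    · exact lt_of_lt_of_le (mul_neg_of_neg_of_pos h hb) (mul_nonneg h' ha.le)
    · have : -(H + b) * rho a H r < -(H + a) * rho b H r := by
        refine lt_of_pow_lt_pow_left₀ 2 (by nlinarith) ?_
        rw [mul_pow, mul_pow, ha2, hb2]
        nlinarith [mul_pos hr2 (show 0 < (H + a) ^ 2 - (H + b) ^ 2 by nlinarith)]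
      linarith

theorem sqrt_one_sub_sq_div_rho {a H r : ℝ} (hr : 0 < r) :
    √(1 - ((H + a) / rho a H r) ^ 2) = r / rho a H r := by
  have ha := rho_pos (a := a) (H := H) hr
  have h1 : 1 - ((H + a) / rho a H r) ^ 2 = (r / rho a H r) ^ 2 := by
    have := sq_rho a H r
    field_simp
    linarith
  rw [h1, Real.sqrt_sq (by positivity)]

/-- The upper half of the unit circle is the graph of a strictly concave function. -/
theorem strictConcaveOn_sqrt_one_sub_sq :
    StrictConcaveOn ℝ (Icc (-1) 1) fun x : ℝ => √(1 - x ^ 2) := by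
  refine ⟨convex_Icc _ _, fun x hx y hy hxy p q hp hq hpq => ?_⟩
  have h1 : 0 ≤ 1 - x ^ 2 := by nlinarith [hx.1, hx.2]
  have h2 : 0 ≤ 1 - y ^ 2 := by nlinarith [hy.1, hy.2]
  simp only [smul_eq_mul]
  set A := √(1 - x ^ 2)
  set B := √(1 - y ^ 2)
  have hA : A ^ 2 = 1 - x ^ 2 := Real.sq_sqrt h1
  have hB : B ^ 2 = 1 - y ^ 2 := Real.sq_sqrt h2
  have hA0 : 0 ≤ A := Real.sqrt_nonneg _
  have hB0 : 0 ≤ B := Real.sqrt_nonneg _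
  refine Real.lt_sqrt_of_sq_lt ?_
  have h3 : 0 < (x - y) ^ 2 := by
    have := sub_ne_zero.2 hxy
    positivity
  have h4 : x * y + A * B < 1 := by nlinarith [sq_nonneg (A - B)]
  have h5 : q = 1 - p := by linarith
  subst h5
  have h6 := mul_pos (mul_pos hp hq) (sub_pos.2 h4)
  have h7 : 1 - (p * x + (1 - p) * y) ^ 2 - (p * A + (1 - p) * B) ^ 2
      = 2 * (p * (1 - p) * (1 - (x * y + A * B))) := by
    linear_combination (-p ^ 2) * hA - (1 - p) ^ 2 * hB
  linarith

/-- Slopes of successive chords of the upper half of the unit circle decrease. -/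
theorem chord_slope_lt {x₁ x₂ x₃ x₄ : ℝ} (h0 : -1 ≤ x₁) (h12 : x₁ < x₂) (h23 : x₂ ≤ x₃)
    (h34 : x₃ < x₄) (h1 : x₄ ≤ 1) :
    (√(1 - x₁ ^ 2) - √(1 - x₂ ^ 2)) * (x₄ - x₃)
      < (√(1 - x₃ ^ 2) - √(1 - x₄ ^ 2)) * (x₂ - x₁) := by
  have hc := strictConcaveOn_sqrt_one_sub_sq
  have hlt : (√(1 - x₄ ^ 2) - √(1 - x₃ ^ 2)) / (x₄ - x₃)
      < (√(1 - x₂ ^ 2) - √(1 - x₁ ^ 2)) / (x₂ - x₁) := by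
    rcases h23.eq_or_lt with rfl | h23
    · exact hc.slope_anti_adjacent ⟨h0, by linarith⟩ ⟨by linarith, h1⟩ h12 h34
    · exact (hc.slope_anti_adjacent ⟨by linarith, by linarith⟩ ⟨by linarith, h1⟩ h23 h34).trans
        (hc.slope_anti_adjacent ⟨h0, by linarith⟩ ⟨by linarith, by linarith⟩ h12 h23)
  rw [div_lt_div_iff₀ (by linarith) (by linarith)] at hlt
  linarith

end RealInequalities

section Abel

variable {n : ℕ}

/-- Summation by parts. -/
theorem sum_sub_mul (ν : Fin (n + 1) → ℝ) (φ : Fin n → ℝ) (s t : ℝ) :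
    ∑ i : Fin n, (ν i.succ - ν i.castSucc) * φ i
      = ∑ j, ν j * ((Fin.cons s φ : Fin (n + 1) → ℝ) j - (Fin.snoc φ t : Fin (n + 1) → ℝ) j)
        - ν 0 * s + ν (Fin.last n) * t := by
  have h1 : ∑ j, ν j * (Fin.cons s φ : Fin (n + 1) → ℝ) j
      = ν 0 * s + ∑ i : Fin n, ν i.succ * φ i := by simp [Fin.sum_univ_succ]
  have h2 : ∑ j, ν j * (Fin.snoc φ t : Fin (n + 1) → ℝ) j
      = ∑ i : Fin n, ν i.castSucc * φ i + ν (Fin.last n) * t := by simp [Fin.sum_univ_castSucc]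
  simp only [mul_sub, sub_mul, Finset.sum_sub_distrib, h1, h2]
  ring

end Abel

namespace MomentPolygon

variable {n : ℕ} (P : MomentPolygon n)

theorem partialSum_one (j : Fin (n + 1)) : P.partialSum (fun _ => 1) j = P.nu j - P.nu 0 := by
  induction j using Fin.induction with
  | zero => simp [partialSum]
  | succ k ih => rw [P.partialSum_succ, ih, one_smul]; abel

variable {P} {a : Fin n → ℝ} {nu c : Fin 2 → ℝ}

/-- The factor of `det(ν_{i+1} - ν_i, ν_j)` in the formula for `ℓ_j` on the half-plane: `ρ_i` plus
or minus `H + a_i`, according to the side of the vertex `i` on which the edge `E_j` lies. -/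
def ellTerm (a : Fin n → ℝ) (H r : ℝ) (j : Fin (n + 1)) (i : Fin n) : ℝ :=
  if i.castSucc < j then rho (a i) H r + (H + a i) else rho (a i) H r - (H + a i)

/-- The affine functions of the polygon in the coordinates `(H, r)`; all additive constants cancel
because `a` and `c` are adjusted to the polygon. -/
theorem ell_actionMap (hac : Adjusted P a c) (H r : ℝ) (j : Fin (n + 1)) :
    ell P.normal P.offset j (actionMap P a nu c H r)
      = (1 / 2) * ∑ i : Fin n, (det2 (P.nu i.succ) (P.nu j) - det2 (P.nu i.castSucc) (P.nu j))
          * ellTerm a H r j i + r ^ 2 / 2 * det2 nu (P.nu j) := by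
  have h1 := P.sum_mul_det2 (fun _ => 1) j (P.nu j)
  rw [partialSum_one] at h1
  have h2 := hac j
  have hsub : ∀ i : Fin n, det2 (P.nu i.succ - P.nu i.castSucc) (P.nu j)
      = det2 (P.nu i.succ) (P.nu j) - det2 (P.nu i.castSucc) (P.nu j) := fun i => by
    simp only [det2, Pi.sub_apply]; ring
  have h3 : ∀ i : Fin n, (det2 (P.nu i.succ) (P.nu j) - det2 (P.nu i.castSucc) (P.nu j))
          * ellTerm a H r j i
        = 2 * (H * (if i.castSucc < j then 1 * det2 (P.nu i.succ - P.nu i.castSucc) (P.nu j) else 0)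
          + (if i.castSucc < j then a i * det2 (P.nu i.succ - P.nu i.castSucc) (P.nu j) else 0))
          - P.nu j 1 * ((P.nu i.succ 0 - P.nu i.castSucc 0) * (H + a i - rho (a i) H r))
          + P.nu j 0 * ((P.nu i.succ 1 - P.nu i.castSucc 1) * (H + a i - rho (a i) H r)) := by
    intro i
    rw [hsub, ellTerm]
    split_ifs <;> simp only [det2] <;> ring
  simp only [h3, Finset.sum_add_distrib, Finset.sum_sub_distrib, ← Finset.mul_sum,
    ← Finset.sum_filter, h1, ← h2]
  rw [P.ell_eq]
  simp only [actionMap, dotProduct, Fin.sum_univ_two, det2, Pi.sub_apply, Matrix.cons_val_zero,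
    Matrix.cons_val_one]
  ring

/-- After summation by parts, every term of `ℓ_j` except the one of `E_j` itself is positive. -/
theorem ellTerm_pos (ha : StrictMono a) {H r : ℝ} (hr : 0 < r) {j k : Fin (n + 1)}
    (hkj : k ≠ j) :
    0 < det2 (P.nu k) (P.nu j) * ((Fin.cons 0 (ellTerm a H r j) : Fin (n + 1) → ℝ) k
      - (Fin.snoc (ellTerm a H r j) 0 : Fin (n + 1) → ℝ) k) := by
  rcases lt_or_gt_of_ne hkj with hlt | hlt
  · refine mul_pos_of_neg_of_neg (P.det2_nu_neg _ _ hlt) ?_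
    obtain ⟨k, rfl⟩ : ∃ k' : Fin n, k = k'.castSucc :=
      (Fin.exists_castSucc_eq.2 (Fin.ne_last_of_lt hlt)).imp fun _ h => h.symm
    rw [Fin.snoc_castSucc]
    have h1 : ellTerm a H r j k = rho (a k) H r + (H + a k) := if_pos hlt
    rcases Fin.eq_zero_or_eq_succ k.castSucc with h0 | ⟨l, hl⟩
    · rw [h0, Fin.cons_zero, h1]
      linarith [add_rho_pos (a := a k) (H := H) hr]
    · rw [hl, Fin.cons_succ, h1]
      have hlk : l < k := by
        have : l.castSucc < k.castSucc := by rw [hl]; exact Fin.castSucc_lt_succ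
        exact this
      have h2 : ellTerm a H r j l = rho (a l) H r + (H + a l) :=
        if_pos ((Fin.castSucc_lt_castSucc_iff.2 hlk).trans hlt)
      rw [h2]
      have := abs_lt.1 (abs_rho_sub_lt (H := H) hr (ha hlk))
      linarith [this.1]
  · have hdet : 0 < det2 (P.nu k) (P.nu j) := by
      have := P.det2_nu_neg _ _ hlt
      simp only [det2] at this ⊢
      linarith
    refine mul_pos hdet ?_
    obtain ⟨k, rfl⟩ : ∃ k' : Fin n, k = k'.succ :=
      (Fin.exists_succ_eq.2 (Fin.ne_zero_of_lt hlt)).imp fun _ h => h.symm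
    rw [Fin.cons_succ]
    have h1 : ellTerm a H r j k = rho (a k) H r - (H + a k) :=
      if_neg (not_lt.2 (Fin.le_castSucc_iff.2 hlt))
    rcases Fin.eq_castSucc_or_eq_last k.succ with ⟨l, hl⟩ | h0
    · rw [hl, Fin.snoc_castSucc, h1]
      have hkl : k < l := by
        have : k.castSucc < l.castSucc := by rw [← hl]; exact Fin.castSucc_lt_succ
        exact this
      have h2 : ellTerm a H r j l = rho (a l) H r - (H + a l) :=
        if_neg (not_lt.2 (by rw [← hl]; exact hlt.le))
      rw [h2]
      have := abs_lt.1 (abs_rho_sub_lt (H := H) hr (ha hkl))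
      linarith [this.2]
    · rw [h0, Fin.snoc_last, h1]
      have := abs_lt.1 (show |H + a k| < rho (a k) H r from by
        rw [← Real.sqrt_sq_eq_abs]
        exact Real.sqrt_lt_sqrt (sq_nonneg _) (by nlinarith [pow_pos hr 2]))
      linarith [this.2]

theorem ell_actionMap_eq_sum (hac : Adjusted P a c) (H r : ℝ) (j : Fin (n + 1)) :
    ell P.normal P.offset j (actionMap P a nu c H r)
      = (1 / 2) * ∑ k, det2 (P.nu k) (P.nu j) *
          ((Fin.cons 0 (ellTerm a H r j) : Fin (n + 1) → ℝ) k
            - (Fin.snoc (ellTerm a H r j) 0 : Fin (n + 1) → ℝ) k)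
        + r ^ 2 / 2 * det2 nu (P.nu j) := by
  rw [ell_actionMap hac, sum_sub_mul (fun k => det2 (P.nu k) (P.nu j)) _ 0 0]
  simp

theorem ellTerm_nonneg (ha : StrictMono a) {H r : ℝ} (hr : 0 < r) (j k : Fin (n + 1)) :
    0 ≤ det2 (P.nu k) (P.nu j) * ((Fin.cons 0 (ellTerm a H r j) : Fin (n + 1) → ℝ) k
      - (Fin.snoc (ellTerm a H r j) 0 : Fin (n + 1) → ℝ) k) := by
  by_cases hkj : k = j
  · subst hkj
    have : det2 (P.nu k) (P.nu k) = 0 := by simp only [det2]; ring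
    rw [this, zero_mul]
  · exact (ellTerm_pos ha hr hkj).le

theorem term_le_ell_actionMap (hac : Adjusted P a c) (hnu : ∀ j, 0 ≤ det2 nu (P.nu j)) {H r : ℝ}
    (hr : 0 < r) (j k : Fin (n + 1)) :
    (1 / 2) * (det2 (P.nu k) (P.nu j) * ((Fin.cons 0 (ellTerm a H r j) : Fin (n + 1) → ℝ) k
      - (Fin.snoc (ellTerm a H r j) 0 : Fin (n + 1) → ℝ) k))
      ≤ ell P.normal P.offset j (actionMap P a nu c H r) := by
  have ha := P.strictMono_of_adjusted hac
  rw [ell_actionMap_eq_sum hac]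
  have h1 := Finset.single_le_sum (fun k _ => ellTerm_nonneg (P := P) ha (H := H) hr j k)
    (Finset.mem_univ k)
  have h2 : 0 ≤ r ^ 2 / 2 * det2 nu (P.nu j) := mul_nonneg (by positivity) (hnu j)
  linarith

/-- The action coordinates map the half-plane into the interior of the polygon. -/
theorem actionMap_mem_interior (hac : Adjusted P a c) (hnu : ∀ j, 0 ≤ det2 nu (P.nu j)) {H r : ℝ}
    (hr : 0 < r) : actionMap P a nu c H r ∈ interior P.carrier := by
  rw [P.interior_carrier]
  intro j
  obtain ⟨k, hk⟩ : ∃ k, k ≠ j := by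
    have : Nontrivial (Fin (n + 1)) := Fin.nontrivial_iff_two_le.2 (by have := P.pos_size; omega)
    exact exists_ne j
  refine lt_of_lt_of_le ?_ (term_le_ell_actionMap hac hnu hr j k)
  exact mul_pos one_half_pos (ellTerm_pos (P.strictMono_of_adjusted hac) hr hk)

/-- The two unbounded edges control the distance to the origin of the half-plane. -/
theorem exists_rho_le (hac : Adjusted P a c) (hnu : ∀ j, 0 ≤ det2 nu (P.nu j)) :
    ∃ A b C : ℝ, 0 < A ∧ ∀ H r, 0 < r → rho b H r ≤
      A * (ell P.normal P.offset 0 (actionMap P a nu c H r)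
        + ell P.normal P.offset (Fin.last n) (actionMap P a nu c H r)) + C := by
  obtain ⟨m, rfl⟩ : ∃ m, n = m + 1 := ⟨n - 1, by have := P.pos_size; omega⟩
  have hD : 0 < -det2 (P.nu 0) (P.nu (Fin.last (m + 1))) := neg_pos.2 P.det2_nu_zero_last_neg
  set D := -det2 (P.nu 0) (P.nu (Fin.last (m + 1))) with hDdef
  refine ⟨2 / D, a 0, a (Fin.last m) - a 0, by positivity, fun H r hr => ?_⟩
  have h1 := term_le_ell_actionMap hac hnu (H := H) hr 0 (Fin.last m).succ
  have h2 := term_le_ell_actionMap hac hnu (H := H) hr (Fin.last (m + 1)) (0 : Fin (m + 1)).castSucc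
  have e1 : ellTerm a H r 0 (Fin.last m) = rho (a (Fin.last m)) H r - (H + a (Fin.last m)) :=
    if_neg (by simp)
  have e2 : ellTerm a H r (Fin.last (m + 1)) 0 = rho (a 0) H r + (H + a 0) :=
    if_pos (Fin.castSucc_lt_last _)
  have e3 : det2 (P.nu (Fin.last (m + 1))) (P.nu 0) = D := by rw [hDdef]; simp only [det2]; ring
  rw [Fin.cons_succ, e1, Fin.succ_last, Fin.snoc_last, e3] at h1
  rw [Fin.snoc_castSucc, e2, Fin.castSucc_zero, Fin.cons_zero,
    show det2 (P.nu 0) (P.nu (Fin.last (m + 1))) = -D by rw [hDdef]; ring] at h2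
  have h3 := rho_pos (a := a (Fin.last m)) (H := H) hr
  rw [← sub_le_iff_le_add, div_mul_eq_mul_div, le_div_iff₀ hD]
  nlinarith [mul_pos hD h3]

/-- The boundary `r = 0` of the half-plane is mapped to the boundary lines of the polygon. -/
theorem exists_ell_eq_zero (hac : Adjusted P a c) (H : ℝ) :
    ∃ j, ell P.normal P.offset j (actionMap P a nu c H 0) = 0 := by
  have ha := P.strictMono_of_adjusted hac
  have hrho : ∀ i, rho (a i) H 0 = |H + a i| := fun i => by
    unfold rho; simp [Real.sqrt_sq_eq_abs]
  obtain ⟨j, hj⟩ : ∃ j : Fin (n + 1), ∀ i : Fin n,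
      (i.castSucc < j → H + a i ≤ 0) ∧ (¬i.castSucc < j → 0 ≤ H + a i) := by
    by_cases hex : {i | 0 ≤ H + a i}.Nonempty
    · obtain ⟨i, hi, hmin⟩ := wellFounded_lt.has_min _ hex
      refine ⟨i.castSucc, fun k => ⟨fun hk => ?_, fun hk => ?_⟩⟩
      · exact (not_le.1 fun h => hmin k h (Fin.castSucc_lt_castSucc_iff.1 hk)).le
      · have := ha.monotone (not_lt.1 fun h => hk (Fin.castSucc_lt_castSucc_iff.2 h))
        have hi' : 0 ≤ H + a i := hi
        linarith
    · refine ⟨Fin.last n, fun k => ⟨fun _ => ?_, fun hk => absurd (Fin.castSucc_lt_last k) hk⟩⟩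
      exact (not_le.1 fun h => hex ⟨k, h⟩).le
  refine ⟨j, ?_⟩
  rw [ell_actionMap hac]
  have : ∀ i, ellTerm a H 0 j i = 0 := by
    intro i
    unfold ellTerm
    rw [hrho]
    split_ifs with h
    · rw [abs_of_nonpos ((hj i).1 h)]; ring
    · rw [abs_of_nonneg ((hj i).2 h)]; ring
  simp [this]

end MomentPolygon

/-! ### The Jacobian determinant of the map to the gradient of the potential -/

namespace MomentPolygon

variable {n : ℕ} (P : MomentPolygon n) (a : Fin n → ℝ) (nu c : Fin 2 → ℝ)

/-- The derivative `∂ξ/∂H`. -/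
def xiDerivH (H r : ℝ) (k : Fin 2) : ℝ :=
  (1 / 2) * ∑ i : Fin n, (P.nu i.succ k - P.nu i.castSucc k) * (1 / rho (a i) H r) + nu k

/-- The derivative `∂ξ/∂r`. -/
def xiDerivR (H r : ℝ) (k : Fin 2) : ℝ :=
  P.nu 0 k / r + (1 / 2) * ∑ i : Fin n, (P.nu i.succ k - P.nu i.castSucc k) *
    ((1 - (H + a i) / rho (a i) H r) / r)

/-- The cosines `(H + a_i) / ρ_i`, with `-1` put in front. -/
def cosLeft (H r : ℝ) : Fin (n + 1) → ℝ := Fin.cons (-1) fun i => (H + a i) / rho (a i) H r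

/-- The cosines `(H + a_i) / ρ_i`, with `1` put at the end. -/
def cosRight (H r : ℝ) : Fin (n + 1) → ℝ := Fin.snoc (fun i => (H + a i) / rho (a i) H r) 1

variable {a}

theorem neg_one_le_cosLeft {H r : ℝ} (hr : 0 < r) (j : Fin (n + 1)) : -1 ≤ cosLeft a H r j := by
  refine Fin.cases ?_ (fun i => ?_) j
  · simp [cosLeft]
  · simpa [cosLeft] using (neg_one_lt_div_rho (a := a i) hr).le

theorem cosRight_le_one {H r : ℝ} (hr : 0 < r) (j : Fin (n + 1)) : cosRight a H r j ≤ 1 := by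
  refine Fin.lastCases ?_ (fun i => ?_) j
  · simp [cosRight]
  · simpa [cosRight] using (div_rho_lt_one (a := a i) hr).le

theorem cosLeft_lt_cosRight (ha : StrictMono a) {H r : ℝ} (hr : 0 < r) (j : Fin (n + 1)) :
    cosLeft a H r j < cosRight a H r j := by
  rcases Fin.eq_zero_or_eq_succ j with rfl | ⟨i, rfl⟩
  · refine Fin.lastCases (motive := fun j => (-1 : ℝ) < cosRight a H r j) ?_ (fun i => ?_) 0
    · simp [cosRight]
    · simpa [cosRight] using neg_one_lt_div_rho (a := a i) hr
  · have h1 : cosLeft a H r i.succ = (H + a i) / rho (a i) H r := Fin.cons_succ _ _ _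
    rw [h1]
    rcases Fin.eq_castSucc_or_eq_last i.succ with ⟨l, hl⟩ | h0
    · rw [hl, cosRight, Fin.snoc_castSucc]
      have hil : i < l := by
        have : i.castSucc < l.castSucc := by rw [← hl]; exact Fin.castSucc_lt_succ
        exact this
      exact div_rho_lt_div_rho hr (ha hil)
    · rw [h0, cosRight, Fin.snoc_last]
      exact div_rho_lt_one hr

theorem cosRight_le_cosLeft (ha : StrictMono a) {H r : ℝ} (hr : 0 < r) {j k : Fin (n + 1)}
    (hjk : j < k) : cosRight a H r j ≤ cosLeft a H r k := by
  obtain ⟨j, rfl⟩ : ∃ j' : Fin n, j = j'.castSucc :=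
    (Fin.exists_castSucc_eq.2 (Fin.ne_last_of_lt hjk)).imp fun _ h => h.symm
  obtain ⟨k, rfl⟩ : ∃ k' : Fin n, k = k'.succ :=
    (Fin.exists_succ_eq.2 (Fin.ne_zero_of_lt hjk)).imp fun _ h => h.symm
  rw [cosRight, cosLeft, Fin.snoc_castSucc, Fin.cons_succ]
  rcases (Fin.castSucc_lt_succ_iff.1 hjk).eq_or_lt with rfl | h
  · exact le_rfl
  · exact (div_rho_lt_div_rho hr (ha h)).le

variable (a)

theorem xiDerivR_eq (H : ℝ) {r : ℝ} (hr : 0 < r) (k : Fin 2) :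
    P.xiDerivR a H r k
      = (1 / (2 * r)) * ∑ j, P.nu j k * (cosRight a H r j - cosLeft a H r j) := by
  have h1 := sum_sub_mul (fun j => P.nu j k) (fun i => 1 - (H + a i) / rho (a i) H r) 2 0
  have h2 : ∀ j, (Fin.cons 2 (fun i => 1 - (H + a i) / rho (a i) H r) : Fin (n + 1) → ℝ) j
      = 1 - cosLeft a H r j := fun j => by
    refine Fin.cases ?_ (fun i => ?_) j
    · simp [cosLeft]; norm_num
    · simp [cosLeft]
  have h3 : ∀ j, (Fin.snoc (fun i => 1 - (H + a i) / rho (a i) H r) 0 : Fin (n + 1) → ℝ) j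
      = 1 - cosRight a H r j := fun j => by
    refine Fin.lastCases ?_ (fun i => ?_) j <;> simp [cosRight]
  simp only [h2, h3, sub_sub_sub_cancel_left, mul_zero, add_zero] at h1
  have h4 : ∑ i : Fin n, (P.nu i.succ k - P.nu i.castSucc k) *
      ((1 - (H + a i) / rho (a i) H r) / r) = (∑ i : Fin n, (P.nu i.succ k - P.nu i.castSucc k) *
      (1 - (H + a i) / rho (a i) H r)) / r := by
    rw [Finset.sum_div]
    exact Finset.sum_congr rfl fun i _ => by ring
  rw [xiDerivR, h4, h1]
  field_simp
  ring

theorem xiDerivH_eq (H : ℝ) {r : ℝ} (hr : 0 < r) (k : Fin 2) :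
    P.xiDerivH a nu H r k
      = nu k + (1 / (2 * r)) * ∑ j, P.nu j k * (√(1 - cosLeft a H r j ^ 2)
        - √(1 - cosRight a H r j ^ 2)) := by
  have h1 := sum_sub_mul (fun j => P.nu j k) (fun i => r / rho (a i) H r) 0 0
  have h2 : ∀ j, (Fin.cons 0 (fun i => r / rho (a i) H r) : Fin (n + 1) → ℝ) j
      = √(1 - cosLeft a H r j ^ 2) := fun j => by
    refine Fin.cases ?_ (fun i => ?_) j
    · simp [cosLeft]
    · simp [cosLeft, sqrt_one_sub_sq_div_rho hr]
  have h3 : ∀ j, (Fin.snoc (fun i => r / rho (a i) H r) 0 : Fin (n + 1) → ℝ) j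
      = √(1 - cosRight a H r j ^ 2) := fun j => by
    refine Fin.lastCases ?_ (fun i => ?_) j
    · simp [cosRight]
    · simp [cosRight, sqrt_one_sub_sq_div_rho hr]
  simp only [h2, h3, mul_zero, sub_zero, add_zero] at h1
  have h4 : ∑ i : Fin n, (P.nu i.succ k - P.nu i.castSucc k) * (r / rho (a i) H r)
      = r * ∑ i : Fin n, (P.nu i.succ k - P.nu i.castSucc k) * (1 / rho (a i) H r) := by
    rw [Finset.mul_sum]
    exact Finset.sum_congr rfl fun i _ => by ring
  rw [h4] at h1
  rw [xiDerivH, ← h1]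
  field_simp
  ring

/-- A double sum of products of two antisymmetric expressions of the same sign is positive. -/
theorem sum_mul_det2_pos {s t : Fin (n + 1) → ℝ}
    (hst : ∀ j k, j < k → s j * t k < s k * t j) :
    0 < ∑ j, ∑ k, s j * t k * det2 (P.nu j) (P.nu k) := by
  have h1 : 2 * ∑ j, ∑ k, s j * t k * det2 (P.nu j) (P.nu k)
      = ∑ j, ∑ k, (s j * t k - s k * t j) * det2 (P.nu j) (P.nu k) := by
    have h2 : ∑ j, ∑ k, s j * t k * det2 (P.nu j) (P.nu k)
        = ∑ j, ∑ k, -(s k * t j) * det2 (P.nu j) (P.nu k) := by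
      rw [Finset.sum_comm]
      refine Finset.sum_congr rfl fun j _ => Finset.sum_congr rfl fun k _ => ?_
      simp only [det2]; ring
    rw [two_mul]
    nth_rw 2 [h2]
    simp only [← Finset.sum_add_distrib]
    refine Finset.sum_congr rfl fun j _ => Finset.sum_congr rfl fun k _ => ?_
    ring
  have hpos : ∀ j k, j ≠ k → 0 < (s j * t k - s k * t j) * det2 (P.nu j) (P.nu k) := by
    intro j k hjk
    rcases lt_or_gt_of_ne hjk with h | h
    · exact mul_pos_of_neg_of_neg (sub_neg.2 (hst j k h)) (P.det2_nu_neg j k h)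
    · have h3 := mul_pos_of_neg_of_neg (sub_neg.2 (hst k j h)) (P.det2_nu_neg k j h)
      simp only [det2] at h3 ⊢
      linarith
  have hnn : ∀ j k, 0 ≤ (s j * t k - s k * t j) * det2 (P.nu j) (P.nu k) := by
    intro j k
    by_cases hjk : j = k
    · subst hjk; simp
    · exact (hpos j k hjk).le
  have hne : (0 : Fin (n + 1)) ≠ Fin.last n := by
    intro h
    have := congrArg Fin.val h
    have := P.pos_size
    simp at *
    omega
  have h4 : 0 < ∑ j, ∑ k, (s j * t k - s k * t j) * det2 (P.nu j) (P.nu k) :=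
    Finset.sum_pos' (fun j _ => Finset.sum_nonneg fun k _ => hnn j k)
      ⟨0, Finset.mem_univ _, Finset.sum_pos' (fun k _ => hnn 0 k)
        ⟨Fin.last n, Finset.mem_univ _, hpos _ _ hne⟩⟩
  linarith

/-- The map `(H, r) ↦ ξ` is a local diffeomorphism: its Jacobian determinant is positive. Both
derivatives are combinations of the normals; the coefficients come from the chords of the polygon
inscribed in the unit half-circle with vertices `(cosine, sine)`, and chord slopes decrease. -/
theorem det2_xiDeriv_pos (ha : StrictMono a) (hnu : ∀ j, 0 ≤ det2 nu (P.nu j)) (H : ℝ) {r : ℝ}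
    (hr : 0 < r) : 0 < det2 (P.xiDerivH a nu H r) (P.xiDerivR a H r) := by
  set t : Fin (n + 1) → ℝ := fun j => cosRight a H r j - cosLeft a H r j with ht
  set s : Fin (n + 1) → ℝ := fun j => √(1 - cosLeft a H r j ^ 2) - √(1 - cosRight a H r j ^ 2)
    with hs
  have htpos : ∀ j, 0 < t j := fun j => sub_pos.2 (cosLeft_lt_cosRight ha hr j)
  have hst : ∀ j k, j < k → s j * t k < s k * t j := fun j k hjk =>
    chord_slope_lt (neg_one_le_cosLeft hr j) (cosLeft_lt_cosRight ha hr j)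
      (cosRight_le_cosLeft ha hr hjk) (cosLeft_lt_cosRight ha hr k) (cosRight_le_one hr k)
  have h1 := P.sum_mul_det2_pos hst
  have h2 : 0 ≤ ∑ j, t j * det2 nu (P.nu j) :=
    Finset.sum_nonneg fun j _ => mul_nonneg (htpos j).le (hnu j)
  have h3 : ∑ j, t j * det2 nu (P.nu j)
      = nu 0 * (∑ j, P.nu j 1 * t j) - nu 1 * ∑ j, P.nu j 0 * t j := by
    simp only [Finset.mul_sum, ← Finset.sum_sub_distrib, det2]
    exact Finset.sum_congr rfl fun j _ => by ring
  have h4 : ∑ j, ∑ k, s j * t k * det2 (P.nu j) (P.nu k)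
      = (∑ j, P.nu j 0 * s j) * (∑ k, P.nu k 1 * t k)
        - (∑ j, P.nu j 1 * s j) * ∑ k, P.nu k 0 * t k := by
    simp only [Finset.sum_mul_sum, ← Finset.sum_sub_distrib, det2]
    exact Finset.sum_congr rfl fun j _ => Finset.sum_congr rfl fun k _ => by ring
  have h5 : det2 (P.xiDerivH a nu H r) (P.xiDerivR a H r)
      = (1 / (2 * r)) * (∑ j, t j * det2 nu (P.nu j))
        + (1 / (2 * r)) ^ 2 * ∑ j, ∑ k, s j * t k * det2 (P.nu j) (P.nu k) := by
    rw [h3, h4]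
    simp only [det2, P.xiDerivR_eq a H hr, P.xiDerivH_eq a nu H hr]
    ring
  rw [h5]
  have h6 : 0 < 1 / (2 * r) := by positivity
  have := mul_pos (pow_pos h6 2) h1
  have := mul_nonneg h6.le h2
  linarith

end MomentPolygon

/-! ### The action coordinates are onto the interior of the polygon -/

namespace MomentPolygon

variable {n : ℕ} {P : MomentPolygon n} {a : Fin n → ℝ} {nu c : Fin 2 → ℝ}

/-- The derivative `∂x/∂H`. -/
def actionDerivH (P : MomentPolygon n) (a : Fin n → ℝ) (H r : ℝ) : Fin 2 → ℝ :=
  ![r * P.xiDerivR a H r 1, -(r * P.xiDerivR a H r 0)]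

/-- The derivative `∂x/∂r`. -/
def actionDerivR (P : MomentPolygon n) (a : Fin n → ℝ) (nu : Fin 2 → ℝ) (H r : ℝ) : Fin 2 → ℝ :=
  ![-(r * P.xiDerivH a nu H r 1), r * P.xiDerivH a nu H r 0]

theorem hasDerivAt_actionMap_left (H : ℝ) {r : ℝ} (hr : 0 < r) :
    HasDerivAt (fun h => actionMap P a nu c h r) (P.actionDerivH a H r) H := by
  have h := hasDerivAt_actionMap_H P a nu c (H := H) hr
  rw [(hasDerivAt_xi_r P a nu 0 hr).deriv, (hasDerivAt_xi_r P a nu 1 hr).deriv] at h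
  exact h

theorem hasDerivAt_actionMap_right (H : ℝ) {r : ℝ} (hr : 0 < r) :
    HasDerivAt (fun s => actionMap P a nu c H s) (P.actionDerivR a nu H r) r := by
  have h := hasDerivAt_actionMap_r P a nu c (H := H) hr
  rw [(hasDerivAt_xi_H P a nu 0 hr).deriv, (hasDerivAt_xi_H P a nu 1 hr).deriv] at h
  exact h

theorem contDiffAt_actionMap {p : ℝ × ℝ} (hp : 0 < p.2) :
    ContDiffAt ℝ ∞ (fun p : ℝ × ℝ => actionMap P a nu c p.1 p.2) p := by
  have hρ : ∀ i, ContDiffAt ℝ ∞ (fun p : ℝ × ℝ => rho (a i) p.1 p.2) p := fun i => by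
    unfold rho
    refine ContDiffAt.sqrt (by fun_prop) ?_
    have := pow_pos hp 2
    positivity
  rw [contDiffAt_pi]
  intro k
  fin_cases k
  · simp only [actionMap, Fin.zero_eta, Matrix.cons_val_zero]
    fun_prop
  · simp only [actionMap, Fin.mk_one, Matrix.cons_val_one, Matrix.cons_val_zero]
    fun_prop

theorem continuous_actionMap : Continuous fun p : ℝ × ℝ => actionMap P a nu c p.1 p.2 := by
  have hρ : ∀ i, Continuous fun p : ℝ × ℝ => rho (a i) p.1 p.2 := fun i => by
    unfold rho
    fun_prop
  refine continuous_pi fun k => ?_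
  fin_cases k
  · simp only [actionMap, Fin.zero_eta, Matrix.cons_val_zero]
    fun_prop
  · simp only [actionMap, Fin.mk_one, Matrix.cons_val_one, Matrix.cons_val_zero]
    fun_prop

theorem fderiv_actionMap {p : ℝ × ℝ} (hp : 0 < p.2) (s t : ℝ) :
    fderiv ℝ (fun p : ℝ × ℝ => actionMap P a nu c p.1 p.2) p (s, t)
      = s • P.actionDerivH a p.1 p.2 + t • P.actionDerivR a nu p.1 p.2 := by
  have hd : HasFDerivAt (fun p : ℝ × ℝ => actionMap P a nu c p.1 p.2)
      (fderiv ℝ (fun p : ℝ × ℝ => actionMap P a nu c p.1 p.2) p) p :=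
    ((contDiffAt_actionMap hp).differentiableAt (by simp)).hasFDerivAt
  have h1 : HasDerivAt (fun h => actionMap P a nu c h p.2)
      (fderiv ℝ (fun p : ℝ × ℝ => actionMap P a nu c p.1 p.2) p (1, 0)) p.1 :=
    HasFDerivAt.comp_hasDerivAt (f := fun h => (h, p.2)) p.1 hd ((hasDerivAt_id p.1).prodMk
      (hasDerivAt_const p.1 p.2))
  have h2 : HasDerivAt (fun s => actionMap P a nu c p.1 s)
      (fderiv ℝ (fun p : ℝ × ℝ => actionMap P a nu c p.1 p.2) p (0, 1)) p.2 :=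
    HasFDerivAt.comp_hasDerivAt (f := fun s => (p.1, s)) p.2 hd ((hasDerivAt_const p.2 p.1).prodMk
      (hasDerivAt_id p.2))
  have h3 : ((s, t) : ℝ × ℝ) = s • (1, 0) + t • (0, 1) := by simp
  rw [h3, map_add, map_smul, map_smul,
    h1.unique (hasDerivAt_actionMap_left p.1 hp), h2.unique (hasDerivAt_actionMap_right p.1 hp)]

theorem surjective_fderiv_actionMap (hac : Adjusted P a c) (hnu : ∀ j, 0 ≤ det2 nu (P.nu j))
    {p : ℝ × ℝ} (hp : 0 < p.2) :
    Function.Surjective (fderiv ℝ (fun p : ℝ × ℝ => actionMap P a nu c p.1 p.2) p) := by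
  intro v
  have hΔ := P.det2_xiDeriv_pos a nu (P.strictMono_of_adjusted hac) hnu p.1 hp
  set x := P.xiDerivH a nu p.1 p.2 with hx
  set y := P.xiDerivR a p.1 p.2 with hy
  set Δ := det2 x y with hΔdef
  have hΔ' : x 0 * y 1 - x 1 * y 0 = Δ := rfl
  -- Cramer's rule
  refine ⟨((v 0 * x 0 + v 1 * x 1) / (p.2 * Δ), (y 1 * v 1 + y 0 * v 0) / (p.2 * Δ)), ?_⟩
  rw [fderiv_actionMap hp]
  ext k
  fin_cases k
  · simp only [actionDerivH, actionDerivR, Fin.zero_eta, Pi.add_apply, Pi.smul_apply, smul_eq_mul,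
      Matrix.cons_val_zero, ← hx, ← hy]
    field_simp
    rw [← hΔ']
    ring
  · simp only [actionDerivH, actionDerivR, Fin.mk_one, Pi.add_apply, Pi.smul_apply, smul_eq_mul,
      Matrix.cons_val_one, Matrix.cons_val_zero, ← hx, ← hy]
    field_simp
    rw [← hΔ']
    ring

theorem isOpen_image_actionMap (hac : Adjusted P a c) (hnu : ∀ j, 0 ≤ det2 nu (P.nu j)) :
    IsOpen ((fun p : ℝ × ℝ => actionMap P a nu c p.1 p.2) '' {p | 0 < p.2}) := by
  rw [isOpen_iff_mem_nhds]
  rintro _ ⟨p, hp, rfl⟩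
  have hs := (contDiffAt_actionMap (P := P) (a := a) (nu := nu) (c := c) hp).hasStrictFDerivAt
    (by simp)
  have hmap := hs.map_nhds_eq_of_surj
    (LinearMap.range_eq_top.2 (surjective_fderiv_actionMap hac hnu hp))
  rw [← hmap]
  exact Filter.image_mem_map ((isOpen_lt continuous_const continuous_snd).mem_nhds hp)

/-- The action coordinates are onto the interior of the polygon: their image is open by the inverse
function theorem, and relatively closed because `(H, r) ↦ x` is proper and maps the boundary of the
half-plane to the boundary of the polygon. -/
theorem exists_actionMap_eq (hac : Adjusted P a c) (hnu : ∀ j, 0 ≤ det2 nu (P.nu j))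
    {x : Fin 2 → ℝ} (hx : x ∈ interior P.carrier) :
    ∃ H r, 0 < r ∧ actionMap P a nu c H r = x := by
  set F : ℝ × ℝ → Fin 2 → ℝ := fun p => actionMap P a nu c p.1 p.2 with hF
  have hopen : IsOpen (F '' {p | 0 < p.2}) := isOpen_image_actionMap hac hnu
  have hne : (interior P.carrier ∩ F '' {p | 0 < p.2}).Nonempty :=
    ⟨F (0, 1), actionMap_mem_interior hac hnu one_pos, ⟨(0, 1), show (0 : ℝ) < 1 from one_pos, rfl⟩⟩
  have hcl : closure (F '' {p | 0 < p.2}) ∩ interior P.carrier ⊆ F '' {p | 0 < p.2} := by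
    rintro y ⟨hy, hyP⟩
    obtain ⟨A, b, C, hA, hbound⟩ := exists_rho_le hac hnu
    set L : (Fin 2 → ℝ) → ℝ := fun z =>
      ell P.normal P.offset 0 z + ell P.normal P.offset (Fin.last n) z with hL
    have hLc : Continuous L := (P.continuous_ell 0).add (P.continuous_ell (Fin.last n))
    have hN : IsOpen {z | L z < L y + 1} := isOpen_lt hLc continuous_const
    set M := A * (L y + 1) + C with hM
    set K : Set (ℝ × ℝ) := Icc (-M - b) (M - b) ×ˢ Icc 0 M
    have hK : IsCompact K := isCompact_Icc.prod isCompact_Icc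
    have hsub : {z | L z < L y + 1} ∩ F '' {p | 0 < p.2} ⊆ F '' K := by
      rintro _ ⟨hz, p, hp, rfl⟩
      refine ⟨p, ?_, rfl⟩
      have h1 := hbound p.1 p.2 hp
      have h2 : rho b p.1 p.2 ≤ M := by
        refine h1.trans ?_
        have hz' : L (F p) < L y + 1 := hz
        have := mul_le_mul_of_nonneg_left hz'.le hA.le
        rw [hM]
        simp only [hL, hF] at this ⊢
        linarith
      have h3 := abs_le.1 ((abs_le_rho b p.1 p.2).trans h2)
      have h4 : p.2 ≤ rho b p.1 p.2 := by
        unfold rho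
        exact Real.le_sqrt_of_sq_le (by nlinarith [sq_nonneg (p.1 + b)])
      have hp' : 0 < p.2 := hp
      exact ⟨⟨by linarith [h3.1], by linarith [h3.2]⟩, hp'.le, h4.trans h2⟩
    have hyK : y ∈ F '' K := by
      have h1 : y ∈ closure ({z | L z < L y + 1} ∩ F '' {p | 0 < p.2}) :=
        hN.inter_closure ⟨by simp, hy⟩
      exact (hK.image continuous_actionMap).isClosed.closure_subset_iff.2 hsub h1
    obtain ⟨p, hp, rfl⟩ := hyK
    refine ⟨p, lt_of_le_of_ne hp.2.1 fun h0 => ?_, rfl⟩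
    obtain ⟨j, hj⟩ := exists_ell_eq_zero (nu := nu) hac p.1
    rw [P.interior_carrier] at hyP
    have h5 := hyP j
    simp only [hF, ← h0] at h5
    rw [hj] at h5
    exact lt_irrefl _ h5
  obtain ⟨p, hp, hpx⟩ := P.convex_interior_carrier.isPreconnected.subset_of_closure_inter_subset
    hopen hne hcl hx
  exact ⟨p.1, p.2, hp, hpx⟩

end MomentPolygon

/-! ### The Hessian of the symplectic potential -/

namespace IsPotential

variable {n : ℕ} {P : MomentPolygon n} {a : Fin n → ℝ} {nu c : Fin 2 → ℝ}
  {u : (Fin 2 → ℝ) → ℝ}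

theorem contDiffAt (hu : IsPotential P a nu c u) {x : Fin 2 → ℝ} (hx : x ∈ interior P.carrier) :
    ContDiffAt ℝ ∞ u x := hu.smooth.contDiffAt (isOpen_interior.mem_nhds hx)

theorem sum_actionDerivH_mul_hess (hu : IsPotential P a nu c u) (hac : Adjusted P a c)
    (hnu : ∀ j, 0 ≤ det2 nu (P.nu j)) (H : ℝ) {r : ℝ} (hr : 0 < r) (k : Fin 2) :
    ∑ j, P.actionDerivH a H r j * hess u (actionMap P a nu c H r) j k = P.xiDerivH a nu H r k := by
  have hx := MomentPolygon.actionMap_mem_interior hac hnu (H := H) hr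
  have hd := (contDiffAt_dirDeriv (b := actionFrame) (hu.contDiffAt hx) k).differentiableAt
    (by simp)
  have h1 := hd.hasFDerivAt.comp_hasDerivAt H
    (MomentPolygon.hasDerivAt_actionMap_left (P := P) (a := a) (nu := nu) (c := c) H hr)
  have h2 := h1.unique ((hasDerivAt_xi_H P a nu k (H := H) hr).congr_of_eventuallyEq
    (Filter.Eventually.of_forall fun h => hu.grad h r hr k))
  rw [fderiv_apply_eq_sum] at h2
  exact h2

theorem sum_actionDerivR_mul_hess (hu : IsPotential P a nu c u) (hac : Adjusted P a c)
    (hnu : ∀ j, 0 ≤ det2 nu (P.nu j)) (H : ℝ) {r : ℝ} (hr : 0 < r) (k : Fin 2) :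
    ∑ j, P.actionDerivR a nu H r j * hess u (actionMap P a nu c H r) j k
      = P.xiDerivR a H r k := by
  have hx := MomentPolygon.actionMap_mem_interior hac hnu (H := H) hr
  have hd := (contDiffAt_dirDeriv (b := actionFrame) (hu.contDiffAt hx) k).differentiableAt
    (by simp)
  have h1 := hd.hasFDerivAt.comp_hasDerivAt r
    (MomentPolygon.hasDerivAt_actionMap_right (P := P) (a := a) (nu := nu) (c := c) H hr)
  have h2 := h1.unique ((hasDerivAt_xi_r P a nu k (H := H) hr).congr_of_eventuallyEq
    (by filter_upwards [lt_mem_nhds hr] with s hs using hu.grad H s hs k))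
  rw [fderiv_apply_eq_sum] at h2
  exact h2

/-- `U (∂x/∂H) = ∂ξ/∂H` and `U (∂x/∂r) = ∂ξ/∂r`, and by the definition of the action coordinates
`det(∂x/∂H, ∂x/∂r) = r² det(∂ξ/∂H, ∂ξ/∂r)`. So the Hessian determinant of the symplectic
potential is `r⁻²`. -/
theorem det_hess (hu : IsPotential P a nu c u) (hac : Adjusted P a c)
    (hnu : ∀ j, 0 ≤ det2 nu (P.nu j)) (H : ℝ) {r : ℝ} (hr : 0 < r) :
    (hess u (actionMap P a nu c H r)).det = (r ^ 2)⁻¹ := by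
  have hΔ := P.det2_xiDeriv_pos a nu (P.strictMono_of_adjusted hac) hnu H hr
  have h1 := hu.sum_actionDerivH_mul_hess hac hnu H hr
  have h2 := hu.sum_actionDerivR_mul_hess hac hnu H hr
  have h10 := h1 0
  have h11 := h1 1
  have h20 := h2 0
  have h21 := h2 1
  simp only [Fin.sum_univ_two, MomentPolygon.actionDerivH, MomentPolygon.actionDerivR,
    Matrix.cons_val_zero, Matrix.cons_val_one] at h10 h11 h20 h21
  rw [Matrix.det_fin_two]
  generalize hess u (actionMap P a nu c H r) = U at *
  simp only [det2] at hΔ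
  generalize P.xiDerivH a nu H r = x at *
  generalize P.xiDerivR a H r = y at *
  apply eq_inv_of_mul_eq_one_left
  apply mul_left_cancel₀ hΔ.ne'
  have e1 : (r * y 1 * U 0 0 + -(r * y 0) * U 1 0) * (-(r * x 1) * U 0 1 + r * x 0 * U 1 1)
      - (r * y 1 * U 0 1 + -(r * y 0) * U 1 1) * (-(r * x 1) * U 0 0 + r * x 0 * U 1 0)
      = x 0 * y 1 - x 1 * y 0 := by rw [h10, h11, h20, h21]
  linear_combination e1

theorem isHessianLike (hu : IsPotential P a nu c u) (hac : Adjusted P a c)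
    (hnu : ∀ j, 0 ≤ det2 nu (P.nu j)) : IsHessianLike (hess u) (interior P.carrier) where
  isOpen := isOpen_interior
  smooth x hx k l := contDiffAt_dirDeriv (b := actionFrame)
    (contDiffAt_dirDeriv (b := actionFrame) (hu.contDiffAt hx) l) k
  symm x hx k l := dirDeriv_comm (b := actionFrame) (hu.contDiffAt hx) k l
  deriv_symm x hx a k l := dirDeriv_comm (b := actionFrame)
    (contDiffAt_dirDeriv (b := actionFrame) (hu.contDiffAt hx) l) a k
  isUnit_det x hx := by
    obtain ⟨H, r, hr, rfl⟩ := MomentPolygon.exists_actionMap_eq hac hnu hx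
    rw [hu.det_hess hac hnu H hr]
    exact isUnit_iff_ne_zero.2 (by positivity)

/-- The derivative of `log det U = -2 log r` along `∂/∂H`. -/
theorem xiDerivH_dot_logDetField (hu : IsPotential P a nu c u) (hac : Adjusted P a c)
    (hnu : ∀ j, 0 ≤ det2 nu (P.nu j)) (H : ℝ) {r : ℝ} (hr : 0 < r) :
    ∑ b, P.xiDerivH a nu H r b * logDetField (hess u) b (actionMap P a nu c H r) = 0 := by
  have h := hu.isHessianLike hac hnu
  have hx := MomentPolygon.actionMap_mem_interior hac hnu (H := H) hr
  have hd := ((h.smooth _ hx).det.differentiableAt (by simp)).hasFDerivAt.comp_hasDerivAt H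
    (MomentPolygon.hasDerivAt_actionMap_left (P := P) (a := a) (nu := nu) (c := c) H hr)
  have h2 := hd.unique ((hasDerivAt_const H (r ^ 2)⁻¹).congr_of_eventuallyEq
    (Filter.Eventually.of_forall fun h' => hu.det_hess hac hnu h' hr))
  rw [fderiv_apply_eq_sum] at h2
  simp only [h.dirDeriv_det hx, hu.det_hess hac hnu H hr] at h2
  simp only [← hu.sum_actionDerivH_mul_hess hac hnu H hr, h.sum_mul_logDetGrad hx]
  have hr2 : (r ^ 2)⁻¹ ≠ 0 := by positivity
  apply mul_left_cancel₀ hr2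
  rw [mul_zero, Finset.mul_sum, ← h2]
  exact Finset.sum_congr rfl fun j _ => by ring

/-- The derivative of `log det U = -2 log r` along `∂/∂r`. -/
theorem xiDerivR_dot_logDetField (hu : IsPotential P a nu c u) (hac : Adjusted P a c)
    (hnu : ∀ j, 0 ≤ det2 nu (P.nu j)) (H : ℝ) {r : ℝ} (hr : 0 < r) :
    ∑ b, P.xiDerivR a H r b * logDetField (hess u) b (actionMap P a nu c H r) = -2 / r := by
  have h := hu.isHessianLike hac hnu
  have hx := MomentPolygon.actionMap_mem_interior hac hnu (H := H) hr
  have hd := ((h.smooth _ hx).det.differentiableAt (by simp)).hasFDerivAt.comp_hasDerivAt r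
    (MomentPolygon.hasDerivAt_actionMap_right (P := P) (a := a) (nu := nu) (c := c) H hr)
  have h2 := hd.unique (((hasDerivAt_pow 2 r).inv (by positivity)).congr_of_eventuallyEq
    (by filter_upwards [lt_mem_nhds hr] with s hs using hu.det_hess hac hnu H hs))
  rw [fderiv_apply_eq_sum] at h2
  simp only [h.dirDeriv_det hx, hu.det_hess hac hnu H hr] at h2
  simp only [← hu.sum_actionDerivR_mul_hess hac hnu H hr, h.sum_mul_logDetGrad hx]
  have hr2 : (r ^ 2)⁻¹ ≠ 0 := by positivity
  apply mul_left_cancel₀ hr2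
  have h3 : (r ^ 2)⁻¹ * (-2 / r) = -(((2 : ℕ) : ℝ) * r ^ (2 - 1)) / (r ^ 2) ^ 2 := by
    field_simp
    norm_num
    ring
  rw [h3, Finset.mul_sum, ← h2]
  exact Finset.sum_congr rfl fun j _ => by ring

end IsPotential

/-! ### Constancy of the vector field and the normals -/

namespace MomentPolygon

variable {n : ℕ} {P : MomentPolygon n} {a : Fin n → ℝ} {nu : Fin 2 → ℝ}

theorem dotProduct_xiDerivH (η : Fin 2 → ℝ) (H r : ℝ) :
    η ⬝ᵥ P.xiDerivH a nu H r
      = (1 / 2) * ∑ i : Fin n, (η ⬝ᵥ P.nu i.succ - η ⬝ᵥ P.nu i.castSucc) * (1 / rho (a i) H r)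
        + η ⬝ᵥ nu := by
  have h : ∑ i : Fin n, (η ⬝ᵥ P.nu i.succ - η ⬝ᵥ P.nu i.castSucc) * (1 / rho (a i) H r)
      = η 0 * ∑ i : Fin n, (P.nu i.succ 0 - P.nu i.castSucc 0) * (1 / rho (a i) H r)
        + η 1 * ∑ i : Fin n, (P.nu i.succ 1 - P.nu i.castSucc 1) * (1 / rho (a i) H r) := by
    simp only [Finset.mul_sum, ← Finset.sum_add_distrib, dotProduct, Fin.sum_univ_two]
    exact Finset.sum_congr rfl fun i _ => by ring
  rw [h]
  simp only [dotProduct, Fin.sum_univ_two, xiDerivH]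
  ring

theorem dotProduct_xiDerivR (η : Fin 2 → ℝ) (H r : ℝ) :
    η ⬝ᵥ P.xiDerivR a H r
      = η ⬝ᵥ P.nu 0 / r
        + (1 / 2) * ∑ i : Fin n, (η ⬝ᵥ P.nu i.succ - η ⬝ᵥ P.nu i.castSucc) *
          ((1 - (H + a i) / rho (a i) H r) / r) := by
  have h : ∑ i : Fin n, (η ⬝ᵥ P.nu i.succ - η ⬝ᵥ P.nu i.castSucc) *
        ((1 - (H + a i) / rho (a i) H r) / r)
      = η 0 * ∑ i : Fin n, (P.nu i.succ 0 - P.nu i.castSucc 0) *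
          ((1 - (H + a i) / rho (a i) H r) / r)
        + η 1 * ∑ i : Fin n, (P.nu i.succ 1 - P.nu i.castSucc 1) *
          ((1 - (H + a i) / rho (a i) H r) / r) := by
    simp only [Finset.mul_sum, ← Finset.sum_add_distrib, dotProduct, Fin.sum_univ_two]
    exact Finset.sum_congr rfl fun i _ => by ring
  rw [h]
  simp only [dotProduct, Fin.sum_univ_two, xiDerivR]
  ring

/-- The functions `1 / ρ_i` with distinct `a_i` are linearly independent modulo constants: at
`H = -a_i` only `1 / ρ_i` is singular as `r → 0`. -/
theorem eq_zero_of_sum_div_rho (ha : StrictMono a) {β : Fin n → ℝ} {μ : ℝ}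
    (h : ∀ H r : ℝ, 0 < r → ∑ k, β k * (1 / rho (a k) H r) = μ) (i : Fin n) : β i = 0 := by
  have hlim : Filter.Tendsto (fun r : ℝ => r * ∑ k, β k * (1 / rho (a k) (-a i) r))
      (𝓝[>] 0) (𝓝 (∑ k, if k = i then β k else 0)) := by
    simp only [Finset.mul_sum]
    refine tendsto_finsetSum _ fun k _ => ?_
    split_ifs with hk
    · subst hk
      refine tendsto_const_nhds.congr' ?_
      filter_upwards [self_mem_nhdsWithin] with r hr
      have hr : 0 < r := hr
      have h1 : rho (a k) (-a k) r = r := by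
        unfold rho
        rw [neg_add_cancel, zero_pow two_ne_zero, zero_add, Real.sqrt_sq hr.le]
      rw [h1]
      field_simp
    · have hne : rho (a k) (-a i) 0 ≠ 0 := by
        have h2 : -a i + a k ≠ 0 := fun h0 => hk (ha.injective (by linarith))
        unfold rho
        have := pow_pos (abs_pos.2 h2) 2
        rw [sq_abs] at this
        positivity
      have hc : ContinuousAt (fun r : ℝ => r * (β k * (1 / rho (a k) (-a i) r))) 0 := by
        refine continuousAt_id.mul (continuousAt_const.mul (continuousAt_const.div ?_ hne))
        unfold rho
        fun_prop
      have h3 := hc.tendsto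
      rw [zero_mul] at h3
      exact h3.mono_left nhdsWithin_le_nhds
  have hlim0 : Filter.Tendsto (fun r : ℝ => r * ∑ k, β k * (1 / rho (a k) (-a i) r))
      (𝓝[>] 0) (𝓝 0) := by
    have h1 : Filter.Tendsto (fun r : ℝ => r * μ) (𝓝[>] 0) (𝓝 0) := by
      have h2 : ContinuousAt (fun r : ℝ => r * μ) 0 := by fun_prop
      have h3 := h2.tendsto
      rw [zero_mul] at h3
      exact h3.mono_left nhdsWithin_le_nhds
    refine h1.congr' ?_
    filter_upwards [self_mem_nhdsWithin] with r hr
    rw [h _ r hr]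
  simpa using tendsto_nhds_unique hlim hlim0

/-- The dot products of `η` with the derivatives of `ξ` are `0` and `1 / r` exactly when `η`
pairs to `1` with all normals and to `0` with `ν`. -/
theorem dotProduct_xiDeriv_iff (ha : StrictMono a) (η : Fin 2 → ℝ) :
    (∀ H r : ℝ, 0 < r → η ⬝ᵥ P.xiDerivH a nu H r = 0 ∧ η ⬝ᵥ P.xiDerivR a H r = 1 / r) ↔
      (∀ j, η ⬝ᵥ P.nu j = 1) ∧ η ⬝ᵥ nu = 0 := by
  simp only [dotProduct_xiDerivH, dotProduct_xiDerivR]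
  constructor
  · intro h
    have hβ : ∀ i : Fin n, η ⬝ᵥ P.nu i.succ - η ⬝ᵥ P.nu i.castSucc = 0 :=
      eq_zero_of_sum_div_rho ha (μ := -2 * (η ⬝ᵥ nu)) fun H r hr => by
        linear_combination 2 * (h H r hr).1
    have h1 := h 0 1 one_pos
    simp only [hβ, zero_mul, Finset.sum_const_zero, mul_zero, zero_add, add_zero, div_one] at h1
    exact ⟨fun j => Fin.induction h1.2 (fun i hi => by linarith [hβ i]) j, h1.1⟩
  · rintro ⟨h1, h0⟩ H r -
    simp [h1, h0]

end MomentPolygon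

namespace IsPotential

variable {n : ℕ} {P : MomentPolygon n} {a : Fin n → ℝ} {nu c : Fin 2 → ℝ}
  {u : (Fin 2 → ℝ) → ℝ}

/-- If `η` pairs to `1` with all normals and to `0` with `ν`, then `log det` of the Hessian of the
potential is `-2 ⟨η, ∇u⟩` up to a constant. -/
theorem logDetField_eq (hu : IsPotential P a nu c u) (hac : Adjusted P a c)
    (hnu : ∀ j, 0 ≤ det2 nu (P.nu j)) {η : Fin 2 → ℝ} (h1 : ∀ j, η ⬝ᵥ P.nu j = 1)
    (h0 : η ⬝ᵥ nu = 0) {x : Fin 2 → ℝ} (hx : x ∈ interior P.carrier) (j : Fin 2) :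
    logDetField (hess u) j x = -2 * η j := by
  obtain ⟨H, r, hr, rfl⟩ := MomentPolygon.exists_actionMap_eq hac hnu hx
  have ha := P.strictMono_of_adjusted hac
  have hΔ := P.det2_xiDeriv_pos a nu ha hnu H hr
  obtain ⟨e1, e2⟩ := (MomentPolygon.dotProduct_xiDeriv_iff ha η).2 ⟨h1, h0⟩ H r hr
  have e3 := hu.xiDerivH_dot_logDetField hac hnu H hr
  have e4 := hu.xiDerivR_dot_logDetField hac hnu H hr
  simp only [dotProduct, Fin.sum_univ_two] at e1 e2 e3 e4
  simp only [det2] at hΔ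
  have e5 : (-2 : ℝ) / r = -2 * (1 / r) := by ring
  rw [e5] at e4
  apply mul_left_cancel₀ hΔ.ne'
  -- Cramer's rule
  fin_cases j
  · simp only [Fin.zero_eta]
    linear_combination P.xiDerivR a H r 1 * (e3 + 2 * e1) - P.xiDerivH a nu H r 1 * (e4 + 2 * e2)
  · simp only [Fin.mk_one]
    linear_combination P.xiDerivH a nu H r 0 * (e4 + 2 * e2) - P.xiDerivR a H r 0 * (e3 + 2 * e1)

/-- The vector field `logDetField` is constant on the interior of the polygon exactly when the
normals lie on a line not through the origin and `ν` is parallel to that line. -/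
theorem dirDeriv_logDetField_eq_zero_iff (hu : IsPotential P a nu c u) (hac : Adjusted P a c)
    (hnu : ∀ j, 0 ≤ det2 nu (P.nu j)) :
    (∀ x ∈ interior P.carrier, ∀ i j, dirDeriv actionFrame i (logDetField (hess u) j) x = 0) ↔
      ∃ η : Fin 2 → ℝ, η ≠ 0 ∧ (∀ j : Fin (n + 1), η ⬝ᵥ P.nu j = 1) ∧ η ⬝ᵥ nu = 0 := by
  have h := hu.isHessianLike hac hnu
  constructor
  · intro h0
    have hconst : ∀ j, ∃ C, ∀ x ∈ interior P.carrier, logDetField (hess u) j x = C := fun j =>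
      isOpen_interior.exists_is_const_of_fderiv_eq_zero
        P.convex_interior_carrier.isPreconnected
        (fun x hx => ((h.contDiffAt_logDetField hx j).differentiableAt
          (by simp)).differentiableWithinAt)
        fun x hx => by
          ext v
          rw [fderiv_apply_eq_sum]
          simp [h0 x hx]
    choose C hC using hconst
    set η : Fin 2 → ℝ := fun j => -(1 / 2) * C j with hη
    have key := (MomentPolygon.dotProduct_xiDeriv_iff (P := P) (nu := nu)
      (P.strictMono_of_adjusted hac) η).1 fun H r hr => by
        have hx := MomentPolygon.actionMap_mem_interior hac hnu (H := H) hr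
        have e3 := hu.xiDerivH_dot_logDetField hac hnu H hr
        have e4 := hu.xiDerivR_dot_logDetField hac hnu H hr
        simp only [hC _ _ hx, Fin.sum_univ_two] at e3 e4
        simp only [dotProduct, Fin.sum_univ_two, hη]
        have e5 : (-2 : ℝ) / r = -2 * (1 / r) := by ring
        exact ⟨by linear_combination -(1 / 2) * e3, by
          linear_combination -(1 / 2) * e4 - (1 / 2) * e5⟩
    refine ⟨η, fun hz => ?_, key⟩
    have h1 := key.1 0
    rw [hz, zero_dotProduct] at h1
    exact zero_ne_one h1
  · rintro ⟨η, -, h1, h0⟩ x hx i j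
    have he : logDetField (hess u) j =ᶠ[𝓝 x] fun _ => -2 * η j := by
      filter_upwards [isOpen_interior.mem_nhds hx] with z hz
      exact hu.logDetField_eq hac hnu h1 h0 hz j
    rw [dirDeriv_congr he]
    simp [dirDeriv]

end IsPotential

end ToricRicci

end

theorem lemma6p2 {n : ℕ} (P : ToricRicci.MomentPolygon n)
    (a : Fin n → ℝ) (c : Fin 2 → ℝ) (hac : ToricRicci.Adjusted P a c)
    (nu : Fin 2 → ℝ) (hnu_first : 0 ≤ ToricRicci.det2 nu (P.nu 0))
    (hnu_last : 0 ≤ ToricRicci.det2 nu (P.nu (Fin.last n)))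
    (u : (Fin 2 → ℝ) → ℝ) (hu : ToricRicci.IsPotential P a nu c u)
    {X : Type*} [TopologicalSpace X] [ChartedSpace (EuclideanSpace ℝ (Fin 4)) X]
    [IsManifold (𝓡 4) ∞ X]
    (g : Bundle.ContMDiffRiemannianMetric (𝓡 4) ∞ (EuclideanSpace ℝ (Fin 4))
      (fun p : X => TangentSpace (𝓡 4) p))
    (Φ : (Fin 2 → ℝ) × (Fin 2 → ℝ) → X) (hΦ : ToricRicci.IsActionAngle P u g Φ) :
    ToricRicci.RicciFlat g ↔
      ∃ η : Fin 2 → ℝ, η ≠ 0 ∧ (∀ j : Fin (n + 1), η ⬝ᵥ P.nu j = 1) ∧ η ⬝ᵥ nu = 0 := by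
  have hnu := P.det2_nu_nonneg_of_ends hnu_first hnu_last
  rw [hΦ.ricciFlat_iff (hu.isHessianLike hac hnu)]
  exact hu.dirDeriv_logDetField_eq_zero_iff hac hnu
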